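/- **Setting.** Let $\Omega\subset\mathbb R^2$ be a bounded polygonal domain with a conforming triangulation $\mathcal T_h$ (so $\Omega$ is the interior of the union of the finitely many closed triangles). Let $\Gamma\subset\Omega$ be a smooth simple closed curve, not touching $\partial\Omega$, which separates $\Omega$ into two open sets $\Omega^-$ and $\Omega^+$, that is, $\Omega\setminus\Gamma=\Omega^-\cup\Omega^+$ is a disjoint union and $\Gamma$ lies in the boundary of both. Let $\beta^\pm>0$ and $\mu^\pm>0$ be constants. A triangle $T\in\mathcal T_h$ is an *interface element* if $\Gamma$ meets its interior. Assume that for every interface element $T$ the curve $\Gamma$ meets $\partial T$ in exactly two points $D\neq E$, which lie on two different edges, that the chord $\Gamma_h^T=DE$ separates the vertices of $T$ adjacent to $T\cap\Omega^-$ from those adjacent to $T\cap\Omega^+$, and that $T$ has no obtuse angle. Let $T_h^\pm$ be the two parts into which the chord cuts $T$, with $T_h^\pm$ on the side of the vertices adjacent to $T\cap\Omega^\pm$, let $X_m$ be the midpoint of the chord, and let $\bar{\mathbf t},\bar{\mathbf n}$ be its unit tangential and normal vectors. For $\mathbf v=(v_1,v_2)$ put $\operatorname{curl}\mathbf v=\partial_{x_1}v_2-\partial_{x_2}v_1$.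 **Spaces.** $\widetilde H^2_0(\Omega)$ is the space of functions $v$ with $v|_{\Omega^\pm}\in H^2(\Omega^\pm)$ (identified with their continuous representatives), with $v=0$ on $\partial\Omega$, and with $v^+=v^-$ and $\beta^+\nabla v^+\cdot\mathbf n=\beta^-\nabla v^-\cdot\mathbf n$ on $\Gamma$. Let $\mathcal{ND}=\{\mathbf a+b(x_2,-x_1)^t:\mathbf a\in\mathbb R^2,\ b\in\mathbb R\}$. If $T$ is not an interface element, then $\mathcal{IND}_h(T)=\mathcal{ND}|_T$ and $\widetilde S_h(T)=\mathbb P_1(T)$. If $T$ is an interface element, then $\mathcal{IND}_h(T)$ consists of the fields that equal $\mathbf z^\pm\in\mathcal{ND}$ on $T_h^\pm$, where at $X_m$ $$\mathbf z^+\cdot\bar{\mathbf t}=\mathbf z^-\cdot\bar{\mathbf t},\qquad \tfrac1{\mu^+}\operatorname{curl}\mathbf z^+=\tfrac1{\mu^-}\operatorname{curl}\mathbf z^-,\qquad \beta^+\mathbf z^+\cdot\bar{\mathbf n}=\beta^-\mathbf z^-\cdot\bar{\mathbf n},$$ and $\widetilde S_h(T)$ consists of the functions that equal $z^\pm\in\mathbb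 P_1$ on $T_h^\pm$, where $z^+=z^-$ and $\beta^+\nabla z^+\cdot\bar{\mathbf n}=\beta^-\nabla z^-\cdot\bar{\mathbf n}$ on $\Gamma_h^T$. $\widetilde S_h(\Omega)$ is the space of functions that are piecewise in $\widetilde S_h(T)$ and continuous at the mesh nodes, and $\mathcal{IND}_h(\Omega)$ is the space of fields $\mathbf z$ that are piecewise in $\mathcal{IND}_h(T)$ with $\int_e[\mathbf z\cdot\mathbf t]_e\,ds=0$ on every interior edge $e$. The subspaces with zero trace, respectively zero tangential trace, on $\partial\Omega$ are $\widetilde S_{h,0}(\Omega)$ and $\mathcal{IND}_{h,0}(\Omega)$. **Interpolations.** $\tilde I_hv\in\widetilde S_h(\Omega)$ is the function with $\tilde I_hv(A)=v(A)$ at every mesh node $A$, and $\widetilde\Pi_h\mathbf u\in\mathcal{IND}_h(\Omega)$ is the field with $\int_e\widetilde\Pi_h\mathbf u\cdot\mathbf t\,ds=\int_e\mathbf u\cdot\mathbf t\,ds$ for every mesh edge $e$, where $\mathbf u\cdot\mathbf t$ on $e$ is the tangential trace of $\mathbf u$. **Claim.** For every $v\in\widetilde H^2_0(\Omega)$ the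 interpolants $\tilde I_hv$ and $\widetilde\Pi_h(\nabla v)$ exist and are unique, they belong to $\widetilde S_{h,0}(\Omega)$ and $\mathcal{IND}_{h,0}(\Omega)$, respectively, and, with the gradient on the right taken on each triangle (on each part $T_h^\pm$ of an interface element), $$\widetilde\Pi_h(\nabla v)=\nabla(\tilde I_hv).$$ -/

import Mathlib

namespace IFE

open MeasureTheory Set
open scoped ContDiff

noncomputable section

/-- The Euclidean plane. -/
abbrev Plane : Type := EuclideanSpace ℝ (Fin 2)

/-! ### Weak derivatives and Sobolev spaces -/

/-- The `j`-th partial derivative of `f` at `x`. -/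
def pd {F : Type*} [NormedAddCommGroup F] [NormedSpace ℝ F] (j : Fin 2) (f : Plane → F)
    (x : Plane) : F :=
  fderiv ℝ f x (EuclideanSpace.single j 1)

/-- Smooth compactly supported functions on the plane. -/
def IsTest (φ : Plane → ℝ) : Prop := ContDiff ℝ ∞ φ ∧ HasCompactSupport φ

/-- `g` is the weak partial derivative `∂_j f` in the open set `U`. -/
structure HasWeakPartial (U : Set Plane) (j : Fin 2) (f g : Plane → ℝ) : Prop where
  locInt : LocallyIntegrableOn f U
  locInt' : LocallyIntegrableOn g U
  eq : ∀ φ, IsTest φ → tsupport φ ⊆ U → ∫ x in U, f x * pd j φ x = -∫ x in U, g x * φ x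

/-- `G` is the weak gradient of `f` in `U`. -/
def HasWeakGrad (U : Set Plane) (f : Plane → ℝ) (G : Plane → Plane) : Prop :=
  ∀ j, HasWeakPartial U j f fun x => G x j

/-- `c` is the weak (scalar) curl `∂₁ u₂ - ∂₂ u₁` of `u` in `U`. -/
structure HasWeakCurl (U : Set Plane) (u : Plane → Plane) (c : Plane → ℝ) : Prop where
  locInt : LocallyIntegrableOn u U
  locInt' : LocallyIntegrableOn c U
  eq : ∀ φ, IsTest φ → tsupport φ ⊆ U →
    ∫ x in U, (u x 1 * pd 0 φ x - u x 0 * pd 1 φ x) = -∫ x in U, c x * φ x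

/-- `d` is the weak divergence of `u` in `U`. -/
structure HasWeakDiv (U : Set Plane) (u : Plane → Plane) (d : Plane → ℝ) : Prop where
  locInt : LocallyIntegrableOn u U
  locInt' : LocallyIntegrableOn d U
  eq : ∀ φ, IsTest φ → tsupport φ ⊆ U →
    ∫ x in U, (u x 0 * pd 0 φ x + u x 1 * pd 1 φ x) = -∫ x in U, d x * φ x

/-- The Sobolev space `H¹(U)`. -/
def MemH1 (U : Set Plane) (f : Plane → ℝ) : Prop :=
  MemLp f 2 (volume.restrict U) ∧
    ∀ j, ∃ g, MemLp g 2 (volume.restrict U) ∧ HasWeakPartial U j f g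

/-- The Sobolev space `H²(U)`. -/
def MemH2 (U : Set Plane) (f : Plane → ℝ) : Prop :=
  MemLp f 2 (volume.restrict U) ∧ ∀ j, ∃ g, MemH1 U g ∧ HasWeakPartial U j f g

/-! ### Triangulations -/

/-- A conforming triangulation; `A i k` is the `k`-th vertex of the `i`-th triangle. Two triangles
meet in a common edge, a common vertex, or not at all. -/
structure Mesh (ι : Type*) where
  A : ι → Fin 3 → Plane
  affineIndep : ∀ i, AffineIndependent ℝ (A i)
  injective : Function.Injective fun i => range (A i)
  conforming : ∀ i j, convexHull ℝ (range (A i)) ∩ convexHull ℝ (range (A j)) =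
    convexHull ℝ (range (A i) ∩ range (A j))

variable {ι : Type*}

/-- The `i`-th closed triangle `T`. -/
def Mesh.tri (M : Mesh ι) (i : ι) : Set Plane := convexHull ℝ (range (M.A i))

/-- The edge of the `i`-th triangle opposite to its `k`-th vertex. -/
def Mesh.edge (M : Mesh ι) (i : ι) (k : Fin 3) : Set Plane :=
  segment ℝ (M.A i (k + 1)) (M.A i (k + 2))

/-- The polygonal domain `Ω` that is triangulated. -/
def Mesh.domain (M : Mesh ι) : Set Plane := interior (⋃ i, M.tri i)

/-- No angle of the `i`-th triangle exceeds `π / 2`. -/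
def Mesh.NonObtuse (M : Mesh ι) (i : ι) : Prop :=
  ∀ k : Fin 3, 0 ≤ inner ℝ (M.A i (k + 1) - M.A i k) (M.A i (k + 2) - M.A i k)

/-! ### The interface and the way it cuts the mesh -/

/-- A smooth simple closed curve `Γ`, parametrized by the `1`-periodic `γ`, which stays away from
`∂Ω` and separates `Ω` into `Ω⁻` and `Ω⁺`. A triangle whose interior meets `Γ` is an interface
element; `Γ` meets the boundary of such an element `T` in exactly two points `D ≠ E` on two
different edges, and the chord `DE` (which approximates `Γ ∩ T`) cuts `T` into `T_h⁻` and `T_h⁺`.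
The unit normal `n` of the chord points from the side of `T_h⁻` to the side of `T_h⁺`: the vertices
of `T` adjacent to `T ∩ Ω⁻` lie on the former, those adjacent to `T ∩ Ω⁺` on the latter.
The values of `D`, `E`, `n` on the other triangles play no role. -/
structure Interface (M : Mesh ι) where
  γ : ℝ → Plane
  smooth : ContDiff ℝ ∞ γ
  regular : ∀ t, deriv γ t ≠ 0
  periodic : Function.Periodic γ 1
  simple : InjOn γ (Ico 0 1)
  Ωm : Set Plane
  Ωp : Set Plane
  isOpen_m : IsOpen Ωm
  isOpen_p : IsOpen Ωp
  disjoint : Disjoint Ωm Ωp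
  subset_domain : range γ ⊆ M.domain
  union : Ωm ∪ Ωp = M.domain \ range γ
  frontier_m : range γ ⊆ frontier Ωm
  frontier_p : range γ ⊆ frontier Ωp
  D : ι → Plane
  E : ι → Plane
  n : ι → Plane
  ne : ∀ i, (range γ ∩ interior (M.tri i)).Nonempty → D i ≠ E i
  inter : ∀ i, (range γ ∩ interior (M.tri i)).Nonempty →
    range γ ∩ frontier (M.tri i) = {D i, E i}
  edges : ∀ i, (range γ ∩ interior (M.tri i)).Nonempty →
    ∃ k l, k ≠ l ∧ D i ∈ M.edge i k ∧ E i ∈ M.edge i l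
  unit : ∀ i, (range γ ∩ interior (M.tri i)).Nonempty → ‖n i‖ = 1
  normal : ∀ i, (range γ ∩ interior (M.tri i)).Nonempty → inner ℝ (E i - D i) (n i) = 0
  side_m : ∀ i, (range γ ∩ interior (M.tri i)).Nonempty → ∀ k,
    M.A i k ∈ closure (interior (M.tri i) ∩ Ωm) → inner ℝ (M.A i k - D i) (n i) ≤ 0
  side_p : ∀ i, (range γ ∩ interior (M.tri i)).Nonempty → ∀ k,
    M.A i k ∈ closure (interior (M.tri i) ∩ Ωp) → 0 ≤ inner ℝ (M.A i k - D i) (n i)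

variable {M : Mesh ι}

/-- The interface `Γ`. -/
def Interface.curve (S : Interface M) : Set Plane := range S.γ

/-- The `i`-th triangle is an interface element. -/
def Interface.IsCut (S : Interface M) (i : ι) : Prop :=
  (S.curve ∩ interior (M.tri i)).Nonempty

/-- The midpoint `X_m` of the chord. -/
def Interface.mid (S : Interface M) (i : ι) : Plane := midpoint ℝ (S.D i) (S.E i)

/-- Signed distance from the chord, negative in `T_h⁻` and positive in `T_h⁺`. -/
def Interface.level (S : Interface M) (i : ι) (x : Plane) : ℝ := inner ℝ (x - S.D i) (S.n i)

/-- `f` is `fm` on `T_h⁻` (with the chord), `fp` on `T_h⁺`, and it is extended by zero outside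
the triangle `T`. -/
def Interface.IsGlued {F : Type*} [Zero F] (S : Interface M) (i : ι) (fm fp f : Plane → F) :
    Prop :=
  (∀ x ∈ M.tri i, S.level i x ≤ 0 → f x = fm x) ∧
  (∀ x ∈ M.tri i, 0 < S.level i x → f x = fp x) ∧
  (∀ x ∉ M.tri i, f x = 0)

/-! ### The broken space of scalar functions -/

/-- The space of functions that are `H²` on `Ω⁻` and on `Ω⁺`, vanish on `∂Ω`, and satisfy
`v⁺ = v⁻` and `β⁺ ∇v⁺ · n = β⁻ ∇v⁻ · n` on `Γ`. Functions in `H²` of the two subdomains are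
identified with their continuous representatives, so that the first jump condition says that `v`
is continuous on `closure Ω`, and the boundary condition is pointwise. The normal traces of
`∇v⁻` and `∇v⁺` on `Γ` are given by Green's formula: the pairing of the outward normal trace of
`G` from `U` with `φ` is `∫_U (G · ∇φ + (div G) φ)`; the outward normals of `Ω⁻` and `Ω⁺` on `Γ`
are opposite. -/
structure Interface.MemH2Zero (S : Interface M) (βm βp : ℝ) (v : Plane → ℝ) : Prop where
  cont : ContinuousOn v (closure M.domain)
  zero : ∀ x ∈ frontier M.domain, v x = 0
  memH2_m : MemH2 S.Ωm v
  memH2_p : MemH2 S.Ωp v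
  flux : ∃ (G : Plane → Plane) (d : Plane → ℝ),
    MemLp G 2 (volume.restrict (S.Ωm ∪ S.Ωp)) ∧ MemLp d 2 (volume.restrict (S.Ωm ∪ S.Ωp)) ∧
    HasWeakGrad (S.Ωm ∪ S.Ωp) v G ∧ HasWeakDiv (S.Ωm ∪ S.Ωp) G d ∧
    ∀ φ, IsTest φ → tsupport φ ⊆ M.domain →
      βm * (∫ x in S.Ωm, (G x 0 * pd 0 φ x + G x 1 * pd 1 φ x + d x * φ x)) +
      βp * (∫ x in S.Ωp, (G x 0 * pd 0 φ x + G x 1 * pd 1 φ x + d x * φ x)) = 0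

/-! ### Edge integrals of tangential components -/

/-- `∫_e u · t ds` over the segment `e` from `P` to `Q`, with `t` oriented from `P` to `Q`. -/
def lineInt (P Q : Plane) (u : Plane → Plane) : ℝ :=
  ∫ s in (0 : ℝ)..1, inner ℝ (u (AffineMap.lineMap P Q s)) (Q - P)

/-- `a₁ b₂ - a₂ b₁`. -/
def cross (a b : Plane) : ℝ := a 0 * b 1 - a 1 * b 0

/-- `τ` is the tangential trace of `u` from within the `i`-th triangle `T` on the edge `PQ`
opposite to its vertex `R`: `τ s = u · (Q - P)` at `P + s (Q - P)`, in the sense of Green's formula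
`∫_{T ∖ Γ} ((curl u) φ + u₂ ∂₁φ - u₁ ∂₂φ) = ± ∫_{PQ} φ u · t ds` for test functions `φ` supported
away from the other two edges and from `Γ ∩ T`; the sign is `+` if `P, Q, R` is
counterclockwise. -/
def Interface.HasEdgeTrace (S : Interface M) (i : ι) (k : Fin 3) (u : Plane → Plane)
    (τ : ℝ → ℝ) : Prop :=
  IntervalIntegrable τ volume 0 1 ∧
  IntegrableOn u (interior (M.tri i) \ S.curve) ∧
  ∃ c : Plane → ℝ, IntegrableOn c (interior (M.tri i) \ S.curve) ∧
    HasWeakCurl (interior (M.tri i) \ S.curve) u c ∧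
    ∀ φ, IsTest φ →
      Disjoint (tsupport φ)
        (M.edge i (k + 1) ∪ M.edge i (k + 2) ∪ closure (S.curve ∩ interior (M.tri i))) →
      ∫ x in interior (M.tri i) \ S.curve,
          (c x * φ x + (u x 1 * pd 0 φ x - u x 0 * pd 1 φ x)) =
        Real.sign (cross (M.A i (k + 2) - M.A i (k + 1)) (M.A i k - M.A i (k + 1))) *
          ∫ s in (0 : ℝ)..1, τ s * φ (AffineMap.lineMap (M.A i (k + 1)) (M.A i (k + 2)) s)

/-- `∫_e u · t ds = I` for the `k`-th edge `e` of the `i`-th triangle, oriented from its vertex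
`k + 1` to its vertex `k + 2`, where `u · t` is the tangential trace. -/
def Interface.HasEdgeIntegral (S : Interface M) (i : ι) (k : Fin 3) (u : Plane → Plane)
    (I : ℝ) : Prop :=
  ∃ τ, S.HasEdgeTrace i k u τ ∧ ∫ s in (0 : ℝ)..1, τ s = I

/-! ### Immersed finite element spaces

Piecewise functions on the mesh are families, indexed by the triangles, of functions on the
triangles (extended by zero). -/

/-- Pointwise scalar curl. -/
def curl (u : Plane → Plane) (x : Plane) : ℝ := pd 0 u x 1 - pd 1 u x 0

/-- The lowest order Nédélec fields `a + b [x₂, -x₁]`. -/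
def IsND (u : Plane → Plane) : Prop :=
  ∃ (a : Plane) (b : ℝ), ∀ x, u x = a + b • !₂[x 1, -x 0]

/-- Affine functions. -/
def IsP1 (f : Plane → ℝ) : Prop := ∃ (c : ℝ) (g : Plane), ∀ x, f x = c + inner ℝ g x

/-- The local immersed Nédélec space. -/
def Interface.MemINDLoc (S : Interface M) (βm βp μm μp : ℝ) (i : ι) (z : Plane → Plane) : Prop :=
  (S.IsCut i → ∃ zm zp, IsND zm ∧ IsND zp ∧
    inner ℝ (zp (S.mid i)) (S.E i - S.D i) = inner ℝ (zm (S.mid i)) (S.E i - S.D i) ∧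
    μp⁻¹ * curl zp (S.mid i) = μm⁻¹ * curl zm (S.mid i) ∧
    βp * inner ℝ (zp (S.mid i)) (S.n i) = βm * inner ℝ (zm (S.mid i)) (S.n i) ∧
    S.IsGlued i zm zp z) ∧
  (¬ S.IsCut i → ∃ p, IsND p ∧ (∀ x ∈ M.tri i, z x = p x) ∧ ∀ x ∉ M.tri i, z x = 0)

/-- The local immersed linear space. -/
def Interface.MemSLoc (S : Interface M) (βm βp : ℝ) (i : ι) (w : Plane → ℝ) : Prop :=
  (S.IsCut i → ∃ wm wp, IsP1 wm ∧ IsP1 wp ∧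
    (∀ x ∈ segment ℝ (S.D i) (S.E i), wp x = wm x ∧
      βm * inner ℝ (gradient wm x) (S.n i) = βp * inner ℝ (gradient wp x) (S.n i)) ∧
    S.IsGlued i wm wp w) ∧
  (¬ S.IsCut i → ∃ p, IsP1 p ∧ (∀ x ∈ M.tri i, w x = p x) ∧ ∀ x ∉ M.tri i, w x = 0)

/-- The global immersed Nédélec space: on common edges of two triangles the integrals of the
tangential components agree. -/
def Interface.MemIND (S : Interface M) (βm βp μm μp : ℝ) (z : ι → Plane → Plane) : Prop :=
  (∀ i, S.MemINDLoc βm βp μm μp i (z i)) ∧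
  ∀ i j, ∀ P ∈ range (M.A i) ∩ range (M.A j), ∀ Q ∈ range (M.A i) ∩ range (M.A j),
    lineInt P Q (z i) = lineInt P Q (z j)

/-- The subspace with zero tangential trace on `∂Ω`. -/
def Interface.MemINDZero (S : Interface M) (βm βp μm μp : ℝ) (z : ι → Plane → Plane) : Prop :=
  S.MemIND βm βp μm μp z ∧
  ∀ i k, M.edge i k ⊆ frontier M.domain →
    ∀ x ∈ openSegment ℝ (M.A i (k + 1)) (M.A i (k + 2)),
    inner ℝ (z i x) (M.A i (k + 2) - M.A i (k + 1)) = 0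

/-- The global immersed linear space, continuous at the mesh nodes. -/
def Interface.MemS (S : Interface M) (βm βp : ℝ) (w : ι → Plane → ℝ) : Prop :=
  (∀ i, S.MemSLoc βm βp i (w i)) ∧
  ∀ i j, ∀ P ∈ range (M.A i) ∩ range (M.A j), w i P = w j P

/-- The subspace with zero trace on `∂Ω`. -/
def Interface.MemSZero (S : Interface M) (βm βp : ℝ) (w : ι → Plane → ℝ) : Prop :=
  S.MemS βm βp w ∧
  ∀ i k, M.edge i k ⊆ frontier M.domain → ∀ x ∈ M.edge i k, w i x = 0

/-- `w` is the nodal interpolant of `v`. -/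
def Interface.IsNodalInterp (S : Interface M) (βm βp : ℝ) (v : Plane → ℝ) (w : ι → Plane → ℝ) :
    Prop :=
  S.MemS βm βp w ∧ ∀ i k, w i (M.A i k) = v (M.A i k)

/-- `z` is the edge interpolant of `u`: `∫_e z · t ds = ∫_e u · t ds` for all edges `e`. -/
def Interface.IsEdgeInterp (S : Interface M) (βm βp μm μp : ℝ) (u : Plane → Plane)
    (z : ι → Plane → Plane) : Prop :=
  S.MemIND βm βp μm μp z ∧
  ∀ i k, S.HasEdgeIntegral i k u (lineInt (M.A i (k + 1)) (M.A i (k + 2)) (z i))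

/-- `z` is the elementwise gradient of `w`, inside the triangles and off the chords. -/
def Interface.IsBrokenGrad (S : Interface M) (w : ι → Plane → ℝ) (z : ι → Plane → Plane) : Prop :=
  ∀ i, ∀ x ∈ interior (M.tri i), (S.IsCut i → S.level i x ≠ 0) → HasGradientAt (w i) (z i x) x

end

end IFE

/-! ### Geometry of a triangle and unisolvence of the immersed linear element. -/

namespace IFE

open MeasureTheory Set Filter Topology
open scoped ContDiff

noncomputable section

/-! ### Plane geometry of a triangle -/

/-! On each element both local spaces have a normal form with the same gradient parameter g. Scalar
functions are c + g·x + ρ (g·n) max((x - D)·n, 0), where ρ = β⁻/β⁺ - 1 on interface elements and ρ =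
0 elsewhere. Nédélec fields jump from g to g + ρ (g·n) n at the centre and carry in addition a
rotational part b (`Interface.memSLoc_iff`, `Interface.memINDLoc_iff`). For b = 0 the field is the
broken gradient of the function. Since the function is continuous across the chord, the integral of
this gradient along an edge is a difference of vertex values (`lineInt_pwND`).

The theorem thus reduces to three facts.

(1) Vertex values determine (c, g). This is a rank-one perturbation of linear interpolation,
invertible when 1 + ρ p·n > 0, where p is the gradient of the linear interpolant of max((x - D)·n,
0). Absence of obtuse angles gives 0 ≤ p·n ≤ 1, and ρ > -1 then suffices (`inner_posPart_grad_mem`,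
`nodal_unisolvent`).

(2) Zero circulation around the triangle forces b = 0: the gradient parts telescope, and what
remains is b times a number of fixed sign (`pwND_rotational_eq_zero`).

(3) The edge integral of the tangential trace of ∇v exists, is unique, and equals v(Q) - v(P). It is
the analytic half of the proof. An edge carries parallelograms that locally avoid Γ, because Γ is
smooth and meets the boundary of an interface element in two points only. In such a parallelogram v
is H², so the derivative of v along the edge has an integrable trace and v is absolutely continuous
on the edge (`MemH2.absolutelyContinuous_side`, `Interface.absolutelyContinuous_edge`). Green's
formula identifies this derivative with the tangential trace
(`HasWeakGrad.integral_cross_eq_boundary`), and test functions supported off Γ determine the trace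
almost everywhere (`Interface.HasEdgeIntegral.unique`).

By (3) the edge data have zero circulation, so (2) and (1) produce the same g for both interpolants.
For the boundary conditions, Γ stays away from ∂Ω, so a chord does not separate the endpoints of a
boundary edge (`Interface.level_mul_nonneg_of_frontier`). The scalar interpolant is then affine on
that edge and vanishes with its end values. -/

lemma inner_plane (a b : Plane) : inner ℝ a b = a 0 * b 0 + a 1 * b 1 := by
  simp [PiLp.inner_apply, Fin.sum_univ_two, mul_comm]

lemma plane_ext {a b : Plane} (h0 : a 0 = b 0) (h1 : a 1 = b 1) : a = b := by
  ext i; fin_cases i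
  · exact h0
  · exact h1

/-- Twice the signed area of a triangle. -/
def tdet (A : Fin 3 → Plane) : ℝ := cross (A 1 - A 0) (A 2 - A 0)

lemma cross_edge (A : Fin 3 → Plane) (k : Fin 3) :
    cross (A (k + 2) - A (k + 1)) (A k - A (k + 1)) = tdet A := by
  fin_cases k <;> simp [tdet, cross] <;> ring

lemma exists_smul_of_cross_eq_zero {a b : Plane} (ha : a ≠ 0) (h : cross a b = 0) :
    ∃ r : ℝ, b = r • a := by
  have hc : a 0 * b 1 - a 1 * b 0 = 0 := h
  by_cases h0 : a 0 = 0
  · have h1 : a 1 ≠ 0 := fun h1 => ha (plane_ext (by simpa using h0) (by simpa using h1))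
    refine ⟨b 1 / a 1, plane_ext ?_ ?_⟩
    · have : a 1 * b 0 = 0 := by rw [h0] at hc; linarith
      simp [h0, (mul_eq_zero.1 this).resolve_left h1]
    · simp [h1]
  · refine ⟨b 0 / a 0, plane_ext ?_ ?_⟩
    · simp [h0]
    · simp; field_simp; linarith

lemma tdet_ne_zero {A : Fin 3 → Plane} (h : AffineIndependent ℝ A) : tdet A ≠ 0 := by
  intro h0
  have h1 : A 1 - A 0 ≠ 0 := sub_ne_zero.2 (h.injective.ne (by decide))
  obtain ⟨r, hr⟩ := exists_smul_of_cross_eq_zero h1 h0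
  have hcol : Collinear ℝ ({A 0, A 1, A 2} : Set Plane) := by
    refine (collinear_iff_of_mem (p₀ := A 0) (by simp)).2 ⟨A 1 - A 0, ?_⟩
    rintro p (rfl | rfl | rfl)
    · exact ⟨0, by simp⟩
    · exact ⟨1, by simp⟩
    · exact ⟨r, by rw [← hr]; simp⟩
  rw [affineIndependent_iff_not_collinear] at h
  apply h
  convert hcol using 1
  ext x; simp [Fin.exists_fin_succ, eq_comm]

/-- Barycentric coordinates. -/
def bary (A : Fin 3 → Plane) (k : Fin 3) (x : Plane) : ℝ :=
  cross (A (k + 1) - x) (A (k + 2) - x) / tdet A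

lemma sum_bary {A : Fin 3 → Plane} (hA : tdet A ≠ 0)
    (x : Plane) : bary A 0 x + bary A 1 x + bary A 2 x = 1 := by
  have h := hA
  simp only [bary, tdet, cross] at *
  simp at *
  field_simp
  ring

lemma sum_bary_smul {A : Fin 3 → Plane} (hA : tdet A ≠ 0)
    (x : Plane) : bary A 0 x • A 0 + bary A 1 x • A 1 + bary A 2 x • A 2 = x := by
  have h := hA
  apply plane_ext <;>
  · simp only [bary, tdet, cross] at *
    simp at *
    field_simp
    ring

lemma bary_vertex {A : Fin 3 → Plane} (hA : tdet A ≠ 0)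
    (k j : Fin 3) : bary A k (A j) = if j = k then 1 else 0 := by
  rw [bary, div_eq_iff hA]
  fin_cases k <;> fin_cases j <;> simp [cross, tdet] <;> ring

lemma bary_combo {A : Fin 3 → Plane} (k : Fin 3) (x y : Plane) {a b : ℝ} (hab : a + b = 1) :
    bary A k (a • x + b • y) = a * bary A k x + b * bary A k y := by
  obtain rfl : b = 1 - a := by linarith
  simp only [bary, cross]
  simp
  ring

lemma continuous_bary {A : Fin 3 → Plane} (k : Fin 3) : Continuous (bary A k) := by
  unfold bary cross
  fun_prop

/-- Translates between barycentric coordinates and the affine coordinates along edge k with origin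
at its first endpoint, in which the analysis near that edge takes place. -/
lemma bary_edge {A : Fin 3 → Plane} (hA : tdet A ≠ 0)
    (k : Fin 3) (x : Plane) (s t : ℝ)
    (hx : x = A (k + 1) + s • (A (k + 2) - A (k + 1)) + t • (A k - A (k + 1))) :
    bary A k x = t ∧ bary A (k + 2) x = s ∧ bary A (k + 1) x = 1 - s - t := by
  subst hx
  simp only [bary, div_eq_iff hA]
  fin_cases k <;> simp [cross, tdet] <;> refine ⟨?_, ?_, ?_⟩ <;> ring

lemma mem_tri_iff {A : Fin 3 → Plane} (hA : tdet A ≠ 0)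
    (x : Plane) : x ∈ convexHull ℝ (range A) ↔ ∀ k, 0 ≤ bary A k x := by
  constructor
  · intro hx k
    have hc : Convex ℝ {y | 0 ≤ bary A k y} := by
      intro y hy z hz a b ha hb hab
      have hy' : 0 ≤ bary A k y := hy
      have hz' : 0 ≤ bary A k z := hz
      change 0 ≤ bary A k (a • y + b • z)
      rw [bary_combo k y z hab]
      positivity
    refine convexHull_min ?_ hc hx
    rintro _ ⟨j, rfl⟩
    change 0 ≤ bary A k (A j)
    rw [bary_vertex hA]
    split_ifs <;> norm_num
  · intro h
    have hs := sum_bary hA x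
    rw [← sum_bary_smul hA x]
    have := (convex_convexHull ℝ (range A)).sum_mem (t := Finset.univ)
      (w := fun k => bary A k x) (z := A) (fun k _ => h k) (by simpa [Fin.sum_univ_three] using hs)
      (fun k _ => subset_convexHull ℝ _ (mem_range_self k))
    simpa [Fin.sum_univ_three] using this

lemma mem_interior_tri_iff {A : Fin 3 → Plane} (hA : tdet A ≠ 0) (x : Plane) :
    x ∈ interior (convexHull ℝ (range A)) ↔ ∀ k, 0 < bary A k x := by
  constructor
  · intro hx k
    have hx0 : 0 ≤ bary A k x := (mem_tri_iff hA x).1 (interior_subset hx) k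
    refine lt_of_le_of_ne hx0 fun h0 => ?_
    -- If the k-th coordinate vanished at x, moving x slightly away from the vertex `A k` would make
    -- it negative while staying in the triangle.
    have hcont : Tendsto (fun ε : ℝ => (1 + ε) • x + (-ε) • A k) (𝓝[>] 0) (𝓝 x) := by
      have : Continuous (fun ε : ℝ => (1 + ε) • x + (-ε) • A k) := by fun_prop
      have h := this.tendsto 0
      simp only [add_zero, one_smul, neg_zero, zero_smul] at h
      exact h.mono_left nhdsWithin_le_nhds
    have hev := hcont.eventually (mem_interior_iff_mem_nhds.1 hx)
    obtain ⟨ε, hε, hpos⟩ := (hev.and self_mem_nhdsWithin).exists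
    have h1 := (mem_tri_iff hA _).1 hε k
    rw [bary_combo k _ _ (by ring), bary_vertex hA] at h1
    have : (0 : ℝ) < ε := hpos
    simp [← h0] at h1
    linarith
  · intro h
    have ho : IsOpen {y | ∀ k, 0 < bary A k y} := by
      simp only [ofPred_forall]
      exact isOpen_iInter_of_finite fun k => isOpen_lt continuous_const (continuous_bary k)
    exact mem_interior.2 ⟨_, fun y hy => (mem_tri_iff hA y).2 fun k => (hy k).le, ho, h⟩

lemma interior_tri_nonempty {A : Fin 3 → Plane} (hA : tdet A ≠ 0)
    : (interior (convexHull ℝ (range A))).Nonempty := by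
  refine ⟨A (0 + 1) + (1 / 3 : ℝ) • (A (0 + 2) - A (0 + 1)) + (1 / 3 : ℝ) • (A 0 - A (0 + 1)),
    (mem_interior_tri_iff hA _).2 ?_⟩
  obtain ⟨h0, h2, h1⟩ := bary_edge hA 0 _ (1 / 3) (1 / 3) rfl
  intro k
  fin_cases k
  · simp at h0 ⊢; rw [h0]; norm_num
  · simp at h1 ⊢; rw [h1]; norm_num
  · simp at h2 ⊢; rw [h2]; norm_num

/-- Linear interpolation at the vertices. -/
lemma exists_affine_interp {A : Fin 3 → Plane} (hA : tdet A ≠ 0)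
    (V : Fin 3 → ℝ) :
    ∃ (c : ℝ) (g : Plane), ∀ k, c + inner ℝ g (A k) = V k := by
  let α := V 1 - V 0
  let β := V 2 - V 0
  let g : Plane := !₂[(α * (A 2 1 - A 0 1) - β * (A 1 1 - A 0 1)) / tdet A,
    (β * (A 1 0 - A 0 0) - α * (A 2 0 - A 0 0)) / tdet A]
  refine ⟨V 0 - inner ℝ g (A 0), g, fun k => ?_⟩
  fin_cases k <;> simp [inner_plane, g, α, β] <;> field_simp <;> simp [tdet, cross] <;> ring

lemma affine_eq_zero {A : Fin 3 → Plane} (hA : tdet A ≠ 0)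
    {c : ℝ} {g : Plane} (h : ∀ k, c + inner ℝ g (A k) = 0) : c = 0 ∧ g = 0 := by
  have h0 := h 0
  have h1 := h 1
  have h2 := h 2
  simp only [inner_plane] at h0 h1 h2
  have hd : tdet A = (A 1 0 - A 0 0) * (A 2 1 - A 0 1) - (A 1 1 - A 0 1) * (A 2 0 - A 0 0) := by
    simp [tdet, cross]
  have e0 : tdet A * g 0 = 0 := by
    rw [hd]; linear_combination (A 2 1 - A 0 1) * (h1 - h0) - (A 1 1 - A 0 1) * (h2 - h0)
  have e1 : tdet A * g 1 = 0 := by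
    rw [hd]; linear_combination (A 1 0 - A 0 0) * (h2 - h0) - (A 2 0 - A 0 0) * (h1 - h0)
  have g0 := (mul_eq_zero.1 e0).resolve_left hA
  have g1 := (mul_eq_zero.1 e1).resolve_left hA
  refine ⟨by simpa [g0, g1] using h0, plane_ext (by simpa using g0) (by simpa using g1)⟩

/-- The inner product of two vectors in terms of their components along the edges. -/
lemma tdet_sq_mul_inner (A : Fin 3 → Plane) (p q : Plane) :
    tdet A ^ 2 * inner ℝ p q =
      ∑ k : Fin 3, inner ℝ (A (k + 1) - A k) (A (k + 2) - A k) *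
        (inner ℝ p (A (k + 1) - A (k + 2)) * inner ℝ q (A (k + 1) - A (k + 2))) := by
  simp [Fin.sum_univ_three, inner_plane, tdet, cross]
  ring

/-- With l = (x - D)·n, the vectors p and q = p - n are the gradients of the linear interpolants of
max(l, 0) and max(-l, 0). Along each edge the increments of these two functions have opposite signs,
and the weights in `tdet_sq_mul_inner` are nonnegative because no angle is obtuse, so p·q ≤ 0. The
bounds follow from p·n = |p|² - p·q and 1 - p·n = |q|² - p·q. -/
lemma inner_posPart_grad_mem {A : Fin 3 → Plane} (hA : tdet A ≠ 0)
    (hobt : ∀ k : Fin 3, 0 ≤ inner ℝ (A (k + 1) - A k) (A (k + 2) - A k))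
    {D n p : Plane} {c : ℝ} (hn : ‖n‖ = 1)
    (hp : ∀ k, c + inner ℝ p (A k) = max (inner ℝ (A k - D) n) 0) :
    0 ≤ inner ℝ p n ∧ inner ℝ p n ≤ 1 := by
  have hnn : inner ℝ n n = 1 := by rw [real_inner_self_eq_norm_sq, hn]; norm_num
  set q : Plane := p - n with hq
  have hqk : ∀ k, inner ℝ q (A k) + (c + inner ℝ D n) = max (-inner ℝ (A k - D) n) 0 := by
    intro k
    have h1 := hp k
    rw [hq, inner_sub_left, real_inner_comm (A k) n]
    rw [inner_sub_left] at *
    rcases le_total (inner ℝ (A k) n - inner ℝ D n) 0 with h | h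
    · rw [max_eq_right h] at h1; rw [max_eq_left (by linarith)]; linarith
    · rw [max_eq_left h] at h1; rw [max_eq_right (by linarith)]; linarith
  have hpq : inner ℝ p q ≤ 0 := by
    have key := tdet_sq_mul_inner A p q
    have hpos : 0 < tdet A ^ 2 := by positivity
    have : tdet A ^ 2 * inner ℝ p q ≤ 0 := by
      rw [key]
      refine Finset.sum_nonpos fun k _ => mul_nonpos_of_nonneg_of_nonpos (hobt k) ?_
      have a1 := hp (k + 1)
      have a2 := hp (k + 2)
      have b1 := hqk (k + 1)
      have b2 := hqk (k + 2)
      rw [inner_sub_right, inner_sub_right]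
      set l1 := inner ℝ (A (k + 1) - D) n
      set l2 := inner ℝ (A (k + 2) - D) n
      have e1 : inner ℝ p (A (k + 1)) - inner ℝ p (A (k + 2)) = max l1 0 - max l2 0 := by linarith
      have e2 : inner ℝ q (A (k + 1)) - inner ℝ q (A (k + 2)) = max (-l1) 0 - max (-l2) 0 := by
        linarith
      rw [e1, e2]
      -- If both endpoints are on one side, one of the two increments is zero; otherwise the
      -- increments have opposite signs.
      rcases le_total l1 0 with h1 | h1 <;> rcases le_total l2 0 with h2 | h2
      · simp [max_eq_right h1, max_eq_right h2]
      · rw [max_eq_right h1, max_eq_left h2, max_eq_left (by linarith : 0 ≤ -l1),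
          max_eq_right (by linarith : -l2 ≤ 0)]
        nlinarith
      · rw [max_eq_left h1, max_eq_right h2, max_eq_right (by linarith : -l1 ≤ 0),
          max_eq_left (by linarith : 0 ≤ -l2)]
        nlinarith
      · simp [max_eq_right (by linarith : -l1 ≤ 0), max_eq_right (by linarith : -l2 ≤ 0)]
    nlinarith
  have hpn : n = p - q := by simp [hq]
  have hpp : 0 ≤ inner ℝ p p := real_inner_self_nonneg
  have hqq : 0 ≤ inner ℝ q q := real_inner_self_nonneg
  have e1 : inner ℝ p n = inner ℝ p p - inner ℝ p q := by
    conv_lhs => rw [hpn]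
    rw [inner_sub_right]
  have e2 : inner ℝ q n = inner ℝ p q - inner ℝ q q := by
    conv_lhs => rw [hpn]
    rw [inner_sub_right, real_inner_comm]
  have e3 : inner ℝ q n = inner ℝ p n - 1 := by rw [hq, inner_sub_left, hnn]
  constructor <;> linarith

/-- Unisolvence of the immersed linear element for the vertex values. -/
lemma nodal_unisolvent {A : Fin 3 → Plane} (hA : tdet A ≠ 0)
    {D n : Plane} {ρ : ℝ} (hρ : -1 < ρ)
    (h : ρ = 0 ∨ (‖n‖ = 1 ∧
      ∀ k : Fin 3, 0 ≤ inner ℝ (A (k + 1) - A k) (A (k + 2) - A k))) :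
    (∀ V : Fin 3 → ℝ, ∃ (c : ℝ) (g : Plane),
      ∀ k, c + inner ℝ g (A k) + ρ * inner ℝ g n * max (inner ℝ (A k - D) n) 0 = V k) ∧
    ∀ (c : ℝ) (g : Plane),
      (∀ k, c + inner ℝ g (A k) + ρ * inner ℝ g n * max (inner ℝ (A k - D) n) 0 = 0) →
      c = 0 ∧ g = 0 := by
  obtain ⟨a, p, hp⟩ := exists_affine_interp hA fun k => max (inner ℝ (A k - D) n) 0
  -- If b + q·x interpolates V, a solution must have g = q - ρ m p with m = g·n. Its normal
  -- component is the scalar equation m (1 + ρ p·n) = q·n, so unisolvence hinges on this factor.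
  have hpos : 0 < 1 + ρ * inner ℝ p n := by
    rcases h with h | ⟨hn, hobt⟩
    · simp [h]
    · obtain ⟨h0, h1⟩ := inner_posPart_grad_mem hA hobt hn hp
      rcases le_total 0 ρ with h2 | h2
      · positivity
      · nlinarith
  constructor
  · intro V
    obtain ⟨b, q, hq⟩ := exists_affine_interp hA V
    set m := inner ℝ q n / (1 + ρ * inner ℝ p n) with hm
    have hgn : inner ℝ (q - (ρ * m) • p) n = m := by
      rw [inner_sub_left, real_inner_smul_left, hm]
      field_simp
      ring
    refine ⟨b - ρ * m * a, q - (ρ * m) • p, fun k => ?_⟩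
    rw [hgn, ← hp k, ← hq k, inner_sub_left, real_inner_smul_left]
    ring
  · intro c g hcg
    have h1 : ∀ k, (c + ρ * inner ℝ g n * a) + inner ℝ (g + (ρ * inner ℝ g n) • p) (A k) = 0 := by
      intro k
      rw [← hcg k, ← hp k, inner_add_left, real_inner_smul_left]
      ring
    obtain ⟨h2, h3⟩ := affine_eq_zero hA h1
    have h4 : inner ℝ g n = 0 := by
      have h5 : inner ℝ (g + (ρ * inner ℝ g n) • p) n = 0 := by rw [h3, inner_zero_left]
      rw [inner_add_left, real_inner_smul_left] at h5
      have : inner ℝ g n * (1 + ρ * inner ℝ p n) = 0 := by linarith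
      exact (mul_eq_zero.1 this).resolve_right hpos.ne'
    rw [h4] at h2 h3
    exact ⟨by simpa using h2, by simpa using h3⟩

end

end IFE

/-! ### Normal forms of the local spaces, circulation of Nédélec fields, and chords near the
boundary. -/

namespace IFE

open MeasureTheory Set Filter Topology
open scoped ContDiff

noncomputable section

/-! ### The local immersed spaces in coordinates -/

/-- The rotated position field. -/
def rot (x : Plane) : Plane := !₂[x 1, -x 0]

/-- Piecewise linear functions, continuous across the line through `D` with normal `n`, whose
gradient jumps from `g` to `g + ρ ⟪g, n⟫ n`. -/
def pwLin (D n : Plane) (ρ c : ℝ) (g x : Plane) : ℝ :=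
  c + inner ℝ g x + ρ * inner ℝ g n * max (inner ℝ (x - D) n) 0

/-- Piecewise Nédélec fields about the centre `X` whose value at `X` jumps from `g` to
`g + ρ ⟪g, n⟫ n`, and whose rotational part jumps from `b` to `ν b`. -/
def pwND (X D n : Plane) (ρ ν : ℝ) (g : Plane) (b : ℝ) (x : Plane) : Plane :=
  if inner ℝ (x - D) n ≤ 0 then g + b • rot (x - X)
  else g + (ρ * inner ℝ g n) • n + (ν * b) • rot (x - X)

/-- In the plane the orthogonal complement of d is the line spanned by n. With d the chord, a jump
without tangential component is a multiple of n. -/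
lemma eq_inner_smul_of_perp {a d n : Plane} (hd : d ≠ 0) (hn : ‖n‖ = 1)
    (ha : inner ℝ d a = 0) (hnd : inner ℝ d n = 0) : a = inner ℝ a n • n := by
  have hnn : n 0 * n 0 + n 1 * n 1 = 1 := by
    rw [← inner_plane, real_inner_self_eq_norm_sq, hn]; norm_num
  have hdd : d 0 * d 0 + d 1 * d 1 ≠ 0 := by
    rw [← inner_plane]; exact inner_self_ne_zero.2 hd
  rw [inner_plane] at *
  have hcr : a 0 * n 1 - a 1 * n 0 = 0 := by
    have h0 : d 0 * (a 0 * n 1 - a 1 * n 0) = 0 := by linear_combination n 1 * ha - a 1 * hnd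
    have h1 : d 1 * (a 0 * n 1 - a 1 * n 0) = 0 := by linear_combination a 0 * hnd - n 0 * ha
    have : (d 0 * d 0 + d 1 * d 1) * (a 0 * n 1 - a 1 * n 0) = 0 := by
      linear_combination d 0 * h0 + d 1 * h1
    exact (mul_eq_zero.1 this).resolve_left hdd
  apply plane_ext <;> simp
  · linear_combination (-a 0) * hnn + n 1 * hcr
  · linear_combination (-a 1) * hnn - n 0 * hcr

lemma gradient_affine {f : Plane → ℝ} {c : ℝ} {g : Plane} (h : ∀ x, f x = c + inner ℝ g x)
    (x : Plane) : HasGradientAt f g x := by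
  obtain rfl : f = fun x => c + inner ℝ g x := funext h
  rw [hasGradientAt_iff_hasFDerivAt]
  exact ((InnerProductSpace.toDual ℝ Plane g).hasFDerivAt (x := x)).const_add c

lemma curl_ND {u : Plane → Plane} {a : Plane} {b : ℝ} (h : ∀ x, u x = a + b • !₂[x 1, -x 0])
    (x : Plane) : curl u x = -2 * b := by
  have h1 : ∀ i : Fin 2, ∀ y : Plane, HasFDerivAt (fun x : Plane => x i)
      (EuclideanSpace.proj i : Plane →L[ℝ] ℝ) y := fun i y =>
    (EuclideanSpace.proj i : Plane →L[ℝ] ℝ).hasFDerivAt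
  have hd : DifferentiableAt ℝ u x := by
    obtain rfl : u = fun x => a + b • !₂[x 1, -x 0] := funext h
    rw [differentiableAt_euclidean]
    intro i
    fin_cases i <;> simp <;> fun_prop
  have hc : ∀ i j : Fin 2, pd j u x i = fderiv ℝ (fun y => u y i) x (EuclideanSpace.single j 1) := by
    intro i j
    have := ((EuclideanSpace.proj i : Plane →L[ℝ] ℝ).hasFDerivAt.comp x hd.hasFDerivAt).fderiv
    have e : (fun y => u y i) = (EuclideanSpace.proj i : Plane →L[ℝ] ℝ) ∘ u := rfl
    rw [e, this]
    rfl
  rw [curl, hc, hc]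
  have e1 : (fun y => u y 1) = fun y : Plane => a 1 + (-b) * y 0 := by
    funext y; rw [h]; simp
  have e0 : (fun y => u y 0) = fun y : Plane => a 0 + b * y 1 := by
    funext y; rw [h]; simp
  rw [e1, e0, (((h1 0 x).const_mul (-b)).const_add (a 1)).fderiv,
    (((h1 1 x).const_mul b).const_add (a 0)).fderiv]
  simp
  ring

variable {ι : Type*} {M : Mesh ι}

open Classical in
/-- The relative jump of the normal derivative. -/
def Interface.nJump (S : Interface M) (βm βp : ℝ) (i : ι) : ℝ :=
  if S.IsCut i then βm / βp - 1 else 0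

open Classical in
/-- The ratio of the curls. -/
def Interface.cRatio (S : Interface M) (μm μp : ℝ) (i : ι) : ℝ :=
  if S.IsCut i then μp / μm else 1

open Classical in
/-- A centre for the Nédélec fields: the midpoint of the chord in interface elements. -/
def Interface.centre (S : Interface M) (i : ι) : Plane :=
  if S.IsCut i then S.mid i else M.A i 0

/-- Agreement at both ends of the chord makes the gradient jump normal to the chord, the flux
condition fixes its size as (β⁻/β⁺ - 1) g·n, and agreement at D fixes the constant. Only (c, g) from
the minus side remains free. Other elements are the case ρ = 0. -/
lemma Interface.memSLoc_iff (S : Interface M) {βm βp : ℝ} (hβp : 0 < βp) (i : ι)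
    (w : Plane → ℝ) :
    S.MemSLoc βm βp i w ↔ ∃ c g,
      (∀ x ∈ M.tri i, w x = pwLin (S.D i) (S.n i) (S.nJump βm βp i) c g x) ∧
      ∀ x ∉ M.tri i, w x = 0 := by
  by_cases hc : S.IsCut i
  · have hn := S.unit i hc
    have hne := S.ne i hc
    have hDE := S.normal i hc
    simp only [Interface.MemSLoc, hc, not_true, false_imp_iff, and_true, true_imp_iff, nJump,
      if_true]
    constructor
    · rintro ⟨wm, wp, ⟨c, g, hm⟩, ⟨c', g', hp⟩, hcond, hg1, hg2, hg3⟩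
      have hD := hcond (S.D i) (left_mem_segment ℝ _ _)
      have hE := hcond (S.E i) (right_mem_segment ℝ _ _)
      have hβ := hD.2
      rw [(gradient_affine hm _).gradient, (gradient_affine hp _).gradient] at hβ
      have hgE := hE.1
      have hgD := hD.1
      rw [hm, hp] at hgE hgD
      have hperp : inner ℝ (S.E i - S.D i) (g' - g) = 0 := by
        simp only [inner_plane] at *
        simp at *
        linear_combination hgE - hgD
      have hθ := eq_inner_smul_of_perp (sub_ne_zero.2 hne.symm) hn hperp hDE
      have hθ' : inner ℝ (g' - g) (S.n i) = (βm / βp - 1) * inner ℝ g (S.n i) := by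
        rw [inner_sub_left]; field_simp; linarith
      have hwp : ∀ x, wp x = wm x + (βm / βp - 1) * inner ℝ g (S.n i) *
          inner ℝ (x - S.D i) (S.n i) := by
        intro x
        have h1 : wp x - wm x = inner ℝ (g' - g) (x - S.D i) := by
          rw [hm, hp]
          simp only [inner_sub_left, inner_sub_right]
          linarith
        rw [hθ, hθ', real_inner_smul_left, real_inner_comm (x - S.D i)] at h1
        linarith
      refine ⟨c, g, fun x hx => ?_, hg3⟩
      rcases le_or_gt (S.level i x) 0 with hl | hl
      · rw [hg1 x hx hl, pwLin, hm]
        rw [Interface.level] at hl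
        simp [max_eq_right hl]
      · rw [hg2 x hx hl, pwLin, hwp, hm]
        rw [Interface.level] at hl
        rw [max_eq_left hl.le]
    · rintro ⟨c, g, h1, h2⟩
      set θ := (βm / βp - 1) * inner ℝ g (S.n i) with hθ
      have hnn : inner ℝ (S.n i) (S.n i) = (1 : ℝ) := by
        rw [real_inner_self_eq_norm_sq, hn]; norm_num
      refine ⟨fun x => c + inner ℝ g x,
        fun x => (c - θ * inner ℝ (S.D i) (S.n i)) + inner ℝ (g + θ • S.n i) x,
        ⟨c, g, fun _ => rfl⟩, ⟨_, _, fun _ => rfl⟩, fun x hx => ⟨?_, ?_⟩, ?_, ?_, h2⟩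
      · have hl : inner ℝ (x - S.D i) (S.n i) = 0 := by
          rw [segment_eq_image_lineMap] at hx
          obtain ⟨s, -, rfl⟩ := hx
          rw [AffineMap.lineMap_apply_module', add_sub_cancel_right, real_inner_smul_left, hDE,
            mul_zero]
        rw [inner_sub_left] at hl
        beta_reduce
        rw [inner_add_left, real_inner_smul_left, real_inner_comm x (S.n i)]
        linear_combination θ * hl
      · rw [(gradient_affine (fun _ => rfl) x).gradient, (gradient_affine (fun _ => rfl) x).gradient,
          inner_add_left, real_inner_smul_left, hnn, hθ]
        field_simp
        ring
      · intro x hx hl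
        rw [h1 x hx, pwLin]
        rw [Interface.level] at hl
        simp [max_eq_right hl]
      · intro x hx hl
        rw [h1 x hx, pwLin]
        rw [Interface.level] at hl
        beta_reduce
        rw [max_eq_left hl.le, inner_add_left, real_inner_smul_left, inner_sub_left,
          real_inner_comm x (S.n i)]
        ring
  · simp only [Interface.MemSLoc, hc, false_imp_iff, true_and, nJump, if_false, pwLin, not_false_iff,
      true_imp_iff]
    constructor
    · rintro ⟨p, ⟨c, g, hp⟩, h1, h2⟩
      exact ⟨c, g, fun x hx => by rw [h1 x hx, hp]; ring, h2⟩
    · rintro ⟨c, g, h1, h2⟩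
      exact ⟨fun x => c + inner ℝ g x, ⟨c, g, fun _ => rfl⟩,
        fun x hx => by rw [h1 x hx]; ring, h2⟩

lemma ND_centre (a X : Plane) (b : ℝ) (x : Plane) :
    a + b • !₂[x 1, -x 0] = (a + b • rot X) + b • rot (x - X) := by
  apply plane_ext <;> simp [rot] <;> ring

/-- Centring the rotations at the chord midpoint makes them vanish there, which decouples the
conditions. The tangential and normal ones give the values at the midpoint the same jump g ↦ g + ρ
(g·n) n as the gradients of the scalar space, and the curl condition scales the rotational part by
μ⁺/μ⁻. -/
lemma Interface.memINDLoc_iff (S : Interface M) {βm βp μm μp : ℝ} (hβp : 0 < βp)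
    (hμm : 0 < μm) (hμp : 0 < μp) (i : ι) (z : Plane → Plane) :
    S.MemINDLoc βm βp μm μp i z ↔ ∃ g b,
      (∀ x ∈ M.tri i, z x = pwND (S.centre i) (S.D i) (S.n i) (S.nJump βm βp i)
        (S.cRatio μm μp i) g b x) ∧ ∀ x ∉ M.tri i, z x = 0 := by
  by_cases hc : S.IsCut i
  · have hn := S.unit i hc
    have hne := S.ne i hc
    have hDE := S.normal i hc
    have hnn : inner ℝ (S.n i) (S.n i) = (1 : ℝ) := by
      rw [real_inner_self_eq_norm_sq, hn]; norm_num
    simp only [Interface.MemINDLoc, hc, not_true, false_imp_iff, and_true, true_imp_iff, nJump,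
      if_true, centre, cRatio]
    set X := S.mid i
    constructor
    · rintro ⟨zm, zp, ⟨a, b, hm⟩, ⟨a', b', hp⟩, ht, hcurl, hβ, hg1, hg2, hg3⟩
      rw [curl_ND hm, curl_ND hp] at hcurl
      have hb : b' = μp / μm * b := by field_simp at hcurl ⊢; linarith
      have hm' : ∀ x, zm x = zm X + b • rot (x - X) := fun x => by
        rw [hm x, ND_centre a X b, hm X]; rfl
      have hp' : ∀ x, zp x = zp X + b' • rot (x - X) := fun x => by
        rw [hp x, ND_centre a' X b', hp X]; rfl
      have hperp : inner ℝ (S.E i - S.D i) (zp X - zm X) = 0 := by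
        rw [real_inner_comm, inner_sub_left, ht, sub_self]
      have hθ := eq_inner_smul_of_perp (sub_ne_zero.2 hne.symm) hn hperp hDE
      have hθ' : inner ℝ (zp X - zm X) (S.n i) = (βm / βp - 1) * inner ℝ (zm X) (S.n i) := by
        rw [inner_sub_left]; field_simp; linarith
      refine ⟨zm X, b, fun x hx => ?_, hg3⟩
      rw [pwND]
      split_ifs with hl
      · rw [hg1 x hx hl, hm' x]
      · rw [hg2 x hx (not_le.1 hl), hp' x, hb, ← hθ', ← hθ]
        simp
    · rintro ⟨g, b, h1, h2⟩
      set θ := (βm / βp - 1) * inner ℝ g (S.n i) with hθ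
      have hX : rot (X - X) = 0 := by apply plane_ext <;> simp [rot]
      have hND : ∀ (a : Plane) (b : ℝ) (x : Plane),
          a + b • rot (x - X) = (a - b • rot X) + b • !₂[x 1, -x 0] := by
        intro a b x
        rw [ND_centre _ X]; simp
      refine ⟨fun x => g + b • rot (x - X), fun x => g + θ • S.n i + (μp / μm * b) • rot (x - X),
        ⟨_, _, fun x => hND _ _ x⟩, ⟨_, _, fun x => hND _ _ x⟩, ?_, ?_, ?_, ?_, ?_, h2⟩
      · simp only [hX, smul_zero, add_zero]
        rw [inner_add_left, real_inner_smul_left, real_inner_comm _ (S.n i), hDE]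
        ring
      · rw [curl_ND (fun x => hND _ _ x), curl_ND (fun x => hND _ _ x)]
        field_simp
      · simp only [hX, smul_zero, add_zero]
        rw [inner_add_left, real_inner_smul_left, hnn, hθ]
        field_simp
        ring
      · intro x hx hl
        exact (h1 x hx).trans (if_pos hl)
      · intro x hx hl
        exact (h1 x hx).trans (if_neg (not_le.2 hl))
  · simp only [Interface.MemINDLoc, hc, false_imp_iff, true_and, nJump, if_false, pwND, centre,
      cRatio, not_false_iff, true_imp_iff]
    constructor
    · rintro ⟨p, ⟨a, b, hp⟩, h1, h2⟩
      refine ⟨a + b • rot (M.A i 0), b, fun x hx => ?_, h2⟩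
      rw [h1 x hx, hp, ND_centre a (M.A i 0)]
      simp
    · rintro ⟨g, b, h1, h2⟩
      refine ⟨fun x => g + b • rot (x - M.A i 0), ⟨g - b • rot (M.A i 0), b, fun x => ?_⟩,
        fun x hx => by rw [h1 x hx]; simp, h2⟩
      rw [ND_centre _ (M.A i 0)]; simp

/-! ### Line integrals of piecewise Nédélec fields -/

/-- The fraction of a segment on which an affine function with end values `a`, `b` is positive. -/
def posFrac (a b : ℝ) : ℝ := ∫ s in (0 : ℝ)..1, if a + s * (b - a) ≤ 0 then (0 : ℝ) else 1

lemma intervalIntegrable_posFrac (a b : ℝ) :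
    IntervalIntegrable (fun s : ℝ => if a + s * (b - a) ≤ 0 then (0 : ℝ) else 1) volume 0 1 := by
  rw [intervalIntegrable_iff]
  refine Measure.integrableOn_of_bounded (M := 1) (by simp) ?_ ?_
  · refine (Measurable.ite ?_ measurable_const measurable_const).aestronglyMeasurable
    exact measurableSet_le (by fun_prop) measurable_const
  · refine ae_of_all _ fun s => ?_
    split_ifs <;> simp

lemma posFrac_mem (a b : ℝ) : 0 ≤ posFrac a b ∧ posFrac a b ≤ 1 := by
  constructor
  · exact intervalIntegral.integral_nonneg zero_le_one fun s _ => by split_ifs <;> simp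
  · have : posFrac a b ≤ ∫ s in (0 : ℝ)..1, (1 : ℝ) :=
      intervalIntegral.integral_mono_on zero_le_one (intervalIntegrable_posFrac a b) (by simp)
        fun s _ => by split_ifs <;> simp
    simpa using this

/-- This is the fundamental theorem of calculus for s ↦ max(a + s (b - a), 0), which is
differentiable off the single zero of its argument. -/
lemma posFrac_mul (a b : ℝ) : posFrac a b * (b - a) = max b 0 - max a 0 := by
  rcases eq_or_ne a b with rfl | hab
  · simp
  have hba : b - a ≠ 0 := sub_ne_zero.2 hab.symm
  rw [posFrac, ← intervalIntegral.integral_mul_const]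
  have := integral_eq_of_hasDerivAt_off_countable_of_le
    (f := fun s : ℝ => max (a + s * (b - a)) 0)
    (f' := fun s : ℝ => (if a + s * (b - a) ≤ 0 then (0 : ℝ) else 1) * (b - a))
    (a := 0) (b := 1) zero_le_one (s := {-a / (b - a)}) (countable_singleton _)
    (by fun_prop) ?_ ((intervalIntegrable_posFrac a b).mul_const _)
  · rw [this]; simp
  · rintro s ⟨-, hs⟩
    have hl : HasDerivAt (fun s : ℝ => a + s * (b - a)) (b - a) s := by
      simpa using ((hasDerivAt_id s).mul_const (b - a)).const_add a
    have hne : a + s * (b - a) ≠ 0 := by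
      intro h
      apply hs
      rw [mem_singleton_iff, eq_div_iff hba]
      linarith
    rcases lt_or_gt_of_ne hne with h | h
    · rw [if_pos h.le, zero_mul]
      refine (hasDerivAt_const s (0 : ℝ)).congr_of_eventuallyEq ?_
      filter_upwards [hl.continuousAt.eventually_lt continuousAt_const h] with t ht
      exact max_eq_right ht.le
    · rw [if_neg (not_le.2 h), one_mul]
      refine hl.congr_of_eventuallyEq ?_
      filter_upwards [continuousAt_const.eventually_lt hl.continuousAt h] with t ht
      exact max_eq_left ht.le

/-- Along the segment `rot (x - X)` has constant product -`cross (P - X) (Q - X)` with Q - P,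
weighted by 1 on the minus fraction and by ν on the plus fraction. The jump ρ (g·n) n is integrated
by `posFrac_mul` into the increment of the kink of `pwLin`. -/
lemma lineInt_pwND {X D n : Plane} {ρ ν : ℝ} {g : Plane} {b : ℝ} {P Q : Plane}
    {z : Plane → Plane} (hz : ∀ x ∈ segment ℝ P Q, z x = pwND X D n ρ ν g b x) :
    lineInt P Q z = pwLin D n ρ 0 g Q - pwLin D n ρ 0 g P -
      cross (P - X) (Q - X) *
        ((1 + (ν - 1) * posFrac (inner ℝ (P - D) n) (inner ℝ (Q - D) n)) * b) := by
  set lP := inner ℝ (P - D) n with hlP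
  set lQ := inner ℝ (Q - D) n with hlQ
  set C : ℝ := inner ℝ g (Q - P) - b * cross (P - X) (Q - X) with hC
  set J : ℝ := ρ * inner ℝ g n * (lQ - lP) - (ν - 1) * b * cross (P - X) (Q - X) with hJ
  have h1 : lineInt P Q z = ∫ s in (0 : ℝ)..1,
      (C + J * if lP + s * (lQ - lP) ≤ 0 then (0 : ℝ) else 1) := by
    refine intervalIntegral.integral_congr fun s hs => ?_
    rw [uIcc_of_le zero_le_one] at hs
    have hx : AffineMap.lineMap P Q s ∈ segment ℝ P Q := by
      rw [segment_eq_image_lineMap]; exact mem_image_of_mem _ hs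
    have hl : inner ℝ (AffineMap.lineMap P Q s - D) n = lP + s * (lQ - lP) := by
      rw [AffineMap.lineMap_apply_module', hlP, hlQ]
      simp only [inner_plane]; simp; ring
    rw [hz _ hx, pwND, hl, AffineMap.lineMap_apply_module']
    split_ifs with h
    · rw [hC]
      simp only [inner_plane, cross, rot]; simp; ring
    · rw [hC, hJ, hlP, hlQ]
      simp only [inner_plane, cross, rot]; simp; ring
  rw [h1, intervalIntegral.integral_add (by simp)
    ((intervalIntegrable_posFrac lP lQ).const_mul J), intervalIntegral.integral_const_mul]
  have hm := posFrac_mul lP lQ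
  change _ + J * posFrac lP lQ = _
  simp only [pwLin, intervalIntegral.integral_const, ← hlP, ← hlQ]
  rw [hC, hJ, inner_sub_right]
  simp only [sub_zero, smul_eq_mul, one_mul]
  linear_combination ρ * inner ℝ g n * hm

/-- A discrete Stokes theorem. Around the triangle the `pwLin` increments telescope, and the crosses
are `tdet A` times the barycentric coordinates of X. The circulation is therefore -`tdet A` · b · Σ
λ_k(X) θ_k. Here θ_k > 0 as a convex combination of 1 and ν, and the λ_k(X) are nonnegative with sum
one since X lies in the triangle. -/
lemma pwND_rotational_eq_zero {A : Fin 3 → Plane} (hA : tdet A ≠ 0) {X : Plane}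
    (hX : X ∈ convexHull ℝ (range A)) {D n : Plane} {ρ ν : ℝ} (hν : 0 < ν) {g : Plane} {b : ℝ}
    {z : Plane → Plane} (hz : ∀ x ∈ convexHull ℝ (range A), z x = pwND X D n ρ ν g b x)
    (hsum : ∑ k : Fin 3, lineInt (A (k + 1)) (A (k + 2)) z = 0) : b = 0 := by
  have hseg : ∀ k : Fin 3, segment ℝ (A (k + 1)) (A (k + 2)) ⊆ convexHull ℝ (range A) := fun k =>
    segment_subset_convexHull (mem_range_self _) (mem_range_self _)
  set θ : Fin 3 → ℝ := fun k =>
    1 + (ν - 1) * posFrac (inner ℝ (A (k + 1) - D) n) (inner ℝ (A (k + 2) - D) n) with hθ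
  have hθpos : ∀ k, 0 < θ k := by
    intro k
    obtain ⟨h0, h1⟩ := posFrac_mem (inner ℝ (A (k + 1) - D) n) (inner ℝ (A (k + 2) - D) n)
    simp only [hθ]
    set m := posFrac (inner ℝ (A (k + 1) - D) n) (inner ℝ (A (k + 2) - D) n)
    rcases h0.eq_or_lt with h | h
    · rw [← h]; norm_num
    · nlinarith [mul_pos hν h]
  have hb : ∀ k, cross (A (k + 1) - X) (A (k + 2) - X) = tdet A * bary A k X := fun k => by
    rw [bary]; field_simp
  have h1 : ∑ k : Fin 3, lineInt (A (k + 1)) (A (k + 2)) z =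
      -(tdet A * (∑ k, bary A k X * θ k) * b) := by
    simp_rw [fun k => lineInt_pwND fun x hx => hz x (hseg k hx), hb]
    simp [Fin.sum_univ_three, hθ]
    ring
  have hnn := (mem_tri_iff hA X).1 hX
  have hs := sum_bary hA X
  have hpos : 0 < ∑ k, bary A k X * θ k := by
    have h0 : 0 ≤ ∑ k, bary A k X * θ k :=
      Finset.sum_nonneg fun k _ => mul_nonneg (hnn k) (hθpos k).le
    refine lt_of_le_of_ne h0 fun h => ?_
    have h' := (Finset.sum_eq_zero_iff_of_nonneg
      fun k _ => mul_nonneg (hnn k) (hθpos k).le).1 h.symm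
    have h'' : ∀ k, bary A k X = 0 := fun k =>
      (mul_eq_zero.1 (h' k (Finset.mem_univ k))).resolve_right (hθpos k).ne'
    simp [h''] at hs
  rw [hsum] at h1
  have : tdet A * (∑ k, bary A k X * θ k) * b = 0 := by linarith
  exact (mul_eq_zero.1 this).resolve_left (mul_ne_zero hA hpos.ne')

/-! ### Edges on the boundary -/

lemma fin_three_cases : ∀ j k : Fin 3, j = k ∨ j = k + 1 ∨ j = k + 2 := by decide

lemma fin_three_add : ∀ k : Fin 3,
    k + 1 + 1 = k + 2 ∧ k + 1 + 2 = k ∧ k + 2 + 1 = k ∧ k + 2 + 2 = k + 1 := by decide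

/-- A zero on RP requires l R ≥ 0 and a zero on RQ requires l R ≤ 0. Zeros on different sides thus
force l R = 0 and both are R, while on one side l is not constant and has at most one zero. -/
lemma eq_of_mem_two_sides {P Q R D E : Plane} {l : Plane → ℝ}
    (hl : ∀ x y : Plane, ∀ a b : ℝ, a + b = 1 → l (a • x + b • y) = a * l x + b * l y)
    (hP : l P < 0) (hQ : 0 < l Q)
    (hD : D ∈ segment ℝ R P ∨ D ∈ segment ℝ R Q) (hE : E ∈ segment ℝ R P ∨ E ∈ segment ℝ R Q)
    (hlD : l D = 0) (hlE : l E = 0) : D = E := by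
  have side : ∀ {P Q D : Plane}, l P < 0 ∨ 0 < l P → D ∈ segment ℝ R P → l D = 0 →
      ∃ a : ℝ, 0 ≤ a ∧ a < 1 ∧ D = (1 - a) • R + a • P ∧ (1 - a) * l R + a * l P = 0 := by
    rintro P Q D hP ⟨a, b, ha, hb, hab, rfl⟩ h
    rw [hl _ _ _ _ hab] at h
    obtain rfl : a = 1 - b := by linarith
    refine ⟨b, hb, lt_of_le_of_ne (by linarith) ?_, rfl, h⟩
    rintro rfl
    rcases hP with hP | hP <;> linarith
  have same : ∀ {P D E : Plane} {a b : ℝ}, l R - l P ≠ 0 →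
      D = (1 - a) • R + a • P → (1 - a) * l R + a * l P = 0 →
      E = (1 - b) • R + b • P → (1 - b) * l R + b * l P = 0 → D = E := by
    intro P D E a b h hD ha hE hb
    have : (a - b) * (l R - l P) = 0 := by linear_combination hb - ha
    obtain rfl : a = b := by linarith [(mul_eq_zero.1 this).resolve_right h]
    rw [hD, hE]
  have diff : ∀ {D E : Plane} {a b : ℝ}, 0 ≤ a → a < 1 → 0 ≤ b → b < 1 →
      D = (1 - a) • R + a • P → (1 - a) * l R + a * l P = 0 →
      E = (1 - b) • R + b • Q → (1 - b) * l R + b * l Q = 0 → D = E := by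
    intro D E a b ha0 ha1 hb0 hb1 hD ha hE hb
    have h1 : 0 ≤ l R := by
      by_contra h
      nlinarith
    have h2 : l R ≤ 0 := by
      by_contra h
      nlinarith
    have h3 : l R = 0 := le_antisymm h2 h1
    rw [h3] at ha hb
    have ha' : a = 0 := by
      rcases mul_eq_zero.1 (by linarith : a * l P = 0) with h | h
      · exact h
      · linarith
    have hb' : b = 0 := by
      rcases mul_eq_zero.1 (by linarith : b * l Q = 0) with h | h
      · exact h
      · linarith
    rw [hD, hE, ha', hb']; simp
  rcases hD with hD | hD <;> rcases hE with hE | hE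
  · obtain ⟨a, ha0, ha1, hD', ha⟩ := side (Q := Q) (Or.inl hP) hD hlD
    obtain ⟨b, hb0, hb1, hE', hb⟩ := side (Q := Q) (Or.inl hP) hE hlE
    refine same (fun h => ?_) hD' ha hE' hb
    nlinarith
  · obtain ⟨a, ha0, ha1, hD', ha⟩ := side (Q := Q) (Or.inl hP) hD hlD
    obtain ⟨b, hb0, hb1, hE', hb⟩ := side (Q := Q) (Or.inr hQ) hE hlE
    exact diff ha0 ha1 hb0 hb1 hD' ha hE' hb
  · obtain ⟨a, ha0, ha1, hD', ha⟩ := side (Q := Q) (Or.inr hQ) hD hlD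
    obtain ⟨b, hb0, hb1, hE', hb⟩ := side (Q := Q) (Or.inl hP) hE hlE
    exact (diff hb0 hb1 ha0 ha1 hE' hb hD' ha).symm
  · obtain ⟨a, ha0, ha1, hD', ha⟩ := side (Q := Q) (Or.inr hQ) hD hlD
    obtain ⟨b, hb0, hb1, hE', hb⟩ := side (Q := Q) (Or.inr hQ) hE hlE
    refine same (fun h => ?_) hD' ha hE' hb
    nlinarith

lemma Interface.level_combo (S : Interface M) (i : ι) (x y : Plane) (a b : ℝ) (hab : a + b = 1) :
    S.level i (a • x + b • y) = a * S.level i x + b * S.level i y := by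
  obtain rfl : b = 1 - a := by linarith
  simp only [Interface.level, inner_plane]; simp; ring

/-- The curve lies in the open set Ω and misses a boundary edge, so D and E lie on the other two
edges. If the chord line strictly separated the endpoints of the boundary edge, it would meet those
two edges in one point only, contradicting D ≠ E. -/
lemma Interface.level_mul_nonneg_of_frontier (S : Interface M) {i : ι} (hc : S.IsCut i)
    {k : Fin 3} (hk : M.edge i k ⊆ frontier M.domain) :
    0 ≤ S.level i (M.A i (k + 1)) * S.level i (M.A i (k + 2)) := by
  have hopen : IsOpen M.domain := isOpen_interior
  have hDE := S.inter i hc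
  have hnot : ∀ x ∈ range S.γ, x ∉ M.edge i k := fun x hx hxe => by
    have h1 := hk hxe
    rw [hopen.frontier_eq] at h1
    exact h1.2 (S.subset_domain hx)
  have hD : S.D i ∈ range S.γ := (hDE.symm.subset (by simp : S.D i ∈ ({S.D i, S.E i} : Set _))).1
  have hE : S.E i ∈ range S.γ := (hDE.symm.subset (by simp : S.E i ∈ ({S.D i, S.E i} : Set _))).1
  have hlD : S.level i (S.D i) = 0 := by simp [Interface.level]
  have hlE : S.level i (S.E i) = 0 := S.normal i hc
  obtain ⟨j, l, -, hDj, hEl⟩ := S.edges i hc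
  have hside : ∀ x ∈ range S.γ, ∀ j, x ∈ M.edge i j →
      x ∈ segment ℝ (M.A i k) (M.A i (k + 1)) ∨ x ∈ segment ℝ (M.A i k) (M.A i (k + 2)) := by
    intro x hx j hj
    have h3 : j = k ∨ j = k + 1 ∨ j = k + 2 := fin_three_cases j k
    rcases h3 with rfl | rfl | rfl
    · exact absurd hj (hnot x hx)
    · right
      rw [Mesh.edge, (fin_three_add k).1, (fin_three_add k).2.1, segment_symm] at hj
      exact hj
    · left
      rw [Mesh.edge, (fin_three_add k).2.2.1, (fin_three_add k).2.2.2] at hj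
      exact hj
  by_contra hneg
  rw [not_le, mul_neg_iff] at hneg
  rcases hneg with ⟨h1, h2⟩ | ⟨h1, h2⟩
  · exact S.ne i hc (eq_of_mem_two_sides (S.level_combo i) h2 h1 (hside _ hD _ hDj).symm
      (hside _ hE _ hEl).symm hlD hlE)
  · exact S.ne i hc (eq_of_mem_two_sides (S.level_combo i) h1 h2 (hside _ hD _ hDj)
      (hside _ hE _ hEl) hlD hlE)

end

end IFE

/-! ### One-dimensional analysis: smooth cutoffs and absolute continuity. -/

namespace IFE

open MeasureTheory Set Filter Topology
open scoped ContDiff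

noncomputable section

/-! ### A smooth cutoff near the origin of the half line -/

/-- A smooth monotone function that vanishes up to `r` and is one from `2 * r` on. -/
def cutoff (r t : ℝ) : ℝ := Real.smoothTransition (t / r - 1)

lemma cutoff_contDiff (r : ℝ) : ContDiff ℝ ∞ (cutoff r) := by
  unfold cutoff
  exact Real.smoothTransition.contDiff.comp (by fun_prop)

lemma cutoff_of_le {r t : ℝ} (hr : 0 < r) (h : t ≤ r) : cutoff r t = 0 := by
  refine Real.smoothTransition.zero_of_nonpos ?_
  have : t / r ≤ 1 := (div_le_one hr).2 h
  linarith

lemma cutoff_of_ge {r t : ℝ} (hr : 0 < r) (h : 2 * r ≤ t) : cutoff r t = 1 := by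
  refine Real.smoothTransition.one_of_one_le ?_
  have : 2 ≤ t / r := (le_div_iff₀ hr).2 h
  linarith

lemma cutoff_mem (r t : ℝ) : 0 ≤ cutoff r t ∧ cutoff r t ≤ 1 :=
  ⟨Real.smoothTransition.nonneg _, Real.smoothTransition.le_one _⟩

lemma cutoff_monotone {r : ℝ} (hr : 0 < r) : Monotone (cutoff r) := fun s t h => by
  refine Real.smoothTransition.monotone ?_
  have : s / r ≤ t / r := by gcongr
  linarith

lemma continuous_deriv_cutoff (r : ℝ) : Continuous (deriv (cutoff r)) :=
  (cutoff_contDiff r).continuous_deriv (by simp)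

lemma contDiff_deriv_cutoff (r : ℝ) : ContDiff ℝ ∞ (deriv (cutoff r)) :=
  ContDiff.deriv' (n := ∞) (by simpa using cutoff_contDiff r)

lemma deriv_cutoff_nonneg {r : ℝ} (hr : 0 < r) (t : ℝ) : 0 ≤ deriv (cutoff r) t :=
  (cutoff_monotone hr).deriv_nonneg

lemma deriv_cutoff_eq_zero {r t : ℝ} (hr : 0 < r) (h : t ∉ Icc r (2 * r)) :
    deriv (cutoff r) t = 0 := by
  rw [mem_Icc, not_and_or, not_le, not_le] at h
  rcases h with h | h
  · have : cutoff r =ᶠ[𝓝 t] fun _ => 0 := by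
      filter_upwards [Iio_mem_nhds h] with s hs using cutoff_of_le hr (le_of_lt hs)
    rw [this.deriv_eq]; simp
  · have : cutoff r =ᶠ[𝓝 t] fun _ => 1 := by
      filter_upwards [Ioi_mem_nhds h] with s hs using cutoff_of_ge hr (le_of_lt hs)
    rw [this.deriv_eq]; simp

lemma hasCompactSupport_deriv_cutoff {r : ℝ} (hr : 0 < r) :
    HasCompactSupport (deriv (cutoff r)) :=
  HasCompactSupport.intro isCompact_Icc fun _ h => deriv_cutoff_eq_zero hr h

lemma integral_deriv_cutoff {r : ℝ} (hr : 0 < r) : ∫ t, deriv (cutoff r) t = 1 := by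
  have h1 : ∫ t, deriv (cutoff r) t = ∫ t in r..2 * r, deriv (cutoff r) t := by
    rw [intervalIntegral.integral_of_le (by linarith), ← integral_Icc_eq_integral_Ioc,
      setIntegral_eq_integral_of_forall_compl_eq_zero fun t ht => deriv_cutoff_eq_zero hr ht]
  rw [h1, intervalIntegral.integral_deriv_eq_sub
    (fun t _ => (cutoff_contDiff r).differentiable (by simp) t)
    ((continuous_deriv_cutoff r).intervalIntegrable _ _), cutoff_of_le hr le_rfl,
    cutoff_of_ge hr le_rfl, sub_zero]

lemma tendsto_cutoff {t : ℝ} (ht : 0 < t) : Tendsto (fun r => cutoff r t) (𝓝[>] 0) (𝓝 1) := by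
  refine tendsto_const_nhds.congr' ?_
  have : Ioo (0 : ℝ) (t / 2) ∈ 𝓝[>] (0 : ℝ) := Ioo_mem_nhdsGT (by linarith)
  filter_upwards [this] with r hr
  exact (cutoff_of_ge hr.1 (by linarith [hr.2])).symm

/-- The derivatives of the cutoffs converge to the Dirac mass at `0+`. -/
lemma tendsto_integral_deriv_cutoff {m : ℝ → ℝ} {m₀ : ℝ} (hm : Integrable m)
    (hlim : Tendsto m (𝓝[>] 0) (𝓝 m₀)) :
    Tendsto (fun r => ∫ t, deriv (cutoff r) t * m t) (𝓝[>] 0) (𝓝 m₀) := by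
  rw [Metric.tendsto_nhds]
  intro ε hε
  have h1 : ∀ᶠ t in 𝓝[>] (0 : ℝ), dist (m t) m₀ < ε / 2 :=
    (Metric.tendsto_nhds.1 hlim) _ (half_pos hε)
  obtain ⟨ρ, hρ, hρ'⟩ := mem_nhdsGT_iff_exists_Ioo_subset.1 h1
  have hρ0 : (0 : ℝ) < ρ := hρ
  filter_upwards [Ioo_mem_nhdsGT (show (0 : ℝ) < ρ / 2 by linarith)] with r hr
  have hi1 : Integrable (deriv (cutoff r)) :=
    (continuous_deriv_cutoff r).integrable_of_hasCompactSupport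
      (hasCompactSupport_deriv_cutoff hr.1)
  obtain ⟨C, hC⟩ := (continuous_deriv_cutoff r).bounded_above_of_compact_support
    (hasCompactSupport_deriv_cutoff hr.1)
  have hi2 : Integrable fun t => deriv (cutoff r) t * m t :=
    hm.bdd_mul (continuous_deriv_cutoff r).aestronglyMeasurable (ae_of_all _ hC)
  have h2 : (∫ t, deriv (cutoff r) t * m t) - m₀ = ∫ t, deriv (cutoff r) t * (m t - m₀) := by
    have : ∫ t, deriv (cutoff r) t * m₀ = m₀ := by
      rw [integral_mul_const, integral_deriv_cutoff hr.1, one_mul]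
    simp_rw [mul_sub]
    rw [integral_sub hi2 (hi1.mul_const _), this]
  rw [Real.dist_eq, h2]
  -- The derivative of the cutoff is a probability density supported in [r, 2r], which lies in (0,
  -- ρ) because r < ρ / 2.
  have h3 : ‖∫ t, deriv (cutoff r) t * (m t - m₀)‖ ≤ ∫ t, deriv (cutoff r) t * (ε / 2) := by
    refine norm_integral_le_of_norm_le (hi1.mul_const _) (ae_of_all _ fun t => ?_)
    rw [norm_mul, Real.norm_of_nonneg (deriv_cutoff_nonneg hr.1 t)]
    by_cases ht : t ∈ Icc r (2 * r)
    · refine mul_le_mul_of_nonneg_left ?_ (deriv_cutoff_nonneg hr.1 t)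
      have : t ∈ Ioo 0 ρ := ⟨hr.1.trans_le ht.1, by linarith [ht.2, hr.2]⟩
      have := hρ' this
      rw [mem_ofPred_eq, dist_eq_norm] at this
      exact this.le
    · rw [deriv_cutoff_eq_zero hr.1 ht]; simp
  rw [integral_mul_const, integral_deriv_cutoff hr.1, one_mul, Real.norm_eq_abs] at h3
  linarith

/-! ### Absolutely continuous functions of one variable -/

lemma AbsolutelyContinuousOnInterval.congr' {f g : ℝ → ℝ} {a b : ℝ}
    (hf : AbsolutelyContinuousOnInterval f a b) (h : ∀ x ∈ uIcc a b, f x = g x) :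
    AbsolutelyContinuousOnInterval g a b := by
  refine Tendsto.congr' ?_ hf
  refine eventually_inf_principal.2 (Eventually.of_forall fun E hE => ?_)
  refine Finset.sum_congr rfl fun i hi => ?_
  rw [h _ (hE.1 i hi).1, h _ (hE.1 i hi).2]

lemma AbsolutelyContinuousOnInterval.of_integral {f τ : ℝ → ℝ} {a b c : ℝ} (hab : a ≤ b)
    (hτ : IntervalIntegrable τ volume a b) (h : ∀ x ∈ Icc a b, f x = c + ∫ t in a..x, τ t) :
    AbsolutelyContinuousOnInterval f a b := by
  have h1 : AbsolutelyContinuousOnInterval (fun _ => c) a b :=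
    ContDiffOn.absolutelyContinuousOnInterval contDiffOn_const
  refine AbsolutelyContinuousOnInterval.congr'
    (h1.fun_add (hτ.absolutelyContinuousOnInterval_intervalIntegral left_mem_uIcc)) fun x hx => ?_
  rw [uIcc_of_le hab] at hx
  exact (h x hx).symm

/-- On each piece f is a primitive of its integrable derivative, and primitives concatenate. -/
lemma AbsolutelyContinuousOnInterval.trans' {f : ℝ → ℝ} {a b c : ℝ} (hab : a ≤ b) (hbc : b ≤ c)
    (h1 : AbsolutelyContinuousOnInterval f a b) (h2 : AbsolutelyContinuousOnInterval f b c) :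
    AbsolutelyContinuousOnInterval f a c := by
  have i1 := h1.intervalIntegrable_deriv
  have i2 := h2.intervalIntegrable_deriv
  refine AbsolutelyContinuousOnInterval.of_integral (τ := deriv f) (c := f a) (hab.trans hbc)
    (i1.trans i2) fun x hx => ?_
  have left : ∀ y ∈ Icc a b, ∫ t in a..y, deriv f t = f y - f a := fun y hy =>
    (h1.mono (by rw [uIcc_of_le hy.1, uIcc_of_le hab]; exact Icc_subset_Icc_right hy.2)
      ).integral_deriv_eq_sub
  rcases le_total x b with hxb | hxb
  · rw [left x ⟨hx.1, hxb⟩]; ring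
  · have h3 : AbsolutelyContinuousOnInterval f b x :=
      h2.mono (by rw [uIcc_of_le hxb, uIcc_of_le hbc]; exact Icc_subset_Icc_right hx.2)
    rw [← intervalIntegral.integral_add_adjacent_intervals i1 h3.intervalIntegrable_deriv,
      left b ⟨hab, le_rfl⟩, h3.integral_deriv_eq_sub]
    ring

/-- Absolute continuity is local, from the two sides of each point. -/
lemma AbsolutelyContinuousOnInterval.of_local {f : ℝ → ℝ}
    (hr : ∀ x ∈ Ico (0 : ℝ) 1, ∃ ε > 0, AbsolutelyContinuousOnInterval f x (x + ε))
    (hl : ∀ x ∈ Ioc (0 : ℝ) 1, ∃ ε > 0, AbsolutelyContinuousOnInterval f (x - ε) x) :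
    AbsolutelyContinuousOnInterval f 0 1 := by
  set s : Set ℝ := {x | AbsolutelyContinuousOnInterval f 0 x} with hs
  have h0 : (0 : ℝ) ∈ s := by
    obtain ⟨ε, hε, h⟩ := hr 0 (by simp)
    exact h.mono (by simp)
  have hmono : ∀ {x y : ℝ}, 0 ≤ x → x ≤ y → y ∈ s → x ∈ s := fun {x y} hx hxy hy =>
    AbsolutelyContinuousOnInterval.mono hy
      (by rw [uIcc_of_le hx, uIcc_of_le (hx.trans hxy)]; exact Icc_subset_Icc_right hxy)
  have key : Icc (0 : ℝ) 1 ⊆ s := by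
    -- Continuous induction on the right endpoint: the left-sided hypothesis makes the set of good
    -- endpoints closed, the right-sided one lets it be enlarged.
    refine IsClosed.Icc_subset_of_forall_exists_gt ?_ h0 ?_
    · refine isClosed_of_closure_subset fun x hx => ?_
      have hx01 : x ∈ Icc (0 : ℝ) 1 :=
        closure_minimal inter_subset_right isClosed_Icc hx
      refine ⟨?_, hx01⟩
      rcases hx01.1.eq_or_lt with rfl | hx0
      · exact h0
      obtain ⟨ε, hε, hac⟩ := hl x ⟨hx0, hx01.2⟩
      obtain ⟨y, hy, hys⟩ := mem_closure_iff.1 hx (Ioi (x - ε)) isOpen_Ioi (by simp [hε])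
      rcases le_total x y with h | h
      · exact hmono hx0.le h hys.1
      · refine AbsolutelyContinuousOnInterval.trans' hys.2.1 h hys.1 (hac.mono ?_)
        rw [uIcc_of_le h, uIcc_of_le (by linarith)]
        exact Icc_subset_Icc_left (le_of_lt hy)
    · rintro x ⟨hxs, hx⟩ y hy
      obtain ⟨ε, hε, hac⟩ := hr x hx
      have hxy : x < y := hy
      refine ⟨min y (x + ε), ?_, ?_, min_le_left _ _⟩
      · refine AbsolutelyContinuousOnInterval.trans' hx.1 (le_min hxy.le (by linarith)) hxs
          (hac.mono ?_)
        rw [uIcc_of_le (le_min hxy.le (by linarith)), uIcc_of_le (by linarith)]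
        exact Icc_subset_Icc_right (min_le_right _ _)
      · exact lt_min hxy (by linarith)
  exact key (right_mem_Icc.2 zero_le_one)

/-- A continuous function on `[0, a]` with an integrable weak derivative is absolutely
continuous. -/
lemma AbsolutelyContinuousOnInterval.of_weakDeriv {f τ : ℝ → ℝ} {a : ℝ} (ha : 0 < a)
    (hf : ContinuousOn f (Icc 0 a)) (hτ : Integrable τ)
    (h : ∀ η : ℝ → ℝ, ContDiff ℝ ∞ η → HasCompactSupport η → tsupport η ⊆ Ioo 0 a →
      ∫ s in Ioo 0 a, f s * deriv η s = -∫ s, τ s * η s) :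
    AbsolutelyContinuousOnInterval f 0 a := by
  have hF : Integrable ((Ioo 0 a).indicator f) := by
    rw [integrable_indicator_iff measurableSet_Ioo]
    exact (hf.integrableOn_Icc).mono_set Ioo_subset_Icc_self
  have hdirac : ∀ x ∈ Ioo 0 a, Tendsto (fun r => ∫ s, (Ioo 0 a).indicator f s *
      deriv (cutoff r) (s - x)) (𝓝[>] 0) (𝓝 (f x)) := by
    intro x hx
    have h1 : Tendsto (fun t => (Ioo 0 a).indicator f (t + x)) (𝓝[>] 0) (𝓝 (f x)) := by
      have hcx : ContinuousAt f x := hf.continuousAt (Icc_mem_nhds hx.1 hx.2)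
      have h2 : Tendsto (fun t : ℝ => t + x) (𝓝[>] 0) (𝓝 x) := by
        have : Tendsto (fun t : ℝ => t + x) (𝓝 0) (𝓝 (0 + x)) :=
          (continuous_id.add continuous_const).tendsto 0
        rw [zero_add] at this
        exact this.mono_left nhdsWithin_le_nhds
      refine (hcx.tendsto.comp h2).congr' ?_
      filter_upwards [h2.eventually (Ioo_mem_nhds hx.1 hx.2)] with t ht
      exact (indicator_of_mem (show t + x ∈ Ioo 0 a from ht) f).symm
    refine (tendsto_integral_deriv_cutoff (hF.comp_add_right x) h1).congr fun r => ?_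
    rw [← integral_add_right_eq_self (fun s => (Ioo 0 a).indicator f s * deriv (cutoff r) (s - x)) x]
    simp [mul_comm]
  -- The test function `cutoff r (s - x) - cutoff r (s - y)` approximates the indicator of (x, y].
  -- As r → 0 its derivative tests f into f x - f y, while the right side tends to minus the
  -- integral of τ over (x, y].
  have key : ∀ x ∈ Ioo 0 a, ∀ y ∈ Ioo 0 a, x ≤ y → f y - f x = ∫ t in x..y, τ t := by
    intro x hx y hy hxy
    have hshift : ∀ r z s, deriv (fun s => cutoff r (s - z)) s = deriv (cutoff r) (s - z) :=
      fun r z s => deriv_comp_sub_const _ _ _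
    have hdiff : ∀ r z, ContDiff ℝ ∞ fun s => cutoff r (s - z) := fun r z =>
      (cutoff_contDiff r).comp (contDiff_id.sub contDiff_const)
    have hev : ∀ᶠ r in 𝓝[>] (0 : ℝ),
        (∫ s, (Ioo 0 a).indicator f s * deriv (cutoff r) (s - x)) -
          (∫ s, (Ioo 0 a).indicator f s * deriv (cutoff r) (s - y)) =
        -∫ s, τ s * (cutoff r (s - x) - cutoff r (s - y)) := by
      -- This bound on r keeps the support, which ends at y + 2r, inside (0, a).
      filter_upwards [Ioo_mem_nhdsGT (show (0 : ℝ) < (a - y) / 2 by linarith [hy.2])] with r hr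
      have hzero : ∀ s ∉ Icc (x + r) (y + 2 * r), cutoff r (s - x) - cutoff r (s - y) = 0 := by
        intro s hs
        rw [mem_Icc, not_and_or, not_le, not_le] at hs
        rcases hs with hs | hs
        · rw [cutoff_of_le hr.1 (by linarith), cutoff_of_le hr.1 (by linarith), sub_zero]
        · rw [cutoff_of_ge hr.1 (by linarith), cutoff_of_ge hr.1 (by linarith), sub_self]
      have hsupp : tsupport (fun s => cutoff r (s - x) - cutoff r (s - y)) ⊆
          Icc (x + r) (y + 2 * r) := by
        refine closure_minimal (fun s hs => ?_) isClosed_Icc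
        by_contra hs'
        exact hs (hzero s hs')
      have := h (fun s => cutoff r (s - x) - cutoff r (s - y)) ((hdiff r x).sub (hdiff r y))
        (HasCompactSupport.intro isCompact_Icc hzero)
        (hsupp.trans (Icc_subset_Ioo (by linarith [hx.1, hr.1]) (by linarith [hr.2])))
      rw [← this, ← integral_indicator measurableSet_Ioo]
      have hInt : ∀ z, Integrable fun s => (Ioo 0 a).indicator f s * deriv (cutoff r) (s - z) := by
        intro z
        obtain ⟨C, hC⟩ := (continuous_deriv_cutoff r).bounded_above_of_compact_support
          (hasCompactSupport_deriv_cutoff hr.1)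
        exact hF.mul_bdd ((continuous_deriv_cutoff r).comp
          (continuous_id.sub continuous_const)).aestronglyMeasurable (ae_of_all _ fun s => hC _)
      rw [← integral_sub (hInt x) (hInt y)]
      congr 1
      funext s
      by_cases hs : s ∈ Ioo 0 a
      · rw [indicator_of_mem hs, indicator_of_mem hs, deriv_fun_sub
          ((hdiff r x).differentiable (by simp) s) ((hdiff r y).differentiable (by simp) s),
          hshift, hshift]
        ring
      · rw [indicator_of_notMem hs, indicator_of_notMem hs]; ring
    have hlim1 := (hdirac x hx).sub (hdirac y hy)
    have hlim2 : Tendsto (fun r => -∫ s, τ s * (cutoff r (s - x) - cutoff r (s - y))) (𝓝[>] 0)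
        (𝓝 (-∫ s, (Ioc x y).indicator τ s)) := by
      refine Tendsto.neg (tendsto_integral_filter_of_dominated_convergence (fun s => ‖τ s‖)
        (Eventually.of_forall fun r => hτ.aestronglyMeasurable.mul
          ((hdiff r x).sub (hdiff r y)).continuous.aestronglyMeasurable)
        (Eventually.of_forall fun r => ae_of_all _ fun s => ?_) hτ.norm (ae_of_all _ fun s => ?_))
      · rw [norm_mul]
        refine mul_le_of_le_one_right (norm_nonneg _) ?_
        rw [Real.norm_eq_abs, abs_le]
        constructor <;> linarith [(cutoff_mem r (s - x)).1, (cutoff_mem r (s - x)).2,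
          (cutoff_mem r (s - y)).1, (cutoff_mem r (s - y)).2]
      · have hle : ∀ z, s ≤ z → Tendsto (fun r => cutoff r (s - z)) (𝓝[>] 0) (𝓝 0) := by
          intro z hz
          refine tendsto_const_nhds.congr' ?_
          filter_upwards [self_mem_nhdsWithin] with r hr
          have hr' : (0 : ℝ) < r := hr
          exact (cutoff_of_le hr' (by linarith)).symm
        have hgt : ∀ z, z < s → Tendsto (fun r => cutoff r (s - z)) (𝓝[>] 0) (𝓝 1) :=
          fun z hz => tendsto_cutoff (by linarith)
        rcases le_or_gt s x with h1 | h1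
        · rw [indicator_of_notMem fun h2 => absurd h2.1 (not_lt.2 h1)]
          simpa using ((hle x h1).sub (hle y (h1.trans hxy))).const_mul (τ s)
        · rcases le_or_gt s y with h2 | h2
          · rw [indicator_of_mem (show s ∈ Ioc x y from ⟨h1, h2⟩)]
            simpa using ((hgt x h1).sub (hle y h2)).const_mul (τ s)
          · rw [indicator_of_notMem fun h3 => absurd h3.2 (not_le.2 h2)]
            simpa using ((hgt x h1).sub (hgt y h2)).const_mul (τ s)
    have := tendsto_nhds_unique (hlim1.congr' hev) hlim2
    rw [integral_indicator measurableSet_Ioc, ← intervalIntegral.integral_of_le hxy] at this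
    linarith
  -- The difference of f and the primitive is constant in the open interval; its continuity carries
  -- this to the endpoints.
  have hcont : ContinuousOn (fun s => f s - ∫ t in (0 : ℝ)..s, τ t) (Icc 0 a) :=
    hf.sub (intervalIntegral.continuous_primitive (fun _ _ => hτ.intervalIntegrable) 0).continuousOn
  have hconst : ∀ x ∈ Icc 0 a, f x - ∫ t in (0 : ℝ)..x, τ t =
      f (a / 2) - ∫ t in (0 : ℝ)..a / 2, τ t := by
    have hmid : a / 2 ∈ Ioo 0 a := ⟨by linarith, by linarith⟩
    have hin : ∀ x ∈ Ioo 0 a, f x - ∫ t in (0 : ℝ)..x, τ t =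
        f (a / 2) - ∫ t in (0 : ℝ)..a / 2, τ t := by
      intro x hx
      have hsplit := intervalIntegral.integral_interval_sub_left
        (hτ.intervalIntegrable (a := 0) (b := a / 2)) (hτ.intervalIntegrable (a := 0) (b := x))
      rcases le_total x (a / 2) with hle | hle
      · have := key x hx _ hmid hle; linarith
      · have := key _ hmid x hx hle
        rw [intervalIntegral.integral_symm (a / 2) x] at hsplit; linarith
    have hcl : Icc 0 a ⊆ closure (Ioo 0 a) := by rw [closure_Ioo ha.ne]
    intro x hx
    exact (Set.EqOn.of_subset_closure (s := Ioo 0 a) (t := Icc 0 a) (fun y hy => hin y hy) hcont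
      continuousOn_const Ioo_subset_Icc_self hcl) hx
  refine AbsolutelyContinuousOnInterval.of_integral ha.le hτ.intervalIntegrable
    (c := f (a / 2) - ∫ t in (0 : ℝ)..a / 2, τ t) fun x hx => ?_
  rw [← hconst x hx]; ring

end

end IFE

/-! ### Calculus of weak derivatives and affine changes of variables. -/

namespace IFE

open MeasureTheory Set Filter Topology
open scoped ContDiff

noncomputable section

/-! ### Test functions and weak derivatives -/

lemma IsTest.differentiable {φ : Plane → ℝ} (h : IsTest φ) : Differentiable ℝ φ :=
  h.1.differentiable (by simp)

lemma contDiff_pd {φ : Plane → ℝ} (h : ContDiff ℝ ∞ φ) (j : Fin 2) : ContDiff ℝ ∞ (pd j φ) := by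
  unfold pd
  exact (h.fderiv_right (m := ∞) (by simp)).clm_apply contDiff_const

lemma tsupport_pd_subset (φ : Plane → ℝ) (j : Fin 2) : tsupport (pd j φ) ⊆ tsupport φ := by
  refine closure_minimal (fun x hx => ?_) (isClosed_tsupport φ)
  by_contra h
  apply hx
  have : φ =ᶠ[𝓝 x] 0 := notMem_tsupport_iff_eventuallyEq.1 h
  rw [pd, this.fderiv_eq]
  simp

lemma IsTest.pd {φ : Plane → ℝ} (h : IsTest φ) (j : Fin 2) : IsTest (pd j φ) :=
  ⟨contDiff_pd h.1 j, h.2.of_isClosed_subset (isClosed_tsupport _) (tsupport_pd_subset φ j)⟩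

lemma fderiv_eq_pd (φ : Plane → ℝ) (x e : Plane) :
    fderiv ℝ φ x e = e 0 * pd 0 φ x + e 1 * pd 1 φ x := by
  have : e = e 0 • EuclideanSpace.single 0 1 + e 1 • EuclideanSpace.single 1 1 := by
    apply plane_ext <;> simp
  conv_lhs => rw [this]
  simp [pd]

lemma pd_mul {φ ψ : Plane → ℝ} {x : Plane} (hφ : DifferentiableAt ℝ φ x)
    (hψ : DifferentiableAt ℝ ψ x) (j : Fin 2) :
    pd j (fun y => φ y * ψ y) x = pd j φ x * ψ x + φ x * pd j ψ x := by
  simp only [pd]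
  rw [fderiv_fun_mul hφ hψ]
  simp
  ring

lemma pd_comm {φ : Plane → ℝ} (h : ContDiff ℝ ∞ φ) (i j : Fin 2) (x : Plane) :
    pd i (pd j φ) x = pd j (pd i φ) x := by
  have hsym : IsSymmSndFDerivAt ℝ φ x :=
    (h.contDiffAt).isSymmSndFDerivAt (by simpa using WithTop.coe_le_coe.2 (le_top : (2 : ℕ∞) ≤ ⊤))
  have hd : DifferentiableAt ℝ (fderiv ℝ φ) x :=
    ((h.fderiv_right (m := ∞) (by simp)).differentiable (by simp)) x
  have key : ∀ e e' : Plane, fderiv ℝ (fun y => fderiv ℝ φ y e) x e' =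
      fderiv ℝ (fderiv ℝ φ) x e' e := by
    intro e e'
    rw [fderiv_clm_apply hd (differentiableAt_const _)]
    simp
  unfold pd
  rw [key, key]
  exact hsym _ _

lemma integrableOn_mul_of_tsupport {U : Set Plane} {f φ : Plane → ℝ}
    (hf : LocallyIntegrableOn f U) (hφ : Continuous φ) (hc : HasCompactSupport φ)
    (hs : tsupport φ ⊆ U) : IntegrableOn (fun x => f x * φ x) U := by
  have h1 : IntegrableOn (fun x => f x * φ x) (tsupport φ) :=
    (hf.integrableOn_compact_subset hs hc).mul_continuousOn hφ.continuousOn hc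
  have h2 : Integrable (fun x => f x * φ x) := by
    refine (integrableOn_iff_integrable_of_support_subset ?_).1 h1
    intro x hx
    refine subset_tsupport φ ?_
    intro h0
    apply hx
    simp [h0]
  exact h2.integrableOn

lemma HasWeakPartial.mono {U V : Set Plane} {j : Fin 2} {f g : Plane → ℝ}
    (h : HasWeakPartial U j f g) (hU : IsOpen U) (hVU : V ⊆ U) :
    HasWeakPartial V j f g := by
  refine ⟨h.locInt.mono_set hVU, h.locInt'.mono_set hVU, fun φ hφ hs => ?_⟩
  have key : ∀ F : Plane → ℝ, (∀ x ∉ V, F x = 0) → ∫ x in V, F x = ∫ x in U, F x := fun F hF =>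
    (setIntegral_eq_of_subset_of_forall_sdiff_eq_zero hU.measurableSet hVU
      fun x hx => hF x hx.2).symm
  rw [key, key]
  · exact h.eq φ hφ (hs.trans hVU)
  · intro x hx
    rw [image_eq_zero_of_notMem_tsupport fun h' => hx (hs h'), mul_zero]
  · intro x hx
    rw [image_eq_zero_of_notMem_tsupport fun h' => hx (hs (tsupport_pd_subset φ j h')), mul_zero]

lemma setIntegral_eq_integral_of_tsupport {U : Set Plane} {φ : Plane → ℝ}
    (hs : tsupport φ ⊆ U) (f : Plane → ℝ) : ∫ x in U, f x * φ x = ∫ x, φ x • f x := by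
  rw [setIntegral_eq_integral_of_forall_compl_eq_zero]
  · simp [mul_comm]
  · intro x hx
    rw [image_eq_zero_of_notMem_tsupport fun h' => hx (hs h'), mul_zero]

/-- Locally integrable functions are determined by their integrals against test functions. -/
lemma ae_eq_of_test {U : Set Plane} (hU : IsOpen U) {g g' : Plane → ℝ}
    (hg : LocallyIntegrableOn g U) (hg' : LocallyIntegrableOn g' U)
    (h : ∀ φ, IsTest φ → tsupport φ ⊆ U → ∫ x in U, g x * φ x = ∫ x in U, g' x * φ x) :
    ∀ᵐ x, x ∈ U → g x = g' x := by
  have := hU.ae_eq_zero_of_integral_contDiff_smul_eq_zero (μ := volume) (hg.sub hg')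
    fun φ h1 h2 h3 => by
      have h4 := h φ ⟨h1, h2⟩ h3
      rw [← setIntegral_eq_integral_of_tsupport h3]
      simp only [Pi.sub_apply, sub_mul]
      rw [integral_sub (integrableOn_mul_of_tsupport hg h1.continuous h2 h3)
        (integrableOn_mul_of_tsupport hg' h1.continuous h2 h3), h4, sub_self]
  filter_upwards [this] with x hx hxU
  exact sub_eq_zero.1 (hx hxU)

lemma HasWeakPartial.ae_eq {U : Set Plane} (hU : IsOpen U) {j : Fin 2} {f g g' : Plane → ℝ}
    (h : HasWeakPartial U j f g) (h' : HasWeakPartial U j f g') :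
    ∀ᵐ x, x ∈ U → g x = g' x :=
  ae_eq_of_test hU h.locInt' h'.locInt' fun φ hφ hs => by
    have h1 := h.eq φ hφ hs
    have h2 := h'.eq φ hφ hs
    linarith

lemma weak_directional {U : Set Plane} {f g₀ g₁ : Plane → ℝ} (h₀ : HasWeakPartial U 0 f g₀)
    (h₁ : HasWeakPartial U 1 f g₁) (e : Plane) {φ : Plane → ℝ} (hφ : IsTest φ)
    (hs : tsupport φ ⊆ U) :
    ∫ x in U, f x * fderiv ℝ φ x e = -∫ x in U, (e 0 * g₀ x + e 1 * g₁ x) * φ x := by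
  have hi : ∀ j, IntegrableOn (fun x => f x * pd j φ x) U := fun j =>
    integrableOn_mul_of_tsupport h₀.locInt (hφ.pd j).1.continuous (hφ.pd j).2
      ((tsupport_pd_subset φ j).trans hs)
  have i₀ := integrableOn_mul_of_tsupport h₀.locInt' hφ.1.continuous hφ.2 hs
  have i₁ := integrableOn_mul_of_tsupport h₁.locInt' hφ.1.continuous hφ.2 hs
  have e1 : ∫ x in U, f x * fderiv ℝ φ x e =
      e 0 * (∫ x in U, f x * pd 0 φ x) + e 1 * ∫ x in U, f x * pd 1 φ x := by
    rw [← integral_const_mul, ← integral_const_mul,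
      ← integral_add ((hi 0).const_mul _) ((hi 1).const_mul _)]
    congr 1; funext x; rw [fderiv_eq_pd]; ring
  have e2 : ∫ x in U, (e 0 * g₀ x + e 1 * g₁ x) * φ x =
      e 0 * (∫ x in U, g₀ x * φ x) + e 1 * ∫ x in U, g₁ x * φ x := by
    rw [← integral_const_mul, ← integral_const_mul,
      ← integral_add (i₀.const_mul _) (i₁.const_mul _)]
    congr 1; funext x; ring
  rw [e1, e2, h₀.eq φ hφ hs, h₁.eq φ hφ hs]
  ring

/-! ### Affine coordinates -/

/-- The affine parametrization of the plane with origin `x₀` and axes `e`, `w`. -/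
def par (x₀ e w : Plane) (p : ℝ × ℝ) : Plane := x₀ + p.1 • e + p.2 • w

/-- The first coordinate. -/
def coordS (x₀ e w x : Plane) : ℝ := cross (x - x₀) w / cross e w

/-- The second coordinate. -/
def coordT (x₀ e w x : Plane) : ℝ := cross e (x - x₀) / cross e w

lemma continuous_par (x₀ e w : Plane) : Continuous (par x₀ e w) := by
  unfold par; fun_prop

lemma coordS_par {x₀ e w : Plane} (hc : cross e w ≠ 0) (p : ℝ × ℝ) :
    coordS x₀ e w (par x₀ e w p) = p.1 := by
  rw [coordS, div_eq_iff hc]; simp [cross, par]; ring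

lemma coordT_par {x₀ e w : Plane} (hc : cross e w ≠ 0) (p : ℝ × ℝ) :
    coordT x₀ e w (par x₀ e w p) = p.2 := by
  rw [coordT, div_eq_iff hc]; simp [cross, par]; ring

lemma par_coord {x₀ e w : Plane} (hc : cross e w ≠ 0) (x : Plane) :
    par x₀ e w (coordS x₀ e w x, coordT x₀ e w x) = x := by
  have h := hc
  apply plane_ext <;>
  · simp [par, coordS, coordT]
    field_simp
    simp [cross]
    ring

lemma contDiff_coordS (x₀ e w : Plane) : ContDiff ℝ ∞ (coordS x₀ e w) := by
  unfold coordS cross; simp only [PiLp.sub_apply]; fun_prop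

lemma contDiff_coordT (x₀ e w : Plane) : ContDiff ℝ ∞ (coordT x₀ e w) := by
  unfold coordT cross; simp only [PiLp.sub_apply]; fun_prop

/-- The parametrization as a homeomorphism. -/
def parHomeo (x₀ e w : Plane) (hc : cross e w ≠ 0) : ℝ × ℝ ≃ₜ Plane where
  toFun := par x₀ e w
  invFun x := (coordS x₀ e w x, coordT x₀ e w x)
  left_inv p := Prod.ext (coordS_par hc p) (coordT_par hc p)
  right_inv x := par_coord hc x
  continuous_toFun := continuous_par x₀ e w
  continuous_invFun := (contDiff_coordS x₀ e w).continuous.prodMk (contDiff_coordT x₀ e w).continuous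

lemma measurableEmbedding_par {x₀ e w : Plane} (hc : cross e w ≠ 0) :
    MeasurableEmbedding (par x₀ e w) :=
  (parHomeo x₀ e w hc).measurableEmbedding

lemma map_par {x₀ e w : Plane} (hc : cross e w ≠ 0) :
    Measure.map (par x₀ e w) volume = ENNReal.ofReal |(cross e w)⁻¹| • volume := by
  obtain ⟨L, hL⟩ : ∃ L : Plane →ₗ[ℝ] Plane, ∀ x, L x = x 0 • e + x 1 • w :=
    ⟨{ toFun := fun x => x 0 • e + x 1 • w
       map_add' := fun x y => by simp [add_smul]; abel
       map_smul' := fun c x => by simp [smul_smul] }, fun _ => rfl⟩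
  have hdet : LinearMap.det L = cross e w := by
    rw [← LinearMap.det_toMatrix (EuclideanSpace.basisFun (Fin 2) ℝ).toBasis, Matrix.det_fin_two]
    simp [LinearMap.toMatrix_apply, hL, cross]
    ring
  have h1 : MeasurePreserving (fun p : ℝ × ℝ => WithLp.toLp 2 ![p.1, p.2] : ℝ × ℝ → Plane)
      volume volume :=
    (PiLp.volume_preserving_toLp (Fin 2)).comp (volume_preserving_finTwoArrow ℝ).symm
  -- A translation and a measure-preserving identification surround the linear map with columns e
  -- and w, whose determinant is `cross e w`.
  have h2 : par x₀ e w = (fun x => x₀ + x) ∘ L ∘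
      (fun p : ℝ × ℝ => WithLp.toLp 2 ![p.1, p.2] : ℝ × ℝ → Plane) := by
    funext p
    simp [par, hL, add_assoc]
  have hLm : Measurable L := L.continuous_of_finiteDimensional.measurable
  rw [h2, ← Measure.map_map (measurable_const_add x₀) (hLm.comp h1.measurable),
    ← Measure.map_map hLm h1.measurable, h1.map_eq,
    Measure.map_linearMap_addHaar_eq_smul_addHaar volume (by rw [hdet]; exact hc), hdet,
    Measure.map_smul, map_add_left_eq_self]

lemma setIntegral_par {x₀ e w : Plane} (hc : cross e w ≠ 0) (U : Set Plane) (F : Plane → ℝ) :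
    ∫ x in U, F x = |cross e w| * ∫ p in par x₀ e w ⁻¹' U, F (par x₀ e w p) := by
  rw [← (measurableEmbedding_par hc).setIntegral_map F U, map_par hc, Measure.restrict_smul,
    integral_smul_measure, ENNReal.toReal_ofReal (abs_nonneg _), abs_inv, smul_eq_mul,
    mul_inv_cancel_left₀ (abs_ne_zero.2 hc)]

lemma integrableOn_par_iff {x₀ e w : Plane} (hc : cross e w ≠ 0) (U : Set Plane)
    (F : Plane → ℝ) :
    IntegrableOn (F ∘ par x₀ e w) (par x₀ e w ⁻¹' U) ↔ IntegrableOn F U := by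
  rw [← (measurableEmbedding_par hc).integrableOn_map_iff, map_par hc, IntegrableOn,
    Measure.restrict_smul, integrable_smul_measure
    (by simpa [abs_pos] using hc) ENNReal.ofReal_ne_top, IntegrableOn]

end

end IFE

/-! ### Absolute continuity of an H² function on a side of a parallelogram. -/

namespace IFE

open MeasureTheory Set Filter Topology
open scoped ContDiff

noncomputable section

/-! ### Restriction of `H²` functions to a side of a parallelogram -/

/-- The product of functions of the two affine coordinates. -/
def tensor (x₀ e w : Plane) (η ζ : ℝ → ℝ) (x : Plane) : ℝ :=
  η (coordS x₀ e w x) * ζ (coordT x₀ e w x)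

section Tensor

variable {x₀ e w : Plane} {η ζ : ℝ → ℝ}

lemma tensor_par (hc : cross e w ≠ 0) (η ζ : ℝ → ℝ) (p : ℝ × ℝ) :
    tensor x₀ e w η ζ (par x₀ e w p) = η p.1 * ζ p.2 := by
  rw [tensor, coordS_par hc, coordT_par hc]

lemma contDiff_tensor (hη : ContDiff ℝ ∞ η) (hζ : ContDiff ℝ ∞ ζ) :
    ContDiff ℝ ∞ (tensor x₀ e w η ζ) :=
  (hη.comp (contDiff_coordS x₀ e w)).mul (hζ.comp (contDiff_coordT x₀ e w))

lemma tsupport_tensor_subset (hc : cross e w ≠ 0) (hcη : HasCompactSupport η)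
    (hcζ : HasCompactSupport ζ) :
    IsCompact (par x₀ e w '' (tsupport η ×ˢ tsupport ζ)) ∧
    tsupport (tensor x₀ e w η ζ) ⊆ par x₀ e w '' (tsupport η ×ˢ tsupport ζ) := by
  have hk : IsCompact (par x₀ e w '' (tsupport η ×ˢ tsupport ζ)) :=
    (IsCompact.prod hcη hcζ).image (continuous_par x₀ e w)
  refine ⟨hk, closure_minimal (fun x hx => ?_) hk.isClosed⟩
  refine ⟨(coordS x₀ e w x, coordT x₀ e w x), ⟨subset_tsupport η ?_, subset_tsupport ζ ?_⟩,
    par_coord hc x⟩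
  · exact left_ne_zero_of_mul hx
  · exact right_ne_zero_of_mul hx

lemma isTest_tensor (hc : cross e w ≠ 0) (hη : ContDiff ℝ ∞ η) (hζ : ContDiff ℝ ∞ ζ)
    (hcη : HasCompactSupport η) (hcζ : HasCompactSupport ζ) : IsTest (tensor x₀ e w η ζ) :=
  ⟨contDiff_tensor hη hζ, (tsupport_tensor_subset hc hcη hcζ).1.of_isClosed_subset
    (isClosed_tsupport _) (tsupport_tensor_subset hc hcη hcζ).2⟩

lemma fderiv_tensor_left (hc : cross e w ≠ 0) (hη : ContDiff ℝ ∞ η) (hζ : ContDiff ℝ ∞ ζ)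
    (p : ℝ × ℝ) :
    fderiv ℝ (tensor x₀ e w η ζ) (par x₀ e w p) e = deriv η p.1 * ζ p.2 := by
  rw [← ((contDiff_tensor hη hζ).differentiable (by simp) _).lineDeriv_eq_fderiv, lineDeriv]
  have h : (fun r : ℝ => tensor x₀ e w η ζ (par x₀ e w p + r • e)) =
      fun r => η (p.1 + r) * ζ p.2 := by
    funext r
    have : par x₀ e w p + r • e = par x₀ e w (p.1 + r, p.2) := by
      simp only [par, add_smul]; abel
    rw [this, tensor_par hc]
  rw [h, deriv_mul_const_field, deriv_comp_const_add, add_zero]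

lemma fderiv_tensor_right (hc : cross e w ≠ 0) (hη : ContDiff ℝ ∞ η) (hζ : ContDiff ℝ ∞ ζ)
    (p : ℝ × ℝ) :
    fderiv ℝ (tensor x₀ e w η ζ) (par x₀ e w p) w = η p.1 * deriv ζ p.2 := by
  rw [← ((contDiff_tensor hη hζ).differentiable (by simp) _).lineDeriv_eq_fderiv, lineDeriv]
  have h : (fun r : ℝ => tensor x₀ e w η ζ (par x₀ e w p + r • w)) =
      fun r => η p.1 * ζ (p.2 + r) := by
    funext r
    have : par x₀ e w p + r • w = par x₀ e w (p.1, p.2 + r) := by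
      simp only [par, add_smul]; abel
    rw [this, tensor_par hc]
  rw [h, deriv_const_mul_field, deriv_comp_const_add, add_zero]

end Tensor

/-- A weak directional derivative in affine coordinates, tested with products. -/
lemma weak_par {V : Set Plane} {x₀ e w d : Plane} (hc : cross e w ≠ 0)
    {f g : Plane → ℝ}
    (hd : ∀ φ, IsTest φ → tsupport φ ⊆ V →
      ∫ x in V, f x * fderiv ℝ φ x d = -∫ x in V, g x * φ x)
    {I J : Set ℝ} (hsub : ∀ p ∈ I ×ˢ J, par x₀ e w p ∈ V)
    {η ζ : ℝ → ℝ} (hη : ContDiff ℝ ∞ η) (hζ : ContDiff ℝ ∞ ζ)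
    (hcη : HasCompactSupport η) (hcζ : HasCompactSupport ζ) (hηI : tsupport η ⊆ I)
    (hζJ : tsupport ζ ⊆ J) :
    ∫ p, (I ×ˢ J).indicator (f ∘ par x₀ e w) p *
        fderiv ℝ (tensor x₀ e w η ζ) (par x₀ e w p) d =
      -∫ p, (I ×ˢ J).indicator (g ∘ par x₀ e w) p * (η p.1 * ζ p.2) := by
  have hs := (tsupport_tensor_subset (x₀ := x₀) hc hcη hcζ).2
  have himg : par x₀ e w '' (tsupport η ×ˢ tsupport ζ) ⊆ V := by
    rintro _ ⟨p, hp, rfl⟩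
    exact hsub p ⟨hηI hp.1, hζJ hp.2⟩
  have h1 := hd _ (isTest_tensor (x₀ := x₀) hc hη hζ hcη hcζ) (hs.trans himg)
  have key : ∀ F φ : Plane → ℝ, (∀ x ∉ par x₀ e w '' (tsupport η ×ˢ tsupport ζ), φ x = 0) →
      ∫ x in V, F x * φ x = |cross e w| *
        ∫ p, (I ×ˢ J).indicator (F ∘ par x₀ e w) p * φ (par x₀ e w p) := by
    intro F φ hφ
    rw [setIntegral_eq_integral_of_forall_compl_eq_zero (fun x hx => by
      rw [hφ x fun h => hx (himg h), mul_zero]), ← setIntegral_univ, setIntegral_par hc]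
    simp only [preimage_univ, setIntegral_univ]
    congr 2
    funext p
    by_cases hp : p ∈ I ×ˢ J
    · rw [indicator_of_mem hp]; rfl
    · rw [indicator_of_notMem hp, hφ (par x₀ e w p), mul_zero, mul_zero]
      rintro ⟨q, hq, hqp⟩
      have : q = p := (parHomeo x₀ e w hc).injective hqp
      exact hp (this ▸ ⟨hηI hq.1, hζJ hq.2⟩)
  rw [key, key] at h1
  · have hne : |cross e w| ≠ 0 := abs_ne_zero.2 hc
    have h2 := mul_left_cancel₀ hne (h1.trans (mul_neg _ _).symm)
    rw [h2]
    simp only [tensor_par hc]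
  · exact fun x hx => image_eq_zero_of_notMem_tsupport fun h => hx (hs h)
  · intro x hx
    have : tensor x₀ e w η ζ =ᶠ[𝓝 x] 0 :=
      notMem_tsupport_iff_eventuallyEq.1 fun h => hx (hs h)
    rw [this.fderiv_eq]; simp

lemma integrable_indicator_par {V : Set Plane} {x₀ e w : Plane} (hc : cross e w ≠ 0) {a δ : ℝ}
    (hsub : ∀ p ∈ Ioo 0 a ×ˢ Ioo 0 δ, par x₀ e w p ∈ V) {F : Plane → ℝ}
    (hF : MemLp F 2 (volume.restrict V)) :
    Integrable ((Ioo 0 a ×ˢ Ioo 0 δ).indicator (F ∘ par x₀ e w)) := by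
  have hR : MeasurableSet (Ioo 0 a ×ˢ Ioo 0 δ) := measurableSet_Ioo.prod measurableSet_Ioo
  rw [integrable_indicator_iff hR]
  set B := par x₀ e w '' (Ioo 0 a ×ˢ Ioo 0 δ) with hB
  have hpre : par x₀ e w ⁻¹' B = Ioo 0 a ×ˢ Ioo 0 δ :=
    preimage_image_eq _ (parHomeo x₀ e w hc).injective
  rw [← hpre, integrableOn_par_iff hc]
  have hBV : B ⊆ V := by rintro _ ⟨p, hp, rfl⟩; exact hsub p hp
  have hfin : volume B < ⊤ := by
    have hk : IsCompact (par x₀ e w '' (Icc 0 a ×ˢ Icc 0 δ)) :=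
      (isCompact_Icc.prod isCompact_Icc).image (continuous_par x₀ e w)
    refine (measure_mono ?_).trans_lt hk.measure_lt_top
    exact image_mono (prod_mono Ioo_subset_Icc_self Ioo_subset_Icc_self)
  have : IsFiniteMeasure (volume.restrict B) := ⟨by simpa using hfin⟩
  exact (hF.mono_measure (Measure.restrict_mono hBV le_rfl)).integrable one_le_two

/-- The restriction of an `H²` function, continuous up to the boundary, to a side of a
parallelogram in its domain is absolutely continuous. -/
theorem MemH2.absolutelyContinuous_side {V : Set Plane} {v : Plane → ℝ} (hv : MemH2 V v)
    {x₀ e w : Plane} (hc : cross e w ≠ 0) {a δ : ℝ} (ha : 0 < a) (hδ : 0 < δ)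
    (hsub : ∀ p ∈ Ioo 0 a ×ˢ Ioo 0 δ, par x₀ e w p ∈ V)
    (hcont : ContinuousOn (v ∘ par x₀ e w) (Icc 0 a ×ˢ Icc 0 δ)) :
    AbsolutelyContinuousOnInterval (fun s => v (x₀ + s • e)) 0 a := by
  obtain ⟨hvL, hv'⟩ := hv
  obtain ⟨g₀, ⟨hg₀, hg₀'⟩, hvg₀⟩ := hv' 0
  obtain ⟨g₁, ⟨hg₁, hg₁'⟩, hvg₁⟩ := hv' 1
  obtain ⟨h₀₀, hh₀₀, hw₀₀⟩ := hg₀' 0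
  obtain ⟨h₀₁, hh₀₁, hw₀₁⟩ := hg₀' 1
  obtain ⟨h₁₀, hh₁₀, hw₁₀⟩ := hg₁' 0
  obtain ⟨h₁₁, hh₁₁, hw₁₁⟩ := hg₁' 1
  -- Here g is the derivative of v along the side e, and h is the derivative of g in the transversal
  -- direction w. Second derivatives are needed to give g a trace on the side.
  set g : Plane → ℝ := fun x => e 0 * g₀ x + e 1 * g₁ x with hg
  set h : Plane → ℝ := fun x => e 0 * (w 0 * h₀₀ x + w 1 * h₀₁ x) +
    e 1 * (w 0 * h₁₀ x + w 1 * h₁₁ x) with hh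
  have hgL : MemLp g 2 (volume.restrict V) := (hg₀.const_mul _).add (hg₁.const_mul _)
  have hhL : MemLp h 2 (volume.restrict V) :=
    (((hh₀₀.const_mul _).add (hh₀₁.const_mul _)).const_mul _).add
      (((hh₁₀.const_mul _).add (hh₁₁.const_mul _)).const_mul _)
  have hwv : ∀ φ, IsTest φ → tsupport φ ⊆ V →
      ∫ x in V, v x * fderiv ℝ φ x e = -∫ x in V, g x * φ x := fun φ hφ hs =>
    weak_directional hvg₀ hvg₁ e hφ hs
  have hwg : ∀ φ, IsTest φ → tsupport φ ⊆ V →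
      ∫ x in V, g x * fderiv ℝ φ x w = -∫ x in V, h x * φ x := by
    intro φ hφ hs
    have e0 := weak_directional hw₀₀ hw₀₁ w hφ hs
    have e1 := weak_directional hw₁₀ hw₁₁ w hφ hs
    have hcφ : Continuous fun x => fderiv ℝ φ x w := by
      have := (hφ.1.fderiv_right (m := ∞) (by simp)).clm_apply (contDiff_const (c := w))
      exact this.continuous
    have hsφ : tsupport (fun x => fderiv ℝ φ x w) ⊆ tsupport φ := by
      refine closure_minimal (fun x hx => ?_) (isClosed_tsupport φ)
      by_contra h'
      apply hx
      have : φ =ᶠ[𝓝 x] 0 := notMem_tsupport_iff_eventuallyEq.1 h'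
      simp [this.fderiv_eq]
    have hkφ : HasCompactSupport fun x => fderiv ℝ φ x w :=
      hφ.2.of_isClosed_subset (isClosed_tsupport _) hsφ
    have i0 := integrableOn_mul_of_tsupport hw₀₀.locInt hcφ hkφ (hsφ.trans hs)
    have i1 := integrableOn_mul_of_tsupport hw₁₀.locInt hcφ hkφ (hsφ.trans hs)
    have l00 := integrableOn_mul_of_tsupport hw₀₀.locInt' hφ.1.continuous hφ.2 hs
    have l01 := integrableOn_mul_of_tsupport hw₀₁.locInt' hφ.1.continuous hφ.2 hs
    have l10 := integrableOn_mul_of_tsupport hw₁₀.locInt' hφ.1.continuous hφ.2 hs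
    have l11 := integrableOn_mul_of_tsupport hw₁₁.locInt' hφ.1.continuous hφ.2 hs
    have l0 : IntegrableOn (fun x => (w 0 * h₀₀ x + w 1 * h₀₁ x) * φ x) V := by
      refine ((l00.const_mul (w 0)).add (l01.const_mul (w 1))).congr (ae_of_all _ fun x => ?_)
      simp; ring
    have l1 : IntegrableOn (fun x => (w 0 * h₁₀ x + w 1 * h₁₁ x) * φ x) V := by
      refine ((l10.const_mul (w 0)).add (l11.const_mul (w 1))).congr (ae_of_all _ fun x => ?_)
      simp; ring
    have eq1 : ∫ x in V, g x * fderiv ℝ φ x w = e 0 * (∫ x in V, g₀ x * fderiv ℝ φ x w) +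
        e 1 * ∫ x in V, g₁ x * fderiv ℝ φ x w := by
      rw [← integral_const_mul, ← integral_const_mul,
        ← integral_add (i0.const_mul _) (i1.const_mul _)]
      congr 1; funext x; simp only [hg]; ring
    have eq2 : ∫ x in V, h x * φ x = e 0 * (∫ x in V, (w 0 * h₀₀ x + w 1 * h₀₁ x) * φ x) +
        e 1 * ∫ x in V, (w 0 * h₁₀ x + w 1 * h₁₁ x) * φ x := by
      rw [← integral_const_mul, ← integral_const_mul,
        ← integral_add (l0.const_mul _) (l1.const_mul _)]
      congr 1; funext x; simp only [hh]; ring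
    rw [eq1, eq2, e0, e1]
    ring
  set R : Set (ℝ × ℝ) := Ioo 0 a ×ˢ Ioo 0 δ with hR
  have hRm : MeasurableSet R := measurableSet_Ioo.prod measurableSet_Ioo
  set fv : ℝ × ℝ → ℝ := R.indicator (v ∘ par x₀ e w) with hfv
  set fg : ℝ × ℝ → ℝ := R.indicator (g ∘ par x₀ e w) with hfg
  set fh : ℝ × ℝ → ℝ := R.indicator (h ∘ par x₀ e w) with hfh
  have ifv : Integrable fv := integrable_indicator_par hc hsub hvL
  have ifg : Integrable fg := integrable_indicator_par hc hsub hgL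
  have ifh : Integrable fh := integrable_indicator_par hc hsub hhL
  have E1 : ∀ η ζ : ℝ → ℝ, ContDiff ℝ ∞ η → ContDiff ℝ ∞ ζ → HasCompactSupport η →
      HasCompactSupport ζ → tsupport η ⊆ Ioo 0 a → tsupport ζ ⊆ Ioo 0 δ →
      ∫ p, fv p * (deriv η p.1 * ζ p.2) = -∫ p, fg p * (η p.1 * ζ p.2) := by
    intro η ζ hη hζ hcη hcζ hηI hζJ
    have := weak_par hc hwv hsub hη hζ hcη hcζ hηI hζJ
    simp only [fderiv_tensor_left hc hη hζ] at this
    exact this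
  have E2 : ∀ η ζ : ℝ → ℝ, ContDiff ℝ ∞ η → ContDiff ℝ ∞ ζ → HasCompactSupport η →
      HasCompactSupport ζ → tsupport η ⊆ Ioo 0 a → tsupport ζ ⊆ Ioo 0 δ →
      ∫ p, fg p * (η p.1 * deriv ζ p.2) = -∫ p, fh p * (η p.1 * ζ p.2) := by
    intro η ζ hη hζ hcη hcζ hηI hζJ
    have := weak_par hc hwg hsub hη hζ hcη hcζ hηI hζJ
    simp only [fderiv_tensor_right hc hη hζ] at this
    exact this
  -- With this width `cutoff q` is already one from 2q < δ on, so 1 - `cutoff q` localizes near the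
  -- side t = 0.
  set q := δ / 3 with hq
  have hq0 : 0 < q := by positivity
  obtain ⟨Cq, hCq⟩ := (continuous_deriv_cutoff q).bounded_above_of_compact_support
    (hasCompactSupport_deriv_cutoff hq0)
  -- Formally K = -∂_t (g (1 - `cutoff q`)), so its integral over t is the trace of g at t = 0. This
  -- integral is the candidate for the weak derivative of v on the side.
  set K : ℝ × ℝ → ℝ := fun p => fg p * deriv (cutoff q) p.2 - fh p * (1 - cutoff q p.2) with hK
  have hcut : ∀ r, Continuous fun p : ℝ × ℝ => cutoff r p.2 := fun r =>
    (cutoff_contDiff r).continuous.comp continuous_snd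
  have hdcut : ∀ r, Continuous fun p : ℝ × ℝ => deriv (cutoff r) p.2 := fun r =>
    (continuous_deriv_cutoff r).comp continuous_snd
  have iK : Integrable K := by
    refine (ifg.mul_bdd (hdcut q).aestronglyMeasurable (ae_of_all _ fun p => hCq _)).sub
      (ifh.mul_bdd (c := 1) (continuous_const.sub (hcut q)).aestronglyMeasurable
        (ae_of_all _ fun p => ?_))
    rw [Real.norm_eq_abs, abs_le]
    constructor <;> linarith [(cutoff_mem q p.2).1, (cutoff_mem q p.2).2]
  refine AbsolutelyContinuousOnInterval.of_weakDeriv (τ := fun s => ∫ t, K (s, t)) ha ?_ ?_ ?_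
  · have h1 : ContinuousOn (fun s : ℝ => (s, (0 : ℝ))) (Icc 0 a) := by fun_prop
    refine (hcont.comp h1 fun s hs => ⟨hs, left_mem_Icc.2 hδ.le⟩).congr fun s _ => ?_
    simp [par]
  · exact Integrable.integral_prod_left iK
  intro η hη hcη hηI
  obtain ⟨Cη, hCη⟩ := hη.continuous.bounded_above_of_compact_support hcη
  have hdη : Continuous (deriv η) := hη.continuous_deriv (by simp)
  obtain ⟨Cd, hCd⟩ := hdη.bounded_above_of_compact_support hcη.deriv
  have hη1 : Continuous fun p : ℝ × ℝ => η p.1 := hη.continuous.comp continuous_fst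
  have hdη1 : Continuous fun p : ℝ × ℝ => deriv η p.1 := hdη.comp continuous_fst
  have ifgη : Integrable fun p => fg p * η p.1 :=
    ifg.mul_bdd hη1.aestronglyMeasurable (ae_of_all _ fun p => hCη _)
  have ifhη : Integrable fun p => fh p * η p.1 :=
    ifh.mul_bdd hη1.aestronglyMeasurable (ae_of_all _ fun p => hCη _)
  have ifvη : Integrable fun p => fv p * deriv η p.1 :=
    ifv.mul_bdd hdη1.aestronglyMeasurable (ae_of_all _ fun p => hCd _)
  -- `E1` with ζ = (`cutoff r`)' moves the s-derivative from η to v. The resulting integral of g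
  -- concentrates at the side as r → 0, so `E2` with ζ = `cutoff r` - `cutoff q` trades it for terms
  -- that stay bounded.
  have hstep : ∀ᶠ r in 𝓝[>] (0 : ℝ), ∫ t, deriv (cutoff r) t * ∫ s, fv (s, t) * deriv η s =
      -(∫ p, fg p * η p.1 * deriv (cutoff q) p.2) +
        ∫ p, fh p * η p.1 * (cutoff r p.2 - cutoff q p.2) := by
    filter_upwards [Ioo_mem_nhdsGT hq0] with r hr
    have hr0 : 0 < r := hr.1
    obtain ⟨Cr, hCr⟩ := (continuous_deriv_cutoff r).bounded_above_of_compact_support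
      (hasCompactSupport_deriv_cutoff hr0)
    have t1 : tsupport (deriv (cutoff r)) ⊆ Ioo 0 δ := by
      refine (closure_minimal (fun t ht => ?_) isClosed_Icc :
        tsupport (deriv (cutoff r)) ⊆ Icc r (2 * r)).trans
          (Icc_subset_Ioo hr0 (by linarith [hr.2]))
      by_contra h'
      exact ht (deriv_cutoff_eq_zero hr0 h')
    have hzero : ∀ t ∉ Icc r (2 * q), cutoff r t - cutoff q t = 0 := by
      intro t ht
      rw [mem_Icc, not_and_or, not_le, not_le] at ht
      rcases ht with ht | ht
      · rw [cutoff_of_le hr0 ht.le, cutoff_of_le hq0 (by linarith [hr.2]), sub_zero]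
      · rw [cutoff_of_ge hr0 (by linarith [hr.2]), cutoff_of_ge hq0 ht.le, sub_self]
    have t2 : tsupport (fun t => cutoff r t - cutoff q t) ⊆ Ioo 0 δ := by
      refine (closure_minimal (fun t ht => ?_) isClosed_Icc :
        tsupport (fun t => cutoff r t - cutoff q t) ⊆ Icc r (2 * q)).trans
          (Icc_subset_Ioo hr0 (by linarith))
      by_contra h'
      exact ht (hzero t h')
    have a1 := E1 η (deriv (cutoff r)) hη (contDiff_deriv_cutoff r) hcη
      (hasCompactSupport_deriv_cutoff hr0) hηI t1
    have a2 := E2 η (fun t => cutoff r t - cutoff q t) hη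
      ((cutoff_contDiff r).sub (cutoff_contDiff q)) hcη
      (HasCompactSupport.intro isCompact_Icc hzero) hηI t2
    have hder : ∀ t, deriv (fun t => cutoff r t - cutoff q t) t =
        deriv (cutoff r) t - deriv (cutoff q) t := fun t =>
      deriv_fun_sub ((cutoff_contDiff r).differentiable (by simp) t)
        ((cutoff_contDiff q).differentiable (by simp) t)
    have a3 : ∫ t, deriv (cutoff r) t * ∫ s, fv (s, t) * deriv η s =
        ∫ p, fv p * (deriv η p.1 * deriv (cutoff r) p.2) := by
      have hi : Integrable (fun p : ℝ × ℝ => fv p * (deriv η p.1 * deriv (cutoff r) p.2)) := by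
        refine (ifvη.mul_bdd (hdcut r).aestronglyMeasurable
          (ae_of_all _ fun p => hCr _)).congr (ae_of_all _ fun p => ?_)
        simp only; ring
      rw [Measure.volume_eq_prod, integral_prod_symm _ hi]
      congr 1; funext t
      rw [← integral_const_mul]
      congr 1; funext s; ring
    have a4 : ∫ p, fg p * (η p.1 * deriv (fun t => cutoff r t - cutoff q t) p.2) =
        (∫ p, fg p * (η p.1 * deriv (cutoff r) p.2)) -
          ∫ p, fg p * η p.1 * deriv (cutoff q) p.2 := by
      rw [← integral_sub]
      · congr 1; funext p; rw [hder]; ring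
      · refine (ifgη.mul_bdd (hdcut r).aestronglyMeasurable
          (ae_of_all _ fun p => hCr _)).congr (ae_of_all _ fun p => ?_)
        simp only; ring
      · exact ifgη.mul_bdd (hdcut q).aestronglyMeasurable (ae_of_all _ fun p => hCq _)
    have a5 : ∫ p, fh p * (η p.1 * (cutoff r p.2 - cutoff q p.2)) =
        ∫ p, fh p * η p.1 * (cutoff r p.2 - cutoff q p.2) := by
      congr 1; funext p; ring
    rw [a3, a1]
    rw [a4, a5] at a2
    linarith
  -- The slice integrals converge as t → 0+ because v is continuous up to the side, and the
  -- derivatives of the cutoffs pick out this limit.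
  have hlimL : Tendsto (fun r => ∫ t, deriv (cutoff r) t * ∫ s, fv (s, t) * deriv η s) (𝓝[>] 0)
      (𝓝 (∫ s in Ioo 0 a, v (x₀ + s • e) * deriv η s)) := by
    refine tendsto_integral_deriv_cutoff (Integrable.integral_prod_right ifvη) ?_
    obtain ⟨Cv, hCv⟩ := (isCompact_Icc.prod isCompact_Icc).exists_bound_of_continuousOn hcont
    rw [← integral_indicator measurableSet_Ioo]
    refine tendsto_integral_filter_of_dominated_convergence
      ((Icc 0 a).indicator fun _ => Cv * Cd) ?_ ?_ ?_ ?_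
    · filter_upwards [Ioo_mem_nhdsGT hδ] with t ht
      have : (fun s => fv (s, t) * deriv η s) =
          (Ioo 0 a).indicator fun s => v (par x₀ e w (s, t)) * deriv η s := by
        funext s
        by_cases hs : s ∈ Ioo 0 a
        · rw [indicator_of_mem hs, hfv, indicator_of_mem (show (s, t) ∈ R from ⟨hs, ht⟩)]; rfl
        · rw [indicator_of_notMem hs, hfv, indicator_of_notMem fun h' : (s, t) ∈ R => hs h'.1,
            zero_mul]
      rw [this]
      have hc1 : ContinuousOn (fun s : ℝ => (s, t)) (Ioo 0 a) := by fun_prop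
      have hc2 := hcont.comp hc1 fun s hs =>
        ⟨Ioo_subset_Icc_self hs, Ioo_subset_Icc_self ht⟩
      exact (aestronglyMeasurable_indicator_iff measurableSet_Ioo).2
        ((hc2.mul hdη.continuousOn).aestronglyMeasurable measurableSet_Ioo)
    · refine Eventually.of_forall fun t => ae_of_all _ fun s => ?_
      rw [norm_mul]
      by_cases hst : (s, t) ∈ R
      · have hs : s ∈ Icc 0 a := Ioo_subset_Icc_self hst.1
        rw [hfv, indicator_of_mem hst, indicator_of_mem hs]
        have hb := hCv (s, t) ⟨hs, Ioo_subset_Icc_self hst.2⟩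
        exact mul_le_mul hb (hCd s) (norm_nonneg _) ((norm_nonneg _).trans hb)
      · rw [hfv, indicator_of_notMem hst, norm_zero, zero_mul]
        refine indicator_nonneg (fun x hx => mul_nonneg ?_ ?_) s
        · exact (norm_nonneg _).trans (hCv (x, 0) ⟨hx, left_mem_Icc.2 hδ.le⟩)
        · exact (norm_nonneg _).trans (hCd 0)
    · exact (integrable_indicator_iff measurableSet_Icc).2 (integrableOn_const (by simp))
    · refine ae_of_all _ fun s => ?_
      by_cases hs : s ∈ Ioo 0 a
      · rw [indicator_of_mem hs]
        refine Tendsto.mul_const _ ?_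
        have h1 : ContinuousWithinAt (v ∘ par x₀ e w) (Icc 0 a ×ˢ Icc 0 δ) (s, 0) :=
          hcont (s, 0) ⟨Ioo_subset_Icc_self hs, left_mem_Icc.2 hδ.le⟩
        have h2 : Tendsto (fun t : ℝ => (s, t)) (𝓝[>] 0) (𝓝[Icc 0 a ×ˢ Icc 0 δ] (s, 0)) := by
          refine tendsto_nhdsWithin_iff.2 ⟨?_, ?_⟩
          · have : Continuous fun t : ℝ => (s, t) := by fun_prop
            exact (this.tendsto 0).mono_left nhdsWithin_le_nhds
          · filter_upwards [Ioo_mem_nhdsGT hδ] with t ht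
            exact ⟨Ioo_subset_Icc_self hs, Ioo_subset_Icc_self ht⟩
        have h3 := h1.tendsto.comp h2
        have h4 : (v ∘ par x₀ e w) (s, 0) = v (x₀ + s • e) := by simp [par]
        rw [h4] at h3
        refine h3.congr' ?_
        filter_upwards [Ioo_mem_nhdsGT hδ] with t ht
        rw [hfv, indicator_of_mem (show (s, t) ∈ R from ⟨hs, ht⟩)]; rfl
      · rw [indicator_of_notMem hs]
        refine tendsto_const_nhds.congr fun t => ?_
        rw [hfv, indicator_of_notMem fun h' : (s, t) ∈ R => hs h'.1, zero_mul]
  have hlimR : Tendsto (fun r => -(∫ p, fg p * η p.1 * deriv (cutoff q) p.2) +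
      ∫ p, fh p * η p.1 * (cutoff r p.2 - cutoff q p.2)) (𝓝[>] 0)
      (𝓝 (-(∫ p, fg p * η p.1 * deriv (cutoff q) p.2) +
        ∫ p, fh p * η p.1 * (1 - cutoff q p.2))) := by
    refine Tendsto.const_add _ (tendsto_integral_filter_of_dominated_convergence
      (fun p => ‖fh p * η p.1‖) ?_ ?_ ifhη.norm (ae_of_all _ fun p => ?_))
    · exact Eventually.of_forall fun r => ifhη.aestronglyMeasurable.mul
        ((hcut r).sub (hcut q)).aestronglyMeasurable
    · refine Eventually.of_forall fun r => ae_of_all _ fun p => ?_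
      rw [norm_mul]
      refine mul_le_of_le_one_right (norm_nonneg _) ?_
      rw [Real.norm_eq_abs, abs_le]
      constructor <;> linarith [(cutoff_mem r p.2).1, (cutoff_mem r p.2).2,
        (cutoff_mem q p.2).1, (cutoff_mem q p.2).2]
    · by_cases hp : p ∈ R
      · exact ((tendsto_cutoff hp.2.1).sub_const _).const_mul _
      · rw [hfh, indicator_of_notMem hp]
        simp
  have heq := tendsto_nhds_unique (hlimL.congr' hstep) hlimR
  rw [heq]
  have iKη : Integrable fun p => K p * η p.1 :=
    iK.mul_bdd hη1.aestronglyMeasurable (ae_of_all _ fun p => hCη _)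
  have hfub : ∫ s, (∫ t, K (s, t)) * η s = ∫ p, K p * η p.1 := by
    rw [Measure.volume_eq_prod, integral_prod _ iKη]
    congr 1; funext s
    exact (integral_mul_const _ _).symm
  have i1 : Integrable fun p => fg p * η p.1 * deriv (cutoff q) p.2 :=
    ifgη.mul_bdd (hdcut q).aestronglyMeasurable (ae_of_all _ fun p => hCq _)
  have i2 : Integrable fun p => fh p * η p.1 * (1 - cutoff q p.2) := by
    refine ifhη.mul_bdd (c := 1) (continuous_const.sub (hcut q)).aestronglyMeasurable
      (ae_of_all _ fun p => ?_)
    rw [Real.norm_eq_abs, abs_le]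
    constructor <;> linarith [(cutoff_mem q p.2).1, (cutoff_mem q p.2).2]
  have hsplit : ∫ p, K p * η p.1 = (∫ p, fg p * η p.1 * deriv (cutoff q) p.2) -
      ∫ p, fh p * η p.1 * (1 - cutoff q p.2) := by
    rw [← integral_sub i1 i2]
    congr 1; funext p; simp only [hK]; ring
  rw [hfub, hsplit]
  ring

end

end IFE

/-! ### Local position of the interface relative to a half line. -/

namespace IFE

open MeasureTheory Set Filter Topology
open scoped ContDiff

noncomputable section

/-! ### The interface near one of its points -/

lemma AbsolutelyContinuousOnInterval.comp_sub_right {g : ℝ → ℝ} {a : ℝ} (ha : 0 ≤ a)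
    (hg : AbsolutelyContinuousOnInterval g 0 a) (x : ℝ) :
    AbsolutelyContinuousOnInterval (fun s => g (s - x)) x (x + a) := by
  have hi := hg.intervalIntegrable_deriv.comp_sub_right x
  rw [zero_add, add_comm a x] at hi
  refine AbsolutelyContinuousOnInterval.of_integral (c := g 0) (by linarith) hi fun y hy => ?_
  rw [intervalIntegral.integral_comp_sub_right (fun t => deriv g t) x, sub_self,
    (hg.mono ?_).integral_deriv_eq_sub]
  · ring
  · rw [uIcc_of_le (by linarith [hy.1]), uIcc_of_le ha]
    exact Icc_subset_Icc_right (by linarith [hy.2])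

lemma AbsolutelyContinuousOnInterval.comp_sub_left {g : ℝ → ℝ} {a : ℝ} (ha : 0 ≤ a)
    (hg : AbsolutelyContinuousOnInterval g 0 a) (x : ℝ) :
    AbsolutelyContinuousOnInterval (fun s => g (x - s)) (x - a) x := by
  have hi := (hg.intervalIntegrable_deriv.comp_sub_left x).symm.neg
  rw [sub_zero] at hi
  refine AbsolutelyContinuousOnInterval.of_integral (c := g a) (by linarith) hi fun y hy => ?_
  simp only [Pi.neg_apply]
  rw [intervalIntegral.integral_neg, intervalIntegral.integral_comp_sub_left (fun t => deriv g t) x,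
    sub_sub_cancel, (hg.mono ?_).integral_deriv_eq_sub]
  · ring
  · rw [uIcc_of_le (by linarith [hy.1]), uIcc_of_le ha]
    exact Icc_subset_Icc_left (by linarith [hy.2])

variable {ι : Type*} {M : Mesh ι}

lemma Interface.isCompact_curve (S : Interface M) : IsCompact S.curve := by
  have : S.curve = S.γ '' Icc 0 1 := by
    rw [Interface.curve]
    refine Subset.antisymm ?_ (image_subset_range _ _)
    rintro _ ⟨t, rfl⟩
    exact ⟨Int.fract t, ⟨Int.fract_nonneg t, (Int.fract_lt_one t).le⟩, by
      have := S.periodic.sub_int_mul_eq (x := t) ⌊t⌋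
      rw [mul_one] at this
      exact this⟩
  rw [this]
  exact isCompact_Icc.image S.smooth.continuous

lemma Interface.isClosed_curve (S : Interface M) : IsClosed S.curve := S.isCompact_curve.isClosed

/-- Points of the curve near `γ t₀` have parameters near `t₀`. -/
lemma Interface.exists_param_near (S : Interface M) (t₀ : ℝ) {η : ℝ} (hη : 0 < η) :
    ∃ r > 0, ∀ y ∈ S.curve, dist y (S.γ t₀) < r → ∃ t, |t - t₀| < η ∧ S.γ t = y := by
  have hfract : ∀ t, S.γ (Int.fract t) = S.γ t := fun t => by
    have := S.periodic.sub_int_mul_eq (x := t) ⌊t⌋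
    rw [mul_one] at this
    exact this
  have hinj : ∀ t ∈ Ioo t₀ (t₀ + 1), S.γ t ≠ S.γ t₀ := by
    intro t ht h
    rw [← hfract t, ← hfract t₀] at h
    have h1 := S.simple ⟨Int.fract_nonneg t, Int.fract_lt_one t⟩
      ⟨Int.fract_nonneg t₀, Int.fract_lt_one t₀⟩ h
    obtain ⟨n, hn⟩ := Int.fract_eq_fract.1 h1
    have h2 : (0 : ℝ) < n := by rw [← hn]; linarith [ht.1]
    have h3 : (n : ℝ) < 1 := by rw [← hn]; linarith [ht.2]
    have h4 : (0 : ℤ) < n := by exact_mod_cast h2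
    have h5 : n < (1 : ℤ) := by exact_mod_cast h3
    omega
  -- The rest of one period is compact and misses γ t₀ because the curve is simple. The period
  -- window below starts at t₀ - η / 2, so a parameter at distance at least η from t₀ falls into
  -- this interval.
  set K := S.γ '' Icc (t₀ + η) (t₀ + 1 - η / 2) with hK
  have hKc : IsClosed K := (isCompact_Icc.image S.smooth.continuous).isClosed
  have hnot : S.γ t₀ ∉ K := by
    rintro ⟨t, ht, h⟩
    exact hinj t ⟨by linarith [ht.1], by linarith [ht.2]⟩ h
  obtain ⟨r, hr, hrK⟩ := Metric.isOpen_iff.1 hKc.isOpen_compl _ hnot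
  refine ⟨r, hr, ?_⟩
  rintro _ ⟨t, rfl⟩ hd
  obtain ⟨t', ht', he⟩ : ∃ t' ∈ Ico (t₀ - η / 2) (t₀ - η / 2 + 1), S.γ t = S.γ t' :=
    S.periodic.exists_mem_Ico one_pos t (t₀ - η / 2)
  refine ⟨t', ?_, he.symm⟩
  by_contra hlt
  refine hrK hd ?_
  rw [he]
  refine mem_image_of_mem _ ?_
  rw [abs_lt, not_and_or, not_lt, not_lt] at hlt
  rcases hlt with h | h
  · linarith [ht'.1]
  · exact ⟨by linarith, by linarith [ht'.2]⟩

lemma hasDerivAt_coord {c : ℝ → Plane} {d : Plane} {t : ℝ} (h : HasDerivAt c d t)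
    (x₀ e w : Plane) :
    HasDerivAt (fun t => coordS x₀ e w (c t)) (cross d w / cross e w) t ∧
    HasDerivAt (fun t => coordT x₀ e w (c t)) (cross e d / cross e w) t := by
  have hi : ∀ i : Fin 2, HasDerivAt (fun t => c t i) (d i) t := fun i =>
    (EuclideanSpace.proj i : Plane →L[ℝ] ℝ).hasFDerivAt.comp_hasDerivAt t h
  constructor
  · exact ((((hi 0).sub_const (x₀ 0)).mul_const (w 1)).sub
      (((hi 1).sub_const (x₀ 1)).mul_const (w 0))).div_const (cross e w)
  · exact ((((hi 1).sub_const (x₀ 1)).const_mul (e 0)).sub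
      (((hi 0).sub_const (x₀ 0)).const_mul (e 1))).div_const (cross e w)

/-- At a point of the curve, a thin cone around a transversal direction avoids the curve. -/
lemma Interface.exists_cone_of_transversal (S : Interface M) (t₀ : ℝ) {e : Plane}
    (he : cross e (deriv S.γ t₀) ≠ 0) :
    ∃ w, cross e w ≠ 0 ∧ ∃ r > 0, ∀ s t : ℝ, 0 < s → 0 < t →
      dist (par (S.γ t₀) e w (s, t)) (S.γ t₀) < r → par (S.γ t₀) e w (s, t) ∉ S.curve := by
  set d := deriv S.γ t₀ with hd
  have hder : HasDerivAt S.γ d t₀ := (S.smooth.differentiable (by simp) t₀).hasDerivAt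
  have hS : HasDerivAt (fun t => coordS (S.γ t₀) e d (S.γ t)) 0 t₀ :=
    (hasDerivAt_coord hder (S.γ t₀) e d).1.congr_deriv (by simp [cross, mul_comm])
  have hT : HasDerivAt (fun t => coordT (S.γ t₀) e d (S.γ t)) 1 t₀ :=
    (hasDerivAt_coord hder (S.γ t₀) e d).2.congr_deriv (div_self he)
  have hS0 : coordS (S.γ t₀) e d (S.γ t₀) = 0 := by simp [coordS, cross]
  have hT0 : coordT (S.γ t₀) e d (S.γ t₀) = 0 := by simp [coordT, cross]
  have ev1 := (hasDerivAt_iff_isLittleO.1 hS).bound (show (0 : ℝ) < 1 / 4 by norm_num)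
  have ev2 := (hasDerivAt_iff_isLittleO.1 hT).bound (show (0 : ℝ) < 1 / 4 by norm_num)
  obtain ⟨η, hη, hball⟩ := Metric.eventually_nhds_iff.1 (ev1.and ev2)
  obtain ⟨r, hr, hnear⟩ := S.exists_param_near t₀ hη
  -- With w = e + d the point has (e, d)-coordinates (s + t, t), so its first coordinate exceeds its
  -- positive second one. Near t₀ the curve has first coordinate at most |t' - t₀| / 4 and second
  -- coordinate within |t' - t₀| / 4 of t' - t₀, which is incompatible with this.
  refine ⟨e + d, ?_, r, hr, fun s t hs ht hdist hmem => ?_⟩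
  · intro h0
    apply he
    rw [← h0]
    simp [cross]; ring
  obtain ⟨t', ht', hy⟩ := hnear _ hmem hdist
  obtain ⟨b1, b2⟩ := hball (y := t') (by rwa [Real.dist_eq])
  have hpar : par (S.γ t₀) e (e + d) (s, t) = par (S.γ t₀) e d (s + t, t) := by
    simp only [par, smul_add, add_smul]; abel
  rw [hS0, hy, hpar, coordS_par he] at b1
  rw [hT0, hy, hpar, coordT_par he] at b2
  simp only [sub_zero, smul_eq_mul, mul_zero, mul_one, Real.norm_eq_abs] at b1 b2
  rw [abs_of_pos (by linarith)] at b1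
  have b3 := neg_abs_le (t - (t' - t₀))
  have b4 := le_abs_self (t - (t' - t₀))
  rcases abs_cases (t' - t₀) with ⟨h1, h2⟩ | ⟨h1, h2⟩ <;> rw [h1] at b1 b2 <;> linarith

/-- At a point of the curve with tangent `e`, the part of the half line in direction `e` near that
point is on one side of the curve, if it does not meet the curve. -/
lemma Interface.exists_side_of_tangent (S : Interface M) (t₀ : ℝ) {e : Plane} (he : e ≠ 0)
    (htan : cross e (deriv S.γ t₀) = 0)
    (hoff : ∀ᶠ s in 𝓝[>] (0 : ℝ), S.γ t₀ + s • e ∉ S.curve) :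
    ∃ w, cross e w ≠ 0 ∧ ∃ r > 0, ∀ s t : ℝ, 0 < s → 0 < t →
      dist (par (S.γ t₀) e w (s, t)) (S.γ t₀) < r → par (S.γ t₀) e w (s, t) ∉ S.curve := by
  obtain ⟨κ, hκ⟩ := exists_smul_of_cross_eq_zero he htan
  have hκ0 : κ ≠ 0 := by
    rintro rfl
    exact S.regular t₀ (by simpa using hκ)
  have hder : HasDerivAt S.γ (deriv S.γ t₀) t₀ :=
    (S.smooth.differentiable (by simp) t₀).hasDerivAt
  rw [hκ] at hder
  set N : Plane := !₂[-e 1, e 0] with hN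
  have hcN : cross e N ≠ 0 := by
    have : cross e N = inner ℝ e e := by rw [inner_plane]; simp [cross, hN]
    rw [this]
    exact inner_self_ne_zero.2 he
  set A : ℝ → ℝ := fun t => coordS (S.γ t₀) e N (S.γ t) with hA
  set B : ℝ → ℝ := fun t => coordT (S.γ t₀) e N (S.γ t) with hB
  have hBc : Continuous B := (contDiff_coordT _ _ _).continuous.comp S.smooth.continuous
  have hAc : Continuous A := (contDiff_coordS _ _ _).continuous.comp S.smooth.continuous
  have hA0 : A t₀ = 0 := by simp [hA, coordS, cross]
  have hAd : HasDerivAt A κ t₀ :=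
    (hasDerivAt_coord hder (S.γ t₀) e N).1.congr_deriv (by
      rw [div_eq_iff hcN]; simp [cross]; ring)
  have hrep : ∀ t, S.γ t = par (S.γ t₀) e N (A t, B t) := fun t => (par_coord hcN _).symm
  obtain ⟨ρ, hρ, hρ'⟩ := mem_nhdsGT_iff_exists_Ioo_subset.1 hoff
  -- An error of at most half the linear term makes the sign of the tangential coordinate A that of
  -- κ (t - t₀).
  have ev1 := (hasDerivAt_iff_isLittleO.1 hAd).bound (show 0 < |κ| / 2 by positivity)
  have ev2 : ∀ᶠ t in 𝓝 t₀, A t < ρ := by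
    refine hAc.continuousAt.eventually_lt continuousAt_const ?_
    rw [hA0]; exact hρ
  obtain ⟨η, hη, hball⟩ := Metric.eventually_nhds_iff.1 (ev1.and ev2)
  obtain ⟨r, hr, hnear⟩ := S.exists_param_near t₀ hη
  have hsign : ∀ t, |t - t₀| < η → (0 < A t ↔ 0 < κ * (t - t₀)) := by
    intro t ht
    have b1 := (hball (y := t) (by rwa [Real.dist_eq])).1
    rw [hA0] at b1
    simp only [sub_zero, smul_eq_mul, Real.norm_eq_abs] at b1
    have b3 := neg_abs_le (A t - (t - t₀) * κ)
    have b4 := le_abs_self (A t - (t - t₀) * κ)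
    have b5 : |κ| / 2 * |t - t₀| = |κ * (t - t₀)| / 2 := by rw [abs_mul]; ring
    rw [b5] at b1
    rcases abs_cases (κ * (t - t₀)) with ⟨h1, h2⟩ | ⟨h1, h2⟩ <;> rw [h1] at b1 <;>
      constructor <;> intro h3 <;> linarith
  -- These parameters describe the branch of the curve that runs along the half line. The normal
  -- coordinate B has no zero there, since the half line is off the curve near its origin; J being
  -- an interval, B has constant sign.
  set J : Set ℝ := {t | |t - t₀| < η ∧ 0 < κ * (t - t₀)} with hJ
  have hJconv : Convex ℝ J := by
    have : J = Metric.ball t₀ η ∩ {t | 0 < κ * (t - t₀)} := by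
      ext t; simp [hJ, Real.dist_eq]
    rw [this]
    refine (convex_ball t₀ η).inter ?_
    intro x hx y hy a b ha hb hab
    have hx' : 0 < κ * (x - t₀) := hx
    have hy' : 0 < κ * (y - t₀) := hy
    change 0 < κ * (a • x + b • y - t₀)
    have : κ * (a • x + b • y - t₀) = a * (κ * (x - t₀)) + b * (κ * (y - t₀)) := by
      obtain rfl : b = 1 - a := by linarith
      simp only [smul_eq_mul]; ring
    rw [this]
    rcases ha.eq_or_lt with h | h
    · have : b = 1 := by linarith
      rw [← h, this]; linarith
    · have := mul_pos h hx'
      have := mul_nonneg hb hy'.le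
      linarith
  have hBne : ∀ t ∈ J, B t ≠ 0 := by
    rintro t ⟨ht, hpos⟩ h0
    have hA1 : 0 < A t := (hsign t ht).2 hpos
    have hA2 : A t < ρ := (hball (y := t) (by rwa [Real.dist_eq])).2
    refine hρ' ⟨hA1, hA2⟩ ?_
    have : S.γ t₀ + A t • e = S.γ t := by
      rw [hrep t, h0]; simp [par]
    rw [this]
    exact mem_range_self t
  have hconst : (∀ t ∈ J, 0 < B t) ∨ ∀ t ∈ J, B t < 0 := by
    by_contra hcon
    push Not at hcon
    obtain ⟨⟨t₁, ht₁, h₁⟩, t₂, ht₂, h₂⟩ := hcon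
    obtain ⟨t, ht, h0⟩ := hJconv.isPreconnected.intermediate_value ht₁ ht₂ hBc.continuousOn
      (show (0 : ℝ) ∈ Icc (B t₁) (B t₂) from ⟨h₁, h₂⟩)
    exact hBne t ht h0
  -- The direction σ N points to the side opposite to the branch: a point with s, t > 0 has B = t σ,
  -- hence σ B > 0.
  have finish : ∀ σ : ℝ, σ ≠ 0 → (∀ t ∈ J, σ * B t < 0) →
      ∃ w, cross e w ≠ 0 ∧ ∃ r > 0, ∀ s t : ℝ, 0 < s → 0 < t →
      dist (par (S.γ t₀) e w (s, t)) (S.γ t₀) < r → par (S.γ t₀) e w (s, t) ∉ S.curve := by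
    intro σ hσ hσJ
    refine ⟨σ • N, ?_, r, hr, fun s t hs ht hdist hmem => ?_⟩
    · have : cross e (σ • N) = σ * cross e N := by simp [cross]; ring
      rw [this]; exact mul_ne_zero hσ hcN
    obtain ⟨t', ht', hy⟩ := hnear _ hmem hdist
    have hpar : par (S.γ t₀) e (σ • N) (s, t) = par (S.γ t₀) e N (s, t * σ) := by
      simp only [par, smul_smul]
    have hAt : A t' = s := by simp only [hA]; rw [hy, hpar, coordS_par hcN]
    have hBt : B t' = t * σ := by simp only [hB]; rw [hy, hpar, coordT_par hcN]
    have := hσJ t' ⟨ht', (hsign t' ht').1 (by rw [hAt]; exact hs)⟩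
    rw [hBt] at this
    nlinarith [mul_self_pos.2 hσ]
  rcases hconst with h | h
  · exact finish (-1) (by norm_num) fun t ht => by linarith [h t ht]
  · exact finish 1 (by norm_num) fun t ht => by linarith [h t ht]

end

end IFE

/-! ### Absolute continuity of v along the mesh edges. -/

namespace IFE

open MeasureTheory Set Filter Topology
open scoped ContDiff

noncomputable section

variable {ι : Type*} {M : Mesh ι}

/-! ### Restriction of piecewise `H²` functions to mesh edges -/

lemma dist_par_lt {x₀ e w : Plane} {r : ℝ} (hr : 0 < r) {s t : ℝ}
    (hs : s ∈ Ioo 0 (r / (‖e‖ + ‖w‖ + 1))) (ht : t ∈ Ioo 0 (r / (‖e‖ + ‖w‖ + 1))) :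
    dist (par x₀ e w (s, t)) x₀ < r := by
  have h0 : 0 < ‖e‖ + ‖w‖ + 1 := by positivity
  have h1 : par x₀ e w (s, t) - x₀ = s • e + t • w := by simp [par, add_assoc]
  rw [dist_eq_norm, h1]
  refine (norm_add_le _ _).trans_lt ?_
  rw [norm_smul, norm_smul, Real.norm_of_nonneg hs.1.le, Real.norm_of_nonneg ht.1.le]
  have h2 : s * ‖e‖ ≤ r / (‖e‖ + ‖w‖ + 1) * ‖e‖ :=
    mul_le_mul_of_nonneg_right hs.2.le (norm_nonneg _)
  have h3 : t * ‖w‖ ≤ r / (‖e‖ + ‖w‖ + 1) * ‖w‖ :=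
    mul_le_mul_of_nonneg_right ht.2.le (norm_nonneg _)
  have h4 : r / (‖e‖ + ‖w‖ + 1) * (‖e‖ + ‖w‖ + 1) = r := by field_simp
  have h5 : 0 < r / (‖e‖ + ‖w‖ + 1) := by positivity
  linarith

lemma Mesh.interior_tri_subset (M : Mesh ι) (i : ι) : interior (M.tri i) ⊆ M.domain :=
  interior_mono (subset_iUnion M.tri i)

/-- From each point of an edge and in each direction along the edge there is a parallelogram, with
a side on the edge, that does not meet the interface. -/
lemma Interface.exists_parallelogram (S : Interface M) {i : ι} {P Q R : Plane}
    (hcr : cross (Q - P) (R - P) ≠ 0)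
    (hin : ∀ s t : ℝ, 0 < s → 0 < t → s + t < 1 →
      par P (Q - P) (R - P) (s, t) ∈ interior (M.tri i))
    (hfr : segment ℝ P Q ⊆ frontier (M.tri i)) {s₀ : ℝ} (h0 : 0 ≤ s₀) (h1 : s₀ < 1) :
    ∃ w, cross (Q - P) w ≠ 0 ∧ ∃ a > 0, ∀ p ∈ Ioo 0 a ×ˢ Ioo 0 a,
      par (P + s₀ • (Q - P)) (Q - P) w p ∈ S.Ωm ∪ S.Ωp := by
  set e := Q - P with he
  set x₀ := P + s₀ • e with hx₀
  have he0 : e ≠ 0 := by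
    rintro h
    exact hcr (by simp [h, cross])
  -- If the curve inside T does not accumulate at the base point, a small parallelogram in T itself
  -- serves. Otherwise the base point is on Γ, hence inside Ω, and the parallelogram may leave T as
  -- long as it avoids Γ.
  by_cases hcl : x₀ ∈ closure (S.curve ∩ interior (M.tri i))
  · have hcut : S.IsCut i := closure_nonempty_iff.1 ⟨x₀, hcl⟩
    have hxc : x₀ ∈ S.curve :=
      closure_minimal inter_subset_left S.isClosed_curve hcl
    have hxd : x₀ ∈ M.domain := S.subset_domain hxc
    obtain ⟨r₁, hr₁, hball⟩ := Metric.isOpen_iff.1 (isOpen_interior : IsOpen M.domain) _ hxd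
    -- The curve meets the edge at most in D and E, so the edge leaves it immediately. This is what
    -- the tangential case needs.
    have hoff : ∀ᶠ s in 𝓝[>] (0 : ℝ), x₀ + s • e ∉ S.curve := by
      have hne : ∀ d : Plane, ∀ᶠ s in 𝓝[>] (0 : ℝ), x₀ + s • e ≠ d := by
        intro d
        by_cases hd : x₀ = d
        · filter_upwards [self_mem_nhdsWithin] with s hs h
          have hs' : (0 : ℝ) < s := hs
          rw [← hd] at h
          have : s • e = 0 := by simpa using h
          rcases smul_eq_zero.1 this with h' | h'
          · linarith
          · exact he0 h'
        · have hc : Tendsto (fun s : ℝ => x₀ + s • e) (𝓝[>] 0) (𝓝 x₀) := by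
            have : Continuous fun s : ℝ => x₀ + s • e := by fun_prop
            have h2 := this.tendsto 0
            simp only [zero_smul, add_zero] at h2
            exact h2.mono_left nhdsWithin_le_nhds
          exact hc.eventually_ne hd
      filter_upwards [hne (S.D i), hne (S.E i),
        Ioo_mem_nhdsGT (show (0 : ℝ) < 1 - s₀ by linarith)] with s hD hE hs hmem
      have hseg : x₀ + s • e ∈ segment ℝ P Q := by
        rw [segment_eq_image']
        exact ⟨s₀ + s, ⟨by linarith [hs.1], by linarith [hs.2]⟩, by
          simp only [hx₀, he, add_smul]; abel⟩
      have := (S.inter i hcut).subset ⟨hmem, hfr hseg⟩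
      rcases this with h | h
      · exact hD h
      · exact hE h
    obtain ⟨t₀, ht₀⟩ := hxc
    have key : ∃ w, cross e w ≠ 0 ∧ ∃ r > 0, ∀ s t : ℝ, 0 < s → 0 < t →
        dist (par (S.γ t₀) e w (s, t)) (S.γ t₀) < r → par (S.γ t₀) e w (s, t) ∉ S.curve := by
      by_cases htan : cross e (deriv S.γ t₀) = 0
      · exact S.exists_side_of_tangent t₀ he0 htan (by rwa [ht₀])
      · exact S.exists_cone_of_transversal t₀ htan
    rw [ht₀] at key
    obtain ⟨w, hw, r, hr, hav⟩ := key
    refine ⟨w, hw, min r r₁ / (‖e‖ + ‖w‖ + 1), by positivity, ?_⟩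
    rintro ⟨s, t⟩ ⟨hs, ht⟩
    have hd := dist_par_lt (x₀ := x₀) (lt_min hr hr₁) hs ht
    rw [S.union]
    exact ⟨hball (hd.trans_le (min_le_right _ _)),
      hav s t hs.1 ht.1 (hd.trans_le (min_le_left _ _))⟩
  · obtain ⟨r, hr, hball⟩ := Metric.isOpen_iff.1 isClosed_closure.isOpen_compl _ hcl
    refine ⟨R - P, hcr, min (r / (‖e‖ + ‖R - P‖ + 1)) ((1 - s₀) / 2),
      lt_min (by positivity) (by linarith), ?_⟩
    rintro ⟨s, t⟩ ⟨hs, ht⟩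
    have hd := dist_par_lt (x₀ := x₀) (e := e) (w := R - P) (s := s) (t := t) hr
      ⟨hs.1, hs.2.trans_le (min_le_left _ _)⟩ ⟨ht.1, ht.2.trans_le (min_le_left _ _)⟩
    have hs2 : s < (1 - s₀) / 2 := hs.2.trans_le (min_le_right _ _)
    have ht2 : t < (1 - s₀) / 2 := ht.2.trans_le (min_le_right _ _)
    have hInt : par x₀ e (R - P) (s, t) ∈ interior (M.tri i) := by
      have hp : par x₀ e (R - P) (s, t) = par P e (R - P) (s₀ + s, t) := by
        simp only [par, hx₀, add_smul]; abel
      rw [hp]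
      exact hin _ _ (by linarith [hs.1]) ht.1 (by linarith)
    rw [S.union]
    exact ⟨M.interior_tri_subset i hInt, fun h => hball hd (subset_closure ⟨h, hInt⟩)⟩

/-- The open parallelogram is connected, so it lies entirely in one of the two subdomains, on which
v is H²; its closure lies in the closure of Ω, where v is continuous. -/
lemma Interface.absolutelyContinuous_from (S : Interface M) {v : Plane → ℝ}
    (hcont : ContinuousOn v (closure M.domain)) (hm : MemH2 S.Ωm v) (hp : MemH2 S.Ωp v)
    {x₀ e w : Plane} (hc : cross e w ≠ 0) {a : ℝ} (ha : 0 < a)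
    (hsub : ∀ p ∈ Ioo 0 a ×ˢ Ioo 0 a, par x₀ e w p ∈ S.Ωm ∪ S.Ωp) :
    AbsolutelyContinuousOnInterval (fun s => v (x₀ + s • e)) 0 a := by
  have hcl : MapsTo (par x₀ e w) (Icc 0 a ×ˢ Icc 0 a) (closure M.domain) := by
    have h1 : MapsTo (par x₀ e w) (Ioo 0 a ×ˢ Ioo 0 a) M.domain := fun p hp => by
      have := hsub p hp
      rw [S.union] at this
      exact this.1
    have h2 := h1.closure (continuous_par x₀ e w)
    rwa [closure_prod_eq, closure_Ioo ha.ne] at h2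
  have hcv : ContinuousOn (v ∘ par x₀ e w) (Icc 0 a ×ˢ Icc 0 a) :=
    hcont.comp (continuous_par x₀ e w).continuousOn hcl
  have hpre : IsPreconnected (par x₀ e w '' (Ioo 0 a ×ˢ Ioo 0 a)) :=
    (isPreconnected_Ioo.prod isPreconnected_Ioo).image _ (continuous_par x₀ e w).continuousOn
  rcases hpre.subset_or_subset S.isOpen_m S.isOpen_p S.disjoint
    (by rintro _ ⟨p, hp, rfl⟩; exact hsub p hp) with h | h
  · exact hm.absolutelyContinuous_side hc ha ha (fun p hp => h (mem_image_of_mem _ hp)) hcv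
  · exact hp.absolutelyContinuous_side hc ha ha (fun p hp => h (mem_image_of_mem _ hp)) hcv

lemma Mesh.tdet_ne_zero (M : Mesh ι) (i : ι) : tdet (M.A i) ≠ 0 :=
  IFE.tdet_ne_zero (M.affineIndep i)

lemma Mesh.par_mem_interior (M : Mesh ι) (i : ι) (k : Fin 3) {s t : ℝ} (hs : 0 < s) (ht : 0 < t)
    (hst : s + t < 1) :
    par (M.A i (k + 1)) (M.A i (k + 2) - M.A i (k + 1)) (M.A i k - M.A i (k + 1)) (s, t) ∈
      interior (M.tri i) := by
  refine (mem_interior_tri_iff (M.tdet_ne_zero i) _).2 fun j => ?_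
  obtain ⟨h0, h2, h1⟩ := bary_edge (M.tdet_ne_zero i) k _ s t rfl
  rcases fin_three_cases j k with rfl | rfl | rfl
  · exact ht.trans_eq h0.symm
  · exact (show 0 < 1 - s - t by linarith).trans_eq h1.symm
  · exact hs.trans_eq h2.symm

lemma fin_three_ne : ∀ k : Fin 3, k + 1 ≠ k ∧ k + 2 ≠ k := by decide

lemma Mesh.edge_subset_frontier (M : Mesh ι) (i : ι) (k : Fin 3) :
    M.edge i k ⊆ frontier (M.tri i) := by
  intro x hx
  have hxt : x ∈ M.tri i := segment_subset_convexHull (mem_range_self _) (mem_range_self _) hx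
  refine ⟨subset_closure hxt, fun hInt => ?_⟩
  have hpos := (mem_interior_tri_iff (M.tdet_ne_zero i) x).1 hInt k
  obtain ⟨a, b, ha, hb, hab, rfl⟩ := hx
  rw [bary_combo k _ _ hab, bary_vertex (M.tdet_ne_zero i), bary_vertex (M.tdet_ne_zero i)] at hpos
  simp [(fin_three_ne k).1, (fin_three_ne k).2] at hpos

theorem Interface.absolutelyContinuous_edge (S : Interface M) {v : Plane → ℝ}
    (hcont : ContinuousOn v (closure M.domain)) (hm : MemH2 S.Ωm v) (hp : MemH2 S.Ωp v)
    (i : ι) (k : Fin 3) :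
    AbsolutelyContinuousOnInterval
      (fun s => v (AffineMap.lineMap (M.A i (k + 1)) (M.A i (k + 2)) s)) 0 1 := by
  set P := M.A i (k + 1) with hP
  set Q := M.A i (k + 2) with hQ
  set R := M.A i k with hR
  have hcr : cross (Q - P) (R - P) ≠ 0 := by
    rw [hP, hQ, hR, cross_edge]; exact M.tdet_ne_zero i
  have hcr' : cross (P - Q) (R - Q) ≠ 0 := by
    have : cross (P - Q) (R - Q) = -cross (Q - P) (R - P) := by simp [cross]; ring
    rw [this]; exact neg_ne_zero.2 hcr
  have hin : ∀ s t : ℝ, 0 < s → 0 < t → s + t < 1 →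
      par P (Q - P) (R - P) (s, t) ∈ interior (M.tri i) := fun s t hs ht hst =>
    M.par_mem_interior i k hs ht hst
  have hin' : ∀ s t : ℝ, 0 < s → 0 < t → s + t < 1 →
      par Q (P - Q) (R - Q) (s, t) ∈ interior (M.tri i) := by
    intro s t hs ht hst
    have : par Q (P - Q) (R - Q) (s, t) = par P (Q - P) (R - P) (1 - s - t, t) := by
      apply plane_ext <;> simp [par] <;> ring
    rw [this]
    exact hin _ _ (by linarith) ht (by linarith)
  have hfr : segment ℝ P Q ⊆ frontier (M.tri i) := M.edge_subset_frontier i k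
  refine AbsolutelyContinuousOnInterval.of_local (fun x hx => ?_) fun x hx => ?_
  · obtain ⟨w, hw, a, ha, hsub⟩ := S.exists_parallelogram hcr hin hfr hx.1 hx.2
    refine ⟨a, ha, ?_⟩
    have h1 := AbsolutelyContinuousOnInterval.comp_sub_right ha.le
      (S.absolutelyContinuous_from hcont hm hp hw ha hsub) x
    convert h1 using 3 with s
    rw [AffineMap.lineMap_apply_module']
    apply plane_ext <;> simp <;> ring
  -- To the left of x the edge is traversed backwards, from Q, where the point has parameter 1 - x.
  · obtain ⟨w, hw, a, ha, hsub⟩ := S.exists_parallelogram hcr' hin' (by rwa [segment_symm])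
      (s₀ := 1 - x) (by linarith [hx.2]) (by linarith [hx.1])
    refine ⟨a, ha, ?_⟩
    have h1 := AbsolutelyContinuousOnInterval.comp_sub_left ha.le
      (S.absolutelyContinuous_from hcont hm hp hw ha hsub) x
    convert h1 using 3 with s
    rw [AffineMap.lineMap_apply_module']
    apply plane_ext <;> simp <;> ring

end

end IFE

/-! ### Green's formula for a gradient and a boundary segment. -/

namespace IFE

open MeasureTheory Set Filter Topology
open scoped ContDiff

noncomputable section

/-! ### Green's formula for gradients on one side of a segment -/

/-- The support of φ does not touch the boundary of O, so truncation to O creates no singularity. It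
yields admissible test functions when φ itself also lives outside O. -/
lemma IsTest.indicator {O : Set Plane} (hO : IsOpen O) {φ : Plane → ℝ} (hφ : IsTest φ)
    (h : tsupport φ ∩ closure O ⊆ O) :
    IsTest (O.indicator φ) ∧ tsupport (O.indicator φ) ⊆ O ∧
      ∀ x ∈ O, ∀ j, IFE.pd j (O.indicator φ) x = IFE.pd j φ x := by
  have hs : tsupport (O.indicator φ) ⊆ tsupport φ ∩ closure O := by
    refine closure_minimal (fun x hx => ?_) ((isClosed_tsupport φ).inter isClosed_closure)
    rw [Function.mem_support, Set.indicator_apply_ne_zero] at hx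
    exact ⟨subset_tsupport φ hx.2, subset_closure hx.1⟩
  have heq : ∀ x ∈ O, O.indicator φ =ᶠ[𝓝 x] φ := fun x hx => by
    filter_upwards [hO.mem_nhds hx] with y hy using indicator_of_mem hy φ
  refine ⟨⟨contDiff_iff_contDiffAt.2 fun x => ?_, ?_⟩, hs.trans h, fun x hx j => ?_⟩
  · by_cases hx : x ∈ O
    · exact hφ.1.contDiffAt.congr_of_eventuallyEq (heq x hx)
    · have : O.indicator φ =ᶠ[𝓝 x] fun _ => 0 :=
        notMem_tsupport_iff_eventuallyEq.1 fun h' => hx (h (hs h'))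
      exact contDiffAt_const.congr_of_eventuallyEq this
  · exact hφ.2.of_isClosed_subset (isClosed_tsupport _) (hs.trans inter_subset_left)
  · rw [IFE.pd, IFE.pd, (heq x hx).fderiv_eq]

/-- A gradient has no curl: the two weak partial derivatives are tested with q ∂₀φ and q ∂₁φ, the
second derivatives of φ cancel by symmetry, and only derivatives of q survive. The factor q is a
cutoff at the part of the boundary where φ need not vanish. -/
lemma HasWeakGrad.integral_cross {U : Set Plane} (hU : IsOpen U) {v : Plane → ℝ}
    {G : Plane → Plane} (hG : HasWeakGrad U v G) {φ q : Plane → ℝ} (hφ : IsTest φ)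
    (hq : ContDiff ℝ ∞ q) (hs : tsupport φ ∩ tsupport q ∩ closure U ⊆ U) :
    ∫ x in U, q x * (G x 1 * pd 0 φ x - G x 0 * pd 1 φ x) =
      -∫ x in U, v x * (pd 1 q x * pd 0 φ x - pd 0 q x * pd 1 φ x) := by
  have hm := hU.measurableSet
  have hA : ∀ j, IsTest fun x => pd j φ x * q x := fun j =>
    ⟨(contDiff_pd hφ.1 j).mul hq, (hφ.pd j).2.mul_right⟩
  have hAs : ∀ j, tsupport (fun x => pd j φ x * q x) ∩ closure U ⊆ U := fun j => by
    rintro x ⟨hx, hxU⟩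
    exact hs ⟨⟨tsupport_pd_subset φ j (tsupport_mul_subset_left hx),
      tsupport_mul_subset_right hx⟩, hxU⟩
  have key : ∀ i j, IntegrableOn (fun x => G x i * (pd j φ x * q x)) U ∧
      IntegrableOn (fun x => v x * (pd i (pd j φ) x * q x + pd j φ x * pd i q x)) U ∧
      ∫ x in U, v x * (pd i (pd j φ) x * q x + pd j φ x * pd i q x) =
        -∫ x in U, G x i * (pd j φ x * q x) := by
    intro i j
    obtain ⟨t, ts, tp⟩ := (hA j).indicator hU (hAs j)
    have e1 : EqOn (fun x => G x i * U.indicator (fun x => pd j φ x * q x) x)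
        (fun x => G x i * (pd j φ x * q x)) U := fun x hx => by
      simp only [indicator_of_mem hx]
    have e2 : EqOn (fun x => v x * pd i (U.indicator (fun x => pd j φ x * q x)) x)
        (fun x => v x * (pd i (pd j φ) x * q x + pd j φ x * pd i q x)) U := fun x hx => by
      simp only [tp x hx, pd_mul ((hφ.pd j).differentiable x) (hq.differentiable (by simp) x)]
    refine ⟨?_, ?_, ?_⟩
    · exact (integrableOn_mul_of_tsupport (hG i).locInt' t.1.continuous t.2 ts).congr_fun e1 hm
    · exact (integrableOn_mul_of_tsupport (hG i).locInt (t.pd i).1.continuous (t.pd i).2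
        ((tsupport_pd_subset _ i).trans ts)).congr_fun e2 hm
    · rw [← setIntegral_congr_fun hm e1, ← setIntegral_congr_fun hm e2]
      exact (hG i).eq _ t ts
  obtain ⟨a1, a2, a3⟩ := key 1 0
  obtain ⟨b1, b2, b3⟩ := key 0 1
  have e1 : ∫ x in U, q x * (G x 1 * pd 0 φ x - G x 0 * pd 1 φ x) =
      (∫ x in U, G x 1 * (pd 0 φ x * q x)) - ∫ x in U, G x 0 * (pd 1 φ x * q x) := by
    rw [← integral_sub a1 b1]
    congr 1; funext x; ring
  have e2 : ∫ x in U, v x * (pd 1 q x * pd 0 φ x - pd 0 q x * pd 1 φ x) =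
      (∫ x in U, v x * (pd 1 (pd 0 φ) x * q x + pd 0 φ x * pd 1 q x)) -
        ∫ x in U, v x * (pd 0 (pd 1 φ) x * q x + pd 1 φ x * pd 0 q x) := by
    rw [← integral_sub a2 b2]
    congr 1; funext x; rw [pd_comm hφ.1 1 0]; ring
  rw [e1, e2, a3, b3]
  ring

lemma HasWeakGrad.hasWeakCurl_zero {U : Set Plane} (hU : IsOpen U) {v : Plane → ℝ}
    {G : Plane → Plane} (hG : HasWeakGrad U v G) (hi : IntegrableOn G U) :
    HasWeakCurl U G fun _ => 0 := by
  refine ⟨hi.locallyIntegrableOn, (integrableOn_zero (μ := volume)).locallyIntegrableOn,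
    fun φ hφ hs => ?_⟩
  have := hG.integral_cross hU hφ (contDiff_const (c := (1 : ℝ)))
    ((inter_subset_left.trans inter_subset_left).trans hs)
  simpa [pd] using this

lemma pd_cutoff_coordT (x₀ e w : Plane) (r : ℝ) (x : Plane) :
    pd 0 (fun y => cutoff r (coordT x₀ e w y)) x =
        deriv (cutoff r) (coordT x₀ e w x) * (-e 1 / cross e w) ∧
      pd 1 (fun y => cutoff r (coordT x₀ e w y)) x =
        deriv (cutoff r) (coordT x₀ e w x) * (e 0 / cross e w) := by
  have hT : ∀ d : Plane, fderiv ℝ (coordT x₀ e w) x d = cross e d / cross e w := by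
    intro d
    have hl : HasLineDerivAt ℝ (coordT x₀ e w) (cross e d / cross e w) x d := by
      unfold HasLineDerivAt
      have : (fun t : ℝ => coordT x₀ e w (x + t • d)) =
          fun t => coordT x₀ e w x + t * (cross e d / cross e w) := by
        funext t
        simp only [coordT, cross]
        simp
        ring
      rw [this]
      simpa using (((hasDerivAt_id (0 : ℝ)).mul_const (cross e d / cross e w)).const_add
        (coordT x₀ e w x))
    rw [← hl.lineDeriv]
    exact ((contDiff_coordT x₀ e w).differentiable (by simp) x).lineDeriv_eq_fderiv.symm
  have hd : ∀ d : Plane, fderiv ℝ (fun y => cutoff r (coordT x₀ e w y)) x d =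
      deriv (cutoff r) (coordT x₀ e w x) * (cross e d / cross e w) := by
    intro d
    have h1 : HasDerivAt (cutoff r) (deriv (cutoff r) (coordT x₀ e w x)) (coordT x₀ e w x) :=
      ((cutoff_contDiff r).differentiable (by simp) _).hasDerivAt
    have h2 := ((contDiff_coordT x₀ e w).differentiable (by simp) x).hasFDerivAt
    have h3 := h1.comp_hasFDerivAt x h2
    have h4 : fderiv ℝ (fun y => cutoff r (coordT x₀ e w y)) x =
      deriv (cutoff r) (coordT x₀ e w x) • fderiv ℝ (coordT x₀ e w) x := h3.fderiv
    rw [h4]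
    simp [hT]
  unfold pd
  rw [hd, hd]
  simp [cross]

/-- The mean of `F` over the lines parallel to a side of `U` converges to the mean over the
side. -/
lemma tendsto_integral_slice {U K : Set Plane} (hU : IsOpen U) (hK : IsCompact K) (hUK : U ⊆ K)
    {P e w : Plane} (hUs : ∀ p, par P e w p ∈ U → p.1 ∈ Ioo 0 1)
    (hPK : ∀ s ∈ Ioo (0 : ℝ) 1, par P e w (s, 0) ∈ K)
    {F : Plane → ℝ} (hF : ContinuousOn F K)
    (hlim : ∀ s ∈ Ioo (0 : ℝ) 1, F =ᶠ[𝓝 (par P e w (s, 0))] 0 ∨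
      ∀ᶠ t in 𝓝[>] (0 : ℝ), par P e w (s, t) ∈ U) :
    Tendsto (fun t => ∫ s, U.indicator F (par P e w (s, t))) (𝓝[>] 0)
      (𝓝 (∫ s in (0 : ℝ)..1, F (par P e w (s, 0)))) := by
  obtain ⟨C, hC⟩ := hK.exists_bound_of_continuousOn hF
  have hcp : ∀ s : ℝ, Continuous fun t => par P e w (s, t) := fun s =>
    (continuous_par P e w).comp (by fun_prop)
  have hcs : ∀ t : ℝ, Continuous fun s => par P e w (s, t) := fun t =>
    (continuous_par P e w).comp (by fun_prop)
  rw [intervalIntegral.integral_of_le zero_le_one, integral_Ioc_eq_integral_Ioo,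
    ← integral_indicator measurableSet_Ioo]
  refine tendsto_integral_filter_of_dominated_convergence
    ((Ioo (0 : ℝ) 1).indicator fun _ => C) (Eventually.of_forall fun t => ?_)
    (Eventually.of_forall fun t => Eventually.of_forall fun s => ?_) ?_
    (Eventually.of_forall fun s => ?_)
  · have hV : IsOpen {s | par P e w (s, t) ∈ U} := hU.preimage (hcs t)
    have : (fun s => U.indicator F (par P e w (s, t))) =
        {s | par P e w (s, t) ∈ U}.indicator fun s => F (par P e w (s, t)) := by
      funext s
      simp [indicator]
    rw [this, aestronglyMeasurable_indicator_iff hV.measurableSet]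
    exact ((hF.mono hUK).comp (hcs t).continuousOn fun s hs => hs).aestronglyMeasurable
      hV.measurableSet
  · by_cases h : par P e w (s, t) ∈ U
    · rw [indicator_of_mem h, indicator_of_mem (hUs _ h)]
      exact hC _ (hUK h)
    · rw [indicator_of_notMem h, norm_zero]
      refine indicator_nonneg (fun s hs => ?_) s
      exact (norm_nonneg _).trans (hC _ (hPK s hs))
  · exact (integrable_indicator_iff measurableSet_Ioo).2 (integrableOn_const (by simp))
  · by_cases hs : s ∈ Ioo (0 : ℝ) 1
    · rw [indicator_of_mem hs]
      have ht : Tendsto (fun t => par P e w (s, t)) (𝓝[>] 0) (𝓝 (par P e w (s, 0))) :=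
        ((hcp s).tendsto 0).mono_left nhdsWithin_le_nhds
      rcases hlim s hs with h | h
      · rw [h.self_of_nhds]
        refine tendsto_const_nhds.congr' ?_
        filter_upwards [ht.eventually h] with t ht'
        by_cases h' : par P e w (s, t) ∈ U
        · rw [indicator_of_mem h', ht']; rfl
        · rw [indicator_of_notMem h']; rfl
      · have h2 : Tendsto (fun t => par P e w (s, t)) (𝓝[>] 0) (𝓝[K] (par P e w (s, 0))) :=
          tendsto_nhdsWithin_iff.2 ⟨ht, h.mono fun t ht' => hUK ht'⟩
        refine ((hF _ (hPK s hs)).tendsto.comp h2).congr' ?_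
        filter_upwards [h] with t ht'
        simp [indicator_of_mem ht']
    · rw [indicator_of_notMem hs]
      refine tendsto_const_nhds.congr fun t => ?_
      rw [indicator_of_notMem fun h => hs (hUs _ h)]

/-- Green's formula: the tangential trace of the gradient of `v` is the derivative of `v` along
the side. -/
theorem HasWeakGrad.integral_cross_eq_boundary {U K : Set Plane} (hU : IsOpen U)
    (hK : IsCompact K) (hUK : U ⊆ K) {P e w : Plane} (hc : cross e w ≠ 0)
    (hUs : ∀ p, par P e w p ∈ U → p.1 ∈ Ioo 0 1 ∧ 0 < p.2)
    (hPK : ∀ s ∈ Ioo (0 : ℝ) 1, par P e w (s, 0) ∈ K)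
    {v : Plane → ℝ} {G : Plane → Plane} (hv : ContinuousOn v K) (hG : HasWeakGrad U v G)
    (hGi : IntegrableOn G U)
    (hac : AbsolutelyContinuousOnInterval (fun s => v (par P e w (s, 0))) 0 1)
    {φ : Plane → ℝ} (hφ : IsTest φ) (h0 : φ (par P e w (0, 0)) = 0)
    (h1 : φ (par P e w (1, 0)) = 0)
    (hs : ∀ x ∈ tsupport φ ∩ closure U, 0 < coordT P e w x → x ∈ U)
    (hlim : ∀ s ∈ Ioo (0 : ℝ) 1, par P e w (s, 0) ∈ tsupport φ →
      ∀ᶠ t in 𝓝[>] (0 : ℝ), par P e w (s, t) ∈ U) :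
    ∫ x in U, (G x 1 * pd 0 φ x - G x 0 * pd 1 φ x) =
      Real.sign (cross e w) *
        ∫ s in (0 : ℝ)..1, deriv (fun s => v (par P e w (s, 0))) s * φ (par P e w (s, 0)) := by
  set κ := cross e w with hκ
  set F : Plane → ℝ := fun x => v x * fderiv ℝ φ x e with hF
  have hφe : Continuous fun x => fderiv ℝ φ x e :=
    (hφ.1.continuous_fderiv (by simp)).clm_apply continuous_const
  have hFc : ContinuousOn F K := hv.mul hφe.continuousOn
  have hUt : ∀ x ∈ U, 0 < coordT P e w x := fun x hx =>
    (hUs (coordS P e w x, coordT P e w x) (by rwa [par_coord hc])).2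
  have hFU : IntegrableOn F U := (hFc.integrableOn_compact hK).mono_set hUK
  have hFi : Integrable fun p => U.indicator F (par P e w p) := by
    have h2 := (integrableOn_par_iff (x₀ := P) hc U F).2 hFU
    rw [← integrable_indicator_iff (hU.preimage (continuous_par P e w)).measurableSet] at h2
    exact h2
  have hlimR : Tendsto (fun r => ∫ t, deriv (cutoff r) t *
      ∫ s, U.indicator F (par P e w (s, t))) (𝓝[>] 0)
      (𝓝 (∫ s in (0 : ℝ)..1, F (par P e w (s, 0)))) := by
    refine tendsto_integral_deriv_cutoff hFi.integral_prod_right ?_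
    refine tendsto_integral_slice hU hK hUK (fun p hp => (hUs p hp).1) hPK hFc fun s hs' => ?_
    by_cases hmem : par P e w (s, 0) ∈ tsupport φ
    · exact Or.inr (hlim s hs' hmem)
    · left
      have h2 : φ =ᶠ[𝓝 (par P e w (s, 0))] 0 := notMem_tsupport_iff_eventuallyEq.1 hmem
      filter_upwards [h2.fderiv (𝕜 := ℝ)] with x hx
      simp [hF, hx]
  have hGc : ∀ j, IntegrableOn (fun x => G x j) U := fun j =>
    (EuclideanSpace.proj j : Plane →L[ℝ] ℝ).integrable_comp hGi
  have hGφ : ∀ i j, IntegrableOn (fun x => G x i * pd j φ x) U := fun i j =>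
    have ⟨_, hC⟩ := (hφ.pd j).2.exists_bound_of_continuous (hφ.pd j).1.continuous
    (hGc i).mul_bdd (hφ.pd j).1.continuous.aestronglyMeasurable (Eventually.of_forall hC)
  have hlimL : Tendsto (fun r => ∫ x in U, cutoff r (coordT P e w x) *
      (G x 1 * pd 0 φ x - G x 0 * pd 1 φ x)) (𝓝[>] 0)
      (𝓝 (∫ x in U, (G x 1 * pd 0 φ x - G x 0 * pd 1 φ x))) := by
    have hI : IntegrableOn (fun x => G x 1 * pd 0 φ x - G x 0 * pd 1 φ x) U :=
      (hGφ 1 0).sub (hGφ 0 1)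
    refine tendsto_integral_filter_of_dominated_convergence
      (fun x => ‖G x 1 * pd 0 φ x - G x 0 * pd 1 φ x‖) (Eventually.of_forall fun r => ?_)
      (Eventually.of_forall fun r => Eventually.of_forall fun x => ?_) hI.norm ?_
    · exact ((cutoff_contDiff r).continuous.comp
        (contDiff_coordT P e w).continuous).aestronglyMeasurable.mul hI.aestronglyMeasurable
    · rw [norm_mul]
      refine mul_le_of_le_one_left (norm_nonneg _) ?_
      rw [Real.norm_of_nonneg (cutoff_mem _ _).1]
      exact (cutoff_mem _ _).2
    · filter_upwards [ae_restrict_mem hU.measurableSet] with x hx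
      simpa using (tendsto_cutoff (hUt x hx)).mul_const (G x 1 * pd 0 φ x - G x 0 * pd 1 φ x)
  -- In `HasWeakGrad.integral_cross` with q = `cutoff r` ∘ `coordT`, the gradient of q is (`cutoff
  -- r`)' (-e₁, e₀) / κ. The right side becomes an average of v ∂_e φ over lines parallel to the
  -- side, and |κ| is the Jacobian of the coordinates.
  have heq : ∀ r > 0, ∫ x in U, cutoff r (coordT P e w x) *
      (G x 1 * pd 0 φ x - G x 0 * pd 1 φ x) =
      -(κ⁻¹ * |κ|) * ∫ t, deriv (cutoff r) t * ∫ s, U.indicator F (par P e w (s, t)) := by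
    intro r hr
    refine (hG.integral_cross hU hφ (q := fun x => cutoff r (coordT P e w x))
      ((cutoff_contDiff r).comp (contDiff_coordT P e w)) ?_).trans ?_
    rotate_left
    · have e1 : ∀ x, v x * (pd 1 (fun x => cutoff r (coordT P e w x)) x * pd 0 φ x -
          pd 0 (fun x => cutoff r (coordT P e w x)) x * pd 1 φ x) =
          κ⁻¹ * (deriv (cutoff r) (coordT P e w x) * F x) := by
        intro x
        obtain ⟨d0, d1⟩ := pd_cutoff_coordT P e w r x
        simp only [d0, d1, hF, fderiv_eq_pd]
        ring
      simp_rw [e1]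
      rw [integral_const_mul, setIntegral_par (x₀ := P) hc,
        ← integral_indicator (hU.preimage (continuous_par P e w)).measurableSet]
      have e2 : (par P e w ⁻¹' U).indicator (fun p => deriv (cutoff r) (coordT P e w (par P e w p)) *
          F (par P e w p)) = fun p => deriv (cutoff r) p.2 * U.indicator F (par P e w p) := by
        funext p
        by_cases hp : par P e w p ∈ U
        · rw [indicator_of_mem (show p ∈ par P e w ⁻¹' U from hp), indicator_of_mem hp,
            coordT_par hc]
        · rw [indicator_of_notMem (show p ∉ par P e w ⁻¹' U from hp), indicator_of_notMem hp,
            mul_zero]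
      have hb : Integrable fun p : ℝ × ℝ =>
          deriv (cutoff r) p.2 * U.indicator F (par P e w p) := by
        obtain ⟨C, hC⟩ := (hasCompactSupport_deriv_cutoff hr).exists_bound_of_continuous
          (continuous_deriv_cutoff r)
        exact hFi.bdd_mul (c := C)
          ((continuous_deriv_cutoff r).comp continuous_snd).aestronglyMeasurable
          (Eventually.of_forall fun p => hC p.2)
      rw [e2, Measure.volume_eq_prod, integral_prod_symm _ hb]
      simp_rw [integral_const_mul]
      ring
    · rintro x ⟨⟨hx1, hx2⟩, hx3⟩
      refine hs x ⟨hx1, hx3⟩ ?_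
      have h2 : tsupport (fun x => cutoff r (coordT P e w x)) ⊆ {x | r ≤ coordT P e w x} := by
        refine closure_minimal (fun y hy => ?_)
          (isClosed_le continuous_const (contDiff_coordT P e w).continuous)
        by_contra h'
        exact hy (cutoff_of_le hr (le_of_lt (not_le.1 h')))
      exact hr.trans_le (h2 hx2)
  have hfin := tendsto_nhds_unique hlimL ((hlimR.const_mul (-(κ⁻¹ * |κ|))).congr'
    (by filter_upwards [self_mem_nhdsWithin] with r hr using (heq r hr).symm))
  have hsign : κ⁻¹ * |κ| = Real.sign κ := by
    rcases lt_or_gt_of_ne hc with h | h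
    · rw [abs_of_neg h, Real.sign_of_neg h]; field_simp
    · rw [abs_of_pos h, Real.sign_of_pos h]; field_simp
  have hder : ∀ s : ℝ, HasDerivAt (fun s => φ (par P e w (s, 0)))
      (fderiv ℝ φ (par P e w (s, 0)) e) s := by
    intro s
    have h2 : HasDerivAt (fun s : ℝ => par P e w (s, 0)) e s := by
      have := ((hasDerivAt_id s).smul_const e).const_add P
      simpa [par] using this
    exact (hφ.differentiable _).hasFDerivAt.comp_hasDerivAt s h2
  have hφac : AbsolutelyContinuousOnInterval (fun s => φ (par P e w (s, 0))) 0 1 :=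
    (ContDiff.contDiffOn (n := 1) ((hφ.1.of_le (by simp)).comp
      (by unfold par; fun_prop))).absolutelyContinuousOnInterval
  -- In the limit v ∂_e φ is integrated over the side itself. Absolute continuity allows the
  -- derivative to be moved to v, and φ vanishes at both endpoints.
  have hibp := hac.integral_mul_deriv_eq_deriv_mul hφac
  simp only [h0, h1, mul_zero, sub_zero, zero_sub, (hder _).deriv] at hibp
  rw [hfin, hsign, hibp]
  ring

end

end IFE

/-! ### Existence and uniqueness of the edge integrals of ∇v. -/

namespace IFE

open MeasureTheory Set Filter Topology
open scoped ContDiff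

noncomputable section

variable {ι : Type*} {M : Mesh ι}

/-! ### Tangential traces of gradients on mesh edges -/

lemma par_zero_right (P Q w : Plane) (s : ℝ) :
    par P (Q - P) w (s, 0) = AffineMap.lineMap P Q s := by
  rw [AffineMap.lineMap_apply_module', par, zero_smul, add_zero, add_comm]

lemma Mesh.isCompact_tri (M : Mesh ι) (i : ι) : IsCompact (M.tri i) :=
  (finite_range _).isCompact_convexHull (𝕜 := ℝ)

lemma Mesh.tri_subset_closure (M : Mesh ι) (i : ι) : M.tri i ⊆ closure M.domain := by
  have h := (convex_convexHull ℝ (range (M.A i))).closure_interior_eq_closure_of_nonempty_interior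
    (interior_tri_nonempty (M.tdet_ne_zero i))
  exact subset_closure.trans (h.symm.subset.trans (closure_mono (M.interior_tri_subset i)))

lemma Mesh.cross_ne_zero (M : Mesh ι) (i : ι) (k : Fin 3) :
    cross (M.A i (k + 2) - M.A i (k + 1)) (M.A i k - M.A i (k + 1)) ≠ 0 := by
  rw [cross_edge]; exact M.tdet_ne_zero i

lemma Mesh.mem_edge_of_bary_eq_zero (M : Mesh ι) {i : ι} {k : Fin 3} {x : Plane}
    (hx : x ∈ M.tri i) (h0 : bary (M.A i) k x = 0) : x ∈ M.edge i k := by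
  have hp := par_coord (x₀ := M.A i (k + 1)) (M.cross_ne_zero i k) x
  obtain ⟨ht, hs, hst⟩ := bary_edge (M.tdet_ne_zero i) k x _ _ hp.symm
  have hpos := (mem_tri_iff (M.tdet_ne_zero i) x).1 hx
  have h1 := hpos (k + 2)
  have h2 := hpos (k + 1)
  simp only at ht hs hst
  rw [h0] at ht
  rw [hs] at h1
  rw [hst, ← ht] at h2
  rw [← ht, par_zero_right] at hp
  rw [Mesh.edge, segment_eq_image_lineMap]
  exact ⟨_, ⟨h1, by linarith⟩, hp⟩

lemma Mesh.par_mem_interior_iff (M : Mesh ι) (i : ι) (k : Fin 3) (p : ℝ × ℝ) :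
    par (M.A i (k + 1)) (M.A i (k + 2) - M.A i (k + 1)) (M.A i k - M.A i (k + 1)) p ∈
      interior (M.tri i) ↔ 0 < p.1 ∧ 0 < p.2 ∧ p.1 + p.2 < 1 := by
  refine ⟨fun h => ?_, fun h => M.par_mem_interior i k h.1 h.2.1 h.2.2⟩
  have hpos := (mem_interior_tri_iff (M.tdet_ne_zero i) _).1 h
  obtain ⟨h0, h2, h1⟩ := bary_edge (M.tdet_ne_zero i) k _ p.1 p.2 rfl
  have a0 := (hpos k).trans_eq h0
  have a2 := (hpos (k + 2)).trans_eq h2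
  have a1 := (hpos (k + 1)).trans_eq h1
  exact ⟨a2, a0, by linarith⟩

/-- The relative interior of an edge does not meet the other two edges. -/
lemma Mesh.lineMap_notMem_edge (M : Mesh ι) (i : ι) (k : Fin 3) {s : ℝ} (hs : s ∈ Ioo (0 : ℝ) 1) :
    AffineMap.lineMap (M.A i (k + 1)) (M.A i (k + 2)) s ∉ M.edge i (k + 1) ∪ M.edge i (k + 2) := by
  obtain ⟨-, h2, h1⟩ := bary_edge (M.tdet_ne_zero i) k
    (AffineMap.lineMap (M.A i (k + 1)) (M.A i (k + 2)) s) s 0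
    (par_zero_right _ _ (M.A i k - M.A i (k + 1)) s).symm
  have hz : ∀ j, ∀ x ∈ M.edge i j, bary (M.A i) j x = 0 := by
    rintro j _ ⟨a, b, -, -, hab, rfl⟩
    rw [bary_combo j _ _ hab, bary_vertex (M.tdet_ne_zero i), bary_vertex (M.tdet_ne_zero i)]
    simp [(fin_three_ne j).1, (fin_three_ne j).2]
  rintro (h | h)
  · rw [hz _ _ h] at h1; linarith [hs.2]
  · rw [hz _ _ h] at h2; linarith [hs.1]

lemma Interface.isOpen_interior_diff (S : Interface M) (i : ι) :
    IsOpen (interior (M.tri i) \ S.curve) :=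
  isOpen_interior.sdiff S.isClosed_curve

lemma Interface.interior_diff_subset (S : Interface M) (i : ι) :
    interior (M.tri i) \ S.curve ⊆ S.Ωm ∪ S.Ωp := by
  rw [S.union]
  exact sdiff_subset_sdiff_left (M.interior_tri_subset i)

/-- Weak gradients are unique almost everywhere, so G coincides with the square integrable one in
the definition of the space, which is integrable on the bounded triangle. -/
lemma Interface.MemH2Zero.integrableOn_grad {S : Interface M} {βm βp : ℝ} {v : Plane → ℝ}
    (hv : S.MemH2Zero βm βp v) {G : Plane → Plane} (hG : HasWeakGrad (S.Ωm ∪ S.Ωp) v G) (i : ι) :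
    IntegrableOn G (interior (M.tri i) \ S.curve) := by
  obtain ⟨G', -, hG', -, hw, -⟩ := hv.flux
  have hO : IsOpen (S.Ωm ∪ S.Ωp) := S.isOpen_m.union S.isOpen_p
  have hfin : volume (interior (M.tri i) \ S.curve) < ⊤ :=
    (measure_mono (sdiff_subset.trans interior_subset)).trans_lt (M.isCompact_tri i).measure_lt_top
  have : IsFiniteMeasure (volume.restrict (interior (M.tri i) \ S.curve)) :=
    ⟨by rwa [Measure.restrict_apply_univ]⟩
  have h1 : IntegrableOn G' (interior (M.tri i) \ S.curve) :=
    (hG'.mono_measure (Measure.restrict_mono (S.interior_diff_subset i) le_rfl)).integrable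
      (by norm_num)
  refine h1.congr_fun_ae ?_
  rw [EventuallyEq, ae_restrict_iff' (S.isOpen_interior_diff i).measurableSet]
  filter_upwards [(hw 0).ae_eq hO (hG 0), (hw 1).ae_eq hO (hG 1)] with x h0 h1 hx
  exact plane_ext (h0 (S.interior_diff_subset i hx)) (h1 (S.interior_diff_subset i hx))

/-- The integral of the tangential trace of `∇ v` over an edge is the difference of the values of
`v` at its endpoints. -/
theorem Interface.MemH2Zero.hasEdgeIntegral {S : Interface M} {βm βp : ℝ} {v : Plane → ℝ}
    (hv : S.MemH2Zero βm βp v) {G : Plane → Plane} (hG : HasWeakGrad (S.Ωm ∪ S.Ωp) v G)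
    (i : ι) (k : Fin 3) :
    S.HasEdgeIntegral i k G (v (M.A i (k + 2)) - v (M.A i (k + 1))) := by
  have hac := S.absolutelyContinuous_edge hv.cont hv.memH2_m hv.memH2_p i k
  have hGi := hv.integrableOn_grad hG i
  have hU := S.isOpen_interior_diff i
  have hGU : HasWeakGrad (interior (M.tri i) \ S.curve) v G := fun j =>
    (hG j).mono (S.isOpen_m.union S.isOpen_p) (S.interior_diff_subset i)
  -- The trace is the derivative of v along the edge, and the weak curl of the gradient is zero.
  refine ⟨deriv fun s => v (AffineMap.lineMap (M.A i (k + 1)) (M.A i (k + 2)) s),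
    ⟨hac.intervalIntegrable_deriv, hGi, fun _ => 0, integrableOn_zero,
      hGU.hasWeakCurl_zero hU hGi, fun φ hφ hd => ?_⟩, ?_⟩
  · have hdis : ∀ x ∈ tsupport φ, x ∉ M.edge i (k + 1) ∧ x ∉ M.edge i (k + 2) ∧
        x ∉ closure (S.curve ∩ interior (M.tri i)) := fun x hx => by
      have := disjoint_left.1 hd hx
      simp only [mem_union, not_or] at this
      exact ⟨this.1.1, this.1.2, this.2⟩
    have hzero : ∀ x, x ∈ M.edge i (k + 1) ∨ x ∈ M.edge i (k + 2) → φ x = 0 := fun x hx => by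
      refine image_eq_zero_of_notMem_tsupport fun h => ?_
      rcases hx with hx | hx
      · exact (hdis x h).1 hx
      · exact (hdis x h).2.1 hx
    simp only [zero_mul, zero_add, ← par_zero_right _ _ (M.A i k - M.A i (k + 1))] at hac ⊢
    refine hGU.integral_cross_eq_boundary hU (M.isCompact_tri i)
      (sdiff_subset.trans interior_subset) (M.cross_ne_zero i k) (fun p hp => ?_) (fun s hs => ?_)
      (hv.cont.mono (M.tri_subset_closure i)) hGi hac hφ ?_ ?_ (fun x hx ht => ?_)
      (fun s hs hmem => ?_)
    · have := (M.par_mem_interior_iff i k p).1 hp.1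
      exact ⟨⟨this.1, by linarith [this.2.1, this.2.2]⟩, this.2.1⟩
    · rw [par_zero_right]
      refine segment_subset_convexHull (mem_range_self (k + 1)) (mem_range_self (k + 2)) ?_
      rw [segment_eq_image_lineMap]
      exact mem_image_of_mem _ (Ioo_subset_Icc_self hs)
    · rw [par_zero_right, AffineMap.lineMap_apply_zero]
      refine hzero _ (Or.inr ?_)
      rw [Mesh.edge, (fin_three_add k).2.2.2]
      exact right_mem_segment _ _ _
    · rw [par_zero_right, AffineMap.lineMap_apply_one]
      refine hzero _ (Or.inl ?_)
      rw [Mesh.edge, (fin_three_add k).1]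
      exact left_mem_segment _ _ _
    · have hxt : x ∈ M.tri i := by
        have := closure_mono (sdiff_subset.trans interior_subset) hx.2
        rwa [(M.isCompact_tri i).isClosed.closure_eq] at this
      obtain ⟨h1, h2, h3⟩ := hdis x hx.1
      -- A point of the closed triangle in the support of φ is off the other two edges by the choice
      -- of φ, and off edge k because its transversal coordinate is positive.
      have hInt : x ∈ interior (M.tri i) := by
        refine (mem_interior_tri_iff (M.tdet_ne_zero i) x).2 fun j => ?_
        refine lt_of_le_of_ne ((mem_tri_iff (M.tdet_ne_zero i) x).1 hxt j) fun h0 => ?_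
        rcases fin_three_cases j k with rfl | rfl | rfl
        · have hp := par_coord (x₀ := M.A i (j + 1)) (M.cross_ne_zero i j) x
          have hb := (bary_edge (M.tdet_ne_zero i) j x _ _ hp.symm).1
          rw [← h0] at hb
          exact ht.ne hb
        · exact h1 (M.mem_edge_of_bary_eq_zero hxt h0.symm)
        · exact h2 (M.mem_edge_of_bary_eq_zero hxt h0.symm)
      exact ⟨hInt, fun hc => h3 (subset_closure ⟨hc, hInt⟩)⟩
    · have hc : Tendsto (fun t => par (M.A i (k + 1)) (M.A i (k + 2) - M.A i (k + 1))
          (M.A i k - M.A i (k + 1)) (s, t)) (𝓝[>] 0)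
          (𝓝 (par (M.A i (k + 1)) (M.A i (k + 2) - M.A i (k + 1))
          (M.A i k - M.A i (k + 1)) (s, 0))) := by
        have : Continuous fun t => par (M.A i (k + 1)) (M.A i (k + 2) - M.A i (k + 1))
          (M.A i k - M.A i (k + 1)) (s, t) := (continuous_par _ _ _).comp (by fun_prop)
        exact (this.tendsto 0).mono_left nhdsWithin_le_nhds
      have hoff := hc.eventually (isClosed_closure.isOpen_compl.mem_nhds (hdis _ hmem).2.2)
      filter_upwards [hoff, Ioo_mem_nhdsGT (show (0 : ℝ) < 1 - s by linarith [hs.2])] with t h1 h2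
      have hInt := M.par_mem_interior i k hs.1 h2.1 (by linarith [h2.2])
      exact ⟨hInt, fun h => h1 (subset_closure ⟨h, hInt⟩)⟩
  · rw [hac.integral_deriv_eq_sub]
    simp

/-! ### Uniqueness of tangential traces -/

/-- A test function on an interval extends from a segment to the plane, avoiding a closed set. -/
lemma exists_test_extension {P Q w : Plane} (hc : cross (Q - P) w ≠ 0) {F : Set Plane}
    (hF : IsClosed F) {g : ℝ → ℝ} (hg : ContDiff ℝ ∞ g) (hgc : HasCompactSupport g)
    (hgF : ∀ s ∈ tsupport g, AffineMap.lineMap P Q s ∉ F) :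
    ∃ φ, IsTest φ ∧ Disjoint (tsupport φ) F ∧ ∀ s, φ (AffineMap.lineMap P Q s) = g s := by
  have hK : IsCompact ((AffineMap.lineMap P Q : ℝ → Plane) '' tsupport g) :=
    hgc.isCompact.image AffineMap.lineMap_continuous
  obtain ⟨L, hL, hKL, hLF⟩ := exists_compact_between hK hF.isOpen_compl
    (by rintro _ ⟨s, hs, rfl⟩; exact hgF s hs)
  -- Extending g constantly in the direction w loses compact support and may hit F; the bump ρ,
  -- equal to one on the image of the support of g, cures both.
  obtain ⟨ρ, h0, h1, -⟩ := exists_contMDiffMap_zero_one_of_isClosed (n := ⊤)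
    (modelWithCornersSelf ℝ Plane) (isOpen_interior (s := L)).isClosed_compl hK.isClosed
    (disjoint_compl_left_iff_subset.2 hKL)
  have hρs : tsupport ρ ⊆ L := by
    refine closure_minimal (fun x hx => ?_) hL.isClosed
    by_contra hxL
    exact hx (h0 fun h => hxL (interior_subset h))
  have hs : tsupport (fun x => g (coordS P (Q - P) w x) * ρ x) ⊆ L :=
    (tsupport_mul_subset_right).trans hρs
  refine ⟨fun x => g (coordS P (Q - P) w x) * ρ x, ⟨?_, ?_⟩, ?_, fun s => ?_⟩
  · exact (hg.comp (contDiff_coordS _ _ _)).mul ρ.contMDiff.contDiff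
  · exact hL.of_isClosed_subset (isClosed_tsupport _) hs
  · exact disjoint_left.2 fun x hx => hLF (hs hx)
  · show g (coordS P (Q - P) w _) * ρ _ = g s
    have : coordS P (Q - P) w (AffineMap.lineMap P Q s) = s := by
      rw [← par_zero_right P Q w s, coordS_par hc]
    rw [this]
    by_cases hs : s ∈ tsupport g
    · rw [h1 (mem_image_of_mem _ hs)]; simp
    · rw [image_eq_zero_of_notMem_tsupport hs, zero_mul]

/-- The two curls agree almost everywhere, so the area sides of the two Green formulas coincide, and
the orientation sign is nonzero. -/
lemma Interface.HasEdgeTrace.integral_mul_eq {S : Interface M} {i : ι} {k : Fin 3}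
    {u : Plane → Plane} {τ τ' : ℝ → ℝ} (h : S.HasEdgeTrace i k u τ)
    (h' : S.HasEdgeTrace i k u τ') {φ : Plane → ℝ} (hφ : IsTest φ)
    (hd : Disjoint (tsupport φ)
      (M.edge i (k + 1) ∪ M.edge i (k + 2) ∪ closure (S.curve ∩ interior (M.tri i)))) :
    ∫ s in (0 : ℝ)..1, τ s * φ (AffineMap.lineMap (M.A i (k + 1)) (M.A i (k + 2)) s) =
      ∫ s in (0 : ℝ)..1, τ' s * φ (AffineMap.lineMap (M.A i (k + 1)) (M.A i (k + 2)) s) := by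
  obtain ⟨-, -, c, -, hc, hform⟩ := h
  obtain ⟨-, -, c', -, hc', hform'⟩ := h'
  have hU := S.isOpen_interior_diff i
  have hcc := ae_eq_of_test hU hc.locInt' hc'.locInt' fun ψ hψ hs => by
    linarith [hc.eq ψ hψ hs, hc'.eq ψ hψ hs]
  have hsign : Real.sign (cross (M.A i (k + 2) - M.A i (k + 1)) (M.A i k - M.A i (k + 1))) ≠ 0 :=
    fun h0 => M.cross_ne_zero i k (Real.sign_eq_zero_iff.1 h0)
  refine mul_left_cancel₀ hsign ?_
  rw [← hform φ hφ hd, ← hform' φ hφ hd]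
  refine setIntegral_congr_ae hU.measurableSet ?_
  filter_upwards [hcc] with x hx hxU
  rw [hx hxU]

/-- Green's formula determines the trace on the part of the edge away from its ends and from the
closure of Γ in the interior of T. The excluded points are finitely many, being ends of the edge, D
or E, so two traces agree almost everywhere. -/
theorem Interface.HasEdgeIntegral.unique {S : Interface M} {i : ι} {k : Fin 3}
    {u : Plane → Plane} {I I' : ℝ} (h : S.HasEdgeIntegral i k u I)
    (h' : S.HasEdgeIntegral i k u I') : I = I' := by
  obtain ⟨τ, hτ, rfl⟩ := h
  obtain ⟨τ', hτ', rfl⟩ := h'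
  set l : ℝ → Plane := ⇑(AffineMap.lineMap (k := ℝ) (M.A i (k + 1)) (M.A i (k + 2))) with hl
  have hlc : Continuous l := AffineMap.lineMap_continuous
  set Z := closure (S.curve ∩ interior (M.tri i)) with hZ
  set V : Set ℝ := Ioo 0 1 ∩ l ⁻¹' Zᶜ with hV
  have hVo : IsOpen V := isOpen_Ioo.inter (isClosed_closure.isOpen_compl.preimage hlc)
  have hFc : IsClosed (M.edge i (k + 1) ∪ M.edge i (k + 2) ∪ Z) := by
    refine IsClosed.union (IsClosed.union ?_ ?_) isClosed_closure <;>
    · rw [Mesh.edge, segment_eq_image_lineMap]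
      exact (isCompact_Icc.image AffineMap.lineMap_continuous).isClosed
  have hInt : ∀ {σ : ℝ → ℝ}, IntervalIntegrable σ volume 0 1 → IntegrableOn σ V := fun hσ =>
    (hσ.1).mono_set (inter_subset_left.trans Ioo_subset_Ioc_self)
  have hae : ∀ᵐ s, s ∈ V → (τ - τ') s = 0 := by
    refine hVo.ae_eq_zero_of_integral_contDiff_smul_eq_zero (μ := volume)
      ((hInt hτ.1).sub (hInt hτ'.1)).locallyIntegrableOn fun g hg hgc hgs => ?_
    obtain ⟨φ, hφ, hd, hφg⟩ := exists_test_extension (M.cross_ne_zero i k) hFc hg hgc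
      (fun s hs => by
        rintro (h | h)
        · exact M.lineMap_notMem_edge i k (hgs hs).1 h
        · exact (hgs hs).2 h)
    have key := hτ.integral_mul_eq hτ' hφ hd
    simp only [hφg] at key
    have hg0 : ∀ s ∉ Ioc (0 : ℝ) 1, g s • (τ - τ') s = 0 := fun s hs => by
      rw [image_eq_zero_of_notMem_tsupport fun h => hs (Ioo_subset_Ioc_self (hgs h).1), zero_smul]
    rw [← setIntegral_eq_integral_of_forall_compl_eq_zero hg0,
      ← intervalIntegral.integral_of_le zero_le_one]
    have hgi : ∀ {σ : ℝ → ℝ}, IntervalIntegrable σ volume 0 1 →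
        IntervalIntegrable (fun s => σ s * g s) volume 0 1 := fun hσ =>
      hσ.mul_continuousOn hg.continuous.continuousOn
    rw [← sub_eq_zero, ← intervalIntegral.integral_sub (hgi hτ.1) (hgi hτ'.1)] at key
    rw [← key]
    congr 1
    funext s
    simp only [Pi.sub_apply, smul_eq_mul]
    ring
  have hfin : {s : ℝ | s ∈ Ioc (0 : ℝ) 1 ∧ s ∉ V}.Finite := by
    have hinj : Function.Injective l := by
      refine AffineMap.lineMap_injective ℝ ?_
      exact (M.affineIndep i).injective.ne (by
        rw [Ne, add_right_inj]; decide)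
    refine (((toFinite {S.D i, S.E i}).preimage hinj.injOn).union (finite_singleton 1)).subset ?_
    rintro s ⟨hs, hsV⟩
    rcases eq_or_lt_of_le hs.2 with h1 | h1
    · exact Or.inr h1
    · left
      have hmem : l s ∈ Z := by
        by_contra h
        exact hsV ⟨⟨hs.1, h1⟩, h⟩
      have hcut : S.IsCut i := closure_nonempty_iff.1 ⟨_, hmem⟩
      have hseg : l s ∈ M.edge i k := by
        rw [Mesh.edge, segment_eq_image_lineMap]
        exact mem_image_of_mem _ (Ioc_subset_Icc_self hs)
      exact (S.inter i hcut).subset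
        ⟨closure_minimal inter_subset_left S.isClosed_curve hmem, M.edge_subset_frontier i k hseg⟩
  refine intervalIntegral.integral_congr_ae ?_
  rw [uIoc_of_le zero_le_one]
  filter_upwards [hae, compl_mem_ae_iff.2 (hfin.measure_zero volume)] with s h1 h2 hs
  have hsV : s ∈ V := by
    by_contra h
    exact h2 ⟨hs, h⟩
  exact sub_eq_zero.1 (h1 hsV)

end

end IFE

/-! ### The commuting diagram. -/

namespace IFE

open MeasureTheory Set Filter Topology
open scoped ContDiff

noncomputable section

variable {ι : Type*} {M : Mesh ι}

/-! ### From edge integrals to the commuting diagram -/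

/-- If P and Q are not strictly separated by the chord line, the kink term is affine on the segment.
-/
lemma pwLin_combo {D n : Plane} {ρ c : ℝ} {g P Q : Plane}
    (h : ρ = 0 ∨ 0 ≤ inner ℝ (P - D) n * inner ℝ (Q - D) n) {a b : ℝ} (ha : 0 ≤ a) (hb : 0 ≤ b)
    (hab : a + b = 1) :
    pwLin D n ρ c g (a • P + b • Q) = a * pwLin D n ρ c g P + b * pwLin D n ρ c g Q := by
  have hl : inner ℝ (a • P + b • Q - D) n = a * inner ℝ (P - D) n + b * inner ℝ (Q - D) n := by
    obtain rfl : b = 1 - a := by linarith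
    simp only [inner_plane]; simp; ring
  have key : ρ * max (inner ℝ (a • P + b • Q - D) n) 0 =
      ρ * (a * max (inner ℝ (P - D) n) 0 + b * max (inner ℝ (Q - D) n) 0) := by
    rcases h with h | h
    · simp [h]
    · rw [hl]
      rcases mul_nonneg_iff.1 h with ⟨h1, h2⟩ | ⟨h1, h2⟩
      · rw [max_eq_left h1, max_eq_left h2, max_eq_left (by positivity)]
      · rw [max_eq_right h1, max_eq_right h2, max_eq_right (by nlinarith)]; simp
  simp only [pwLin, inner_add_right, real_inner_smul_right]
  linear_combination inner ℝ g n * key - c * hab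

/-- Inside an unseparated segment the tangential component is the slope of `pwLin`. The open segment
is needed: at an endpoint on the chord line the field takes its minus value even if the segment lies
on the plus side. -/
lemma inner_pwND_eq_zero {X D n : Plane} {ρ ν c : ℝ} {g P Q : Plane}
    (h : ρ = 0 ∨ 0 ≤ inner ℝ (P - D) n * inner ℝ (Q - D) n)
    (hPQ : pwLin D n ρ c g P = pwLin D n ρ c g Q) {x : Plane} (hx : x ∈ openSegment ℝ P Q) :
    inner ℝ (pwND X D n ρ ν g 0 x) (Q - P) = 0 := by
  obtain ⟨a, b, ha, hb, hab, rfl⟩ := hx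
  have hl : inner ℝ (a • P + b • Q - D) n = a * inner ℝ (P - D) n + b * inner ℝ (Q - D) n := by
    obtain rfl : b = 1 - a := by linarith
    simp only [inner_plane]; simp; ring
  have hn : inner ℝ n (Q - P) = inner ℝ (Q - D) n - inner ℝ (P - D) n := by
    simp only [inner_plane]; simp; ring
  rw [pwND, hl]
  simp only [pwLin] at hPQ
  set lP := inner ℝ (P - D) n
  set lQ := inner ℝ (Q - D) n
  simp only [mul_zero, zero_smul, add_zero]
  split_ifs with hx
  · rw [inner_sub_right]
    rcases h with h | h
    · simp [h] at hPQ; linarith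
    · rcases mul_nonneg_iff.1 h with ⟨h1, h2⟩ | ⟨h1, h2⟩
      -- Both levels are nonnegative while the point in between has level at most zero, so the whole
      -- segment lies on the chord line.
      · have : 0 ≤ a * lP := by positivity
        have : 0 ≤ b * lQ := by positivity
        have e1 : lP = 0 := (mul_eq_zero.1 (by linarith : a * lP = 0)).resolve_left ha.ne'
        have e2 : lQ = 0 := (mul_eq_zero.1 (by linarith : b * lQ = 0)).resolve_left hb.ne'
        rw [e1, e2] at hPQ; linarith
      · rw [max_eq_right h1, max_eq_right h2] at hPQ; linarith
  · rw [inner_add_left, real_inner_smul_left, hn, inner_sub_right]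
    rcases h with h | h
    · simp [h] at hPQ ⊢; linarith
    · rcases mul_nonneg_iff.1 h with ⟨h1, h2⟩ | ⟨h1, h2⟩
      · rw [max_eq_left h1, max_eq_left h2] at hPQ; linarith
      · exfalso; apply hx; nlinarith

lemma Interface.centre_mem (S : Interface M) (i : ι) : S.centre i ∈ M.tri i := by
  rw [Interface.centre]
  split_ifs with h
  · obtain ⟨k, l, -, hD, hE⟩ := S.edges i h
    have hs : ∀ k, M.edge i k ⊆ M.tri i := fun k =>
      segment_subset_convexHull (mem_range_self _) (mem_range_self _)
    exact (convex_convexHull ℝ _).midpoint_mem (hs k hD) (hs l hE)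
  · exact subset_convexHull ℝ _ (mem_range_self _)

/-- The pointwise content of the commuting diagram: the same g and ρ parametrize function and field,
and the gradient has b = 0. -/
lemma hasGradientAt_pwLin {D n g x : Plane} {ρ c : ℝ} {X : Plane} {ν : ℝ}
    (h : ρ = 0 ∨ inner ℝ (x - D) n ≠ 0) :
    HasGradientAt (pwLin D n ρ c g) (pwND X D n ρ ν g 0 x) x := by
  have hcont : ContinuousAt (fun y : Plane => inner ℝ (y - D) n) x := by fun_prop
  simp only [pwND, mul_zero, zero_smul, add_zero]
  rcases h with h | h
  · subst h
    simp only [zero_mul, zero_smul, add_zero, ite_self]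
    exact gradient_affine (c := c) (fun y => by simp [pwLin]) x
  · rcases lt_or_gt_of_ne h with h | h
    · rw [if_pos h.le]
      refine (gradient_affine (c := c) (g := g) (fun y => rfl) x).congr_of_eventuallyEq ?_
      filter_upwards [hcont.eventually_lt continuousAt_const h] with y hy
      rw [pwLin, max_eq_right hy.le]; ring
    · rw [if_neg (not_le.2 h)]
      refine (gradient_affine (c := c - ρ * inner ℝ g n * inner ℝ D n) (fun y => rfl)
        x).congr_of_eventuallyEq ?_
      filter_upwards [continuousAt_const.eventually_lt hcont h] with y hy
      rw [pwLin, max_eq_left hy.le, inner_add_left, real_inner_smul_left, inner_sub_left,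
        real_inner_comm y n]
      ring

/-- The algebraic half of the theorem. All that enters about G is that its edge integrals are unique
and equal the differences of v at the vertices. -/
theorem Interface.commuting_of_edgeIntegral (S : Interface M)
    {βm βp μm μp : ℝ} (hβm : 0 < βm) (hβp : 0 < βp) (hμm : 0 < μm) (hμp : 0 < μp)
    (hM : ∀ i, S.IsCut i → M.NonObtuse i) {v : Plane → ℝ} {G : Plane → Plane}
    (hv : ∀ x ∈ frontier M.domain, v x = 0)
    (hex : ∀ i k, S.HasEdgeIntegral i k G (v (M.A i (k + 2)) - v (M.A i (k + 1))))
    (huniq : ∀ i k I I', S.HasEdgeIntegral i k G I → S.HasEdgeIntegral i k G I' → I = I') :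
    (∃! w, S.IsNodalInterp βm βp v w) ∧
    (∃! z, S.IsEdgeInterp βm βp μm μp G z) ∧
    ∀ w z, S.IsNodalInterp βm βp v w → S.IsEdgeInterp βm βp μm μp G z →
      S.MemSZero βm βp w ∧ S.MemINDZero βm βp μm μp z ∧ S.IsBrokenGrad w z := by
  classical
  have hdet : ∀ i, tdet (M.A i) ≠ 0 := fun i => tdet_ne_zero (M.affineIndep i)
  set ρ : ι → ℝ := fun i => S.nJump βm βp i with hρ
  set ν : ι → ℝ := fun i => S.cRatio μm μp i with hν
  have hρ1 : ∀ i, -1 < ρ i := by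
    intro i
    simp only [hρ, Interface.nJump]
    split_ifs
    · have : 0 < βm / βp := by positivity
      linarith
    · norm_num
  have hν0 : ∀ i, 0 < ν i := by
    intro i
    simp only [hν, Interface.cRatio]
    split_ifs
    · positivity
    · norm_num
  have huni := fun i => nodal_unisolvent (D := S.D i) (n := S.n i) (hdet i) (hρ1 i) (by
    by_cases hc : S.IsCut i
    · exact Or.inr ⟨S.unit i hc, hM i hc⟩
    · left; simp [hρ, Interface.nJump, hc])
  choose c g hcg using fun i => (huni i).1 fun k => v (M.A i k)
  have hcg' : ∀ i k, pwLin (S.D i) (S.n i) (ρ i) (c i) (g i) (M.A i k) = v (M.A i k) := hcg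
  have hinj : ∀ i c' g', (∀ k, pwLin (S.D i) (S.n i) (ρ i) c' g' (M.A i k) = v (M.A i k)) →
      c' = c i ∧ g' = g i := by
    intro i c' g' h
    obtain ⟨h1, h2⟩ := (huni i).2 (c' - c i) (g' - g i) fun k => by
      have e1 := h k
      have e2 := hcg' i k
      simp only [pwLin] at e1 e2
      rw [inner_sub_left, inner_sub_left]
      linarith
    exact ⟨sub_eq_zero.1 h1, sub_eq_zero.1 h2⟩
  have hvert : ∀ i k, M.A i k ∈ M.tri i := fun i k => subset_convexHull ℝ _ (mem_range_self k)
  have hseg : ∀ i, ∀ P ∈ range (M.A i), ∀ Q ∈ range (M.A i), segment ℝ P Q ⊆ M.tri i :=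
    fun i P hP Q hQ => segment_subset_convexHull hP hQ
  set W : ι → Plane → ℝ := fun i => (M.tri i).indicator
    (pwLin (S.D i) (S.n i) (ρ i) (c i) (g i)) with hW
  -- The field uses the g found by nodal interpolation, without rotational part.
  set Z : ι → Plane → Plane := fun i => (M.tri i).indicator
    (pwND (S.centre i) (S.D i) (S.n i) (ρ i) (ν i) (g i) 0) with hZ
  have hWv : ∀ i, ∀ P ∈ range (M.A i), W i P = v P := by
    rintro i _ ⟨k, rfl⟩
    simp only [hW]
    rw [indicator_of_mem (hvert i k), hcg']
  have hZl : ∀ i, ∀ P ∈ range (M.A i), ∀ Q ∈ range (M.A i), lineInt P Q (Z i) = v Q - v P := by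
    intro i P hP Q hQ
    rw [lineInt_pwND fun x hx => indicator_of_mem (hseg i P hP Q hQ hx) _, ← hWv i P hP,
      ← hWv i Q hQ]
    simp only [hW]
    rw [indicator_of_mem (hseg i P hP Q hQ (left_mem_segment ℝ P Q)),
      indicator_of_mem (hseg i P hP Q hQ (right_mem_segment ℝ P Q))]
    simp only [pwLin]
    ring
  have hWmem : S.MemS βm βp W := by
    refine ⟨fun i => (S.memSLoc_iff hβp i _).2 ⟨c i, g i, fun x hx => indicator_of_mem hx _,
      fun x hx => indicator_of_notMem hx _⟩, fun i j P hP => ?_⟩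
    rw [hWv i P hP.1, hWv j P hP.2]
  have hZmem : S.MemIND βm βp μm μp Z := by
    refine ⟨fun i => (S.memINDLoc_iff hβp hμm hμp i _).2 ⟨g i, 0, fun x hx => indicator_of_mem hx _,
      fun x hx => indicator_of_notMem hx _⟩, fun i j P hP Q hQ => ?_⟩
    rw [hZl i P hP.1 Q hQ.1, hZl j P hP.2 Q hQ.2]
  have hWint : S.IsNodalInterp βm βp v W := ⟨hWmem, fun i k => hWv i _ (mem_range_self k)⟩
  have hZint : S.IsEdgeInterp βm βp μm μp G Z := by
    refine ⟨hZmem, fun i k => ?_⟩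
    rw [hZl i _ (mem_range_self _) _ (mem_range_self _)]
    exact hex i k
  have hWuniq : ∀ w, S.IsNodalInterp βm βp v w → w = W := by
    rintro w ⟨⟨hloc, -⟩, hw⟩
    funext i
    obtain ⟨c', g', h1, h2⟩ := (S.memSLoc_iff hβp i _).1 (hloc i)
    obtain ⟨rfl, rfl⟩ := hinj i c' g' fun k => by rw [← hw i k, h1 _ (hvert i k)]
    funext x
    by_cases hx : x ∈ M.tri i
    · rw [h1 x hx]; exact (indicator_of_mem hx _).symm
    · rw [h2 x hx]; exact (indicator_of_notMem hx _).symm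
  have hZuniq : ∀ z, S.IsEdgeInterp βm βp μm μp G z → z = Z := by
    rintro z ⟨⟨hloc, -⟩, hz⟩
    funext i
    obtain ⟨g', b, h1, h2⟩ := (S.memINDLoc_iff hβp hμm hμp i _).1 (hloc i)
    have hI : ∀ k, lineInt (M.A i (k + 1)) (M.A i (k + 2)) (z i) =
        v (M.A i (k + 2)) - v (M.A i (k + 1)) := fun k => huniq i k _ _ (hz i k) (hex i k)
    -- The prescribed edge integrals are differences of v and telescope around the triangle.
    have hb : b = 0 := by
      refine pwND_rotational_eq_zero (hdet i) (S.centre_mem i) (hν0 i) h1 ?_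
      simp_rw [hI]
      simp [Fin.sum_univ_three]
      ring
    subst hb
    have hI' : ∀ k, pwLin (S.D i) (S.n i) (ρ i) 0 g' (M.A i (k + 2)) -
        pwLin (S.D i) (S.n i) (ρ i) 0 g' (M.A i (k + 1)) =
        v (M.A i (k + 2)) - v (M.A i (k + 1)) := by
      intro k
      rw [← hI k, lineInt_pwND fun x hx => h1 x (hseg i _ (mem_range_self _) _ (mem_range_self _) hx)]
      simp [hρ]
    have hg : g' = g i := by
      -- The constant is chosen to match v at vertex 0. Edges 1 and 2 are those containing vertex 0
      -- and carry the match to the other vertices; indices are modulo 3, so 2 + 2 is vertex 1.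
      refine (hinj i (v (M.A i 0) - pwLin (S.D i) (S.n i) (ρ i) 0 g' (M.A i 0)) g' fun k => ?_).2
      have e1 : pwLin (S.D i) (S.n i) (ρ i) 0 g' (M.A i 0) - _ = v (M.A i 0) - _ := hI' 1
      have e2 : _ - pwLin (S.D i) (S.n i) (ρ i) 0 g' (M.A i 0) = _ - v (M.A i 0) := hI' 2
      have e : ∀ c' x, pwLin (S.D i) (S.n i) (ρ i) c' g' x =
          c' + pwLin (S.D i) (S.n i) (ρ i) 0 g' x := fun c' x => by simp only [pwLin]; ring
      rw [e]
      fin_cases k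
      · exact sub_add_cancel _ _
      · change _ = v (M.A i (2 + 2))
        change _ + pwLin (S.D i) (S.n i) (ρ i) 0 g' (M.A i (2 + 2)) = _
        linarith
      · change _ = v (M.A i (1 + 1))
        change _ + pwLin (S.D i) (S.n i) (ρ i) 0 g' (M.A i (1 + 1)) = _
        linarith
    subst hg
    funext x
    by_cases hx : x ∈ M.tri i
    · rw [h1 x hx]; exact (indicator_of_mem hx _).symm
    · rw [h2 x hx]; exact (indicator_of_notMem hx _).symm
  refine ⟨⟨W, hWint, hWuniq⟩, ⟨Z, hZint, hZuniq⟩, fun w z hw hz => ?_⟩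
  obtain rfl := hWuniq w hw
  obtain rfl := hZuniq z hz
  have hsign : ∀ i k, M.edge i k ⊆ frontier M.domain → ρ i = 0 ∨
      0 ≤ inner ℝ (M.A i (k + 1) - S.D i) (S.n i) * inner ℝ (M.A i (k + 2) - S.D i) (S.n i) := by
    intro i k hk
    by_cases hc : S.IsCut i
    · exact Or.inr (S.level_mul_nonneg_of_frontier hc hk)
    · left; simp [hρ, Interface.nJump, hc]
  have hend : ∀ i k, M.edge i k ⊆ frontier M.domain →
      pwLin (S.D i) (S.n i) (ρ i) (c i) (g i) (M.A i (k + 1)) = 0 ∧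
      pwLin (S.D i) (S.n i) (ρ i) (c i) (g i) (M.A i (k + 2)) = 0 := by
    intro i k hk
    rw [hcg', hcg', hv _ (hk (left_mem_segment ℝ _ _)), hv _ (hk (right_mem_segment ℝ _ _))]
    simp
  refine ⟨⟨hWmem, fun i k hk x hx => ?_⟩, ⟨hZmem, fun i k hk x hx => ?_⟩, fun i x hx hl => ?_⟩
  · simp only [hW]
    rw [indicator_of_mem (hseg i _ (mem_range_self _) _ (mem_range_self _) hx)]
    obtain ⟨a, b, ha, hb, hab, rfl⟩ := hx
    rw [pwLin_combo (hsign i k hk) ha hb hab, (hend i k hk).1, (hend i k hk).2]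
    simp
  · simp only [hZ]
    rw [indicator_of_mem (hseg i _ (mem_range_self _) _ (mem_range_self _)
      (openSegment_subset_segment ℝ _ _ hx))]
    exact inner_pwND_eq_zero (hsign i k hk) ((hend i k hk).1.trans (hend i k hk).2.symm) hx
  · have e : Z i x = pwND (S.centre i) (S.D i) (S.n i) (ρ i) (ν i) (g i) 0 x :=
      indicator_of_mem (interior_subset hx) _
    rw [e]
    refine (hasGradientAt_pwLin (c := c i) ?_).congr_of_eventuallyEq ?_
    · by_cases hc : S.IsCut i
      · exact Or.inr (hl hc)
      · left; simp [hρ, Interface.nJump, hc]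
    · filter_upwards [mem_interior_iff_mem_nhds.1 hx] with y hy
      exact indicator_of_mem hy _

end

end IFE

theorem mainTheorem7 {ι : Type*} [Finite ι] (M : IFE.Mesh ι) (S : IFE.Interface M)
    (βm βp μm μp : ℝ) (hβm : 0 < βm) (hβp : 0 < βp) (hμm : 0 < μm) (hμp : 0 < μp)
    (hM : ∀ i, S.IsCut i → M.NonObtuse i)
    (v : IFE.Plane → ℝ) (hv : S.MemH2Zero βm βp v)
    (G : IFE.Plane → IFE.Plane) (hG : IFE.HasWeakGrad (S.Ωm ∪ S.Ωp) v G) :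
    (∃! w, S.IsNodalInterp βm βp v w) ∧
    (∃! z, S.IsEdgeInterp βm βp μm μp G z) ∧
    ∀ w z, S.IsNodalInterp βm βp v w → S.IsEdgeInterp βm βp μm μp G z →
      S.MemSZero βm βp w ∧ S.MemINDZero βm βp μm μp z ∧ S.IsBrokenGrad w z :=
  S.commuting_of_edgeIntegral hβm hβp hμm hμp hM hv.zero (hv.hasEdgeIntegral hG)
    fun _ _ _ _ h h' => h.unique h'
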